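/- Let $F$ be the free group of rank $n$ with free basis $a_1,\dots,a_n$, let $\mathcal T$ be its Cayley graph (a tree, on which $F$ acts on the left), and let $w_1,\dots,w_m$ be a finite list of words in $F$. The line pattern $\mathcal L$ is the set of lines $\{g w_i^k\}_{k\in\mathbb Z}$, $g\in F$, $w_i \ne 1$ (the axis of $g w_i g^{-1}$ in $\mathcal T$), and the decomposition space $\mathcal D$ is the quotient of $\partial_\infty F=\partial_\infty\mathcal T$ that identifies the two end points of each line in $\mathcal L$; let $q:\partial_\infty F\to\mathcal D$ be the quotient map. The Čech cohomology group $\check H^0(\mathcal D,\mathbb Z)$ is the direct limit over all open covers $\mathcal U$ of $\mathcal D$ of $H^0(\mathcal U,\mathbb Z)=\ker(d^0:C^0(\mathcal U)\to C^1(\mathcal U))$; it is a right $F$-module, where $g\in F$ acts by pullback along $d\mapsto gd$. For a finite nonempty subtree $\mathcal X$ of $\mathcal T$, the Whitehead graph $\mathrm{Wh}(\mathcal X)$ has as vertices the vertices of $\mathcal T$ adjacent to $\mathcal X$, two of them joined when a line of $\mathcal L$ passes through both. A cover associated to $\mathcal X$ is an open cover $\{U_a\}$ of $\mathcal D$ indexed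 by the vertices $a$ of $\mathrm{Wh}(\mathcal X)$ such that $U_a$ contains the $q$-image of the shadow of $a$ from $\mathcal X$, $U_a\cap U_b\neq\emptyset$ (for $a\ne b$) iff $a,b$ are joined in $\mathrm{Wh}(\mathcal X)$, and there are no triple intersections; the cover associated to $\mathcal X=\emptyset$ is $\{\mathcal D\}$. A class is supported on $\mathcal X$ if it is represented by an element of $H^0(\mathcal U,\mathbb Z)$ for a cover $\mathcal U$ associated to $\mathcal X$; a support of a class is a minimal finite (possibly empty) subtree on which it is supported. Let $B_R$ be the ball of radius $R$ in $\mathcal T$ about the identity vertex. Given classes $\sigma_1,\dots,\sigma_k\in\check H^0(\mathcal D,\mathbb Z)$, let $p:\mathbb ZF^k\to\check H^0(\mathcal D,\mathbb Z)$ be the homomorphism of right $F$-modules with $p(e_j)=\sigma_j$. Given supports $\mathcal X_j$ of the $\sigma_j$, define the support of $x=\sum n_{ij}e_jg_{ij}\in\mathbb ZF^k$ (in reduced form, all $n_{ij}\ne0$) to be the convex hull of $\bigcup_{i,j} g_{ij}^{-1}\mathcal X_j$. **Theorem.** There are computable functions $R_0$ of $(n;w_1,\dots,w_m)$ and $N$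 of $(n;w_1,\dots,w_m;R)$ with the following property. Let $n\ge 0$, words $w_1,\dots,w_m$ and $R\ge0$ be given, write $R_0=R_0(n;w_1,\dots,w_m)$ and $N=N(n;w_1,\dots,w_m;R)$, and let $\sigma_1,\dots,\sigma_k$ be classes supported on $B_R$ such that every class supported on $B_{R_0}$ is a $\mathbb Z$-linear combination of translates $\sigma_j g$ with $g\in B_R$. Then $p$ is surjective and, for every choice of supports $\mathcal X_j$ of the $\sigma_j$, $\ker p$ is generated as an abelian group by those of its elements whose supports have at most $N$ vertices. In particular this applies with $R=R_0$ whenever $\sigma_1,\dots,\sigma_k$ is a finite generating set of the group of classes supported on $B_{R_0}$ (the computed generators); the bound $N$ is then a computable function of $n$ and $\mathcal L$ alone. -/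

import Mathlib

open Set TopologicalSpace

noncomputable section

/-! ## Čech cohomology in degree zero, for an arbitrary topological space -/

namespace CechZero

variable {X Y Z : Type} [TopologicalSpace X] [TopologicalSpace Y] [TopologicalSpace Z]

/-- An open cover of `X`. -/
structure OpenCover (X : Type) [TopologicalSpace X] where
  /-- the members of the cover -/
  sets : Set (Opens X)
  covers : ∀ x : X, ∃ U ∈ sets, x ∈ U

/-- Open covers are ordered by refinement: `𝒰 ≤ 𝒱` when `𝒱` refines `𝒰`. -/
instance : Preorder (OpenCover X) where
  le 𝒰 𝒱 := ∀ V ∈ 𝒱.sets, ∃ U ∈ 𝒰.sets, V ≤ U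
  le_refl _ V hV := ⟨V, hV, le_rfl⟩
  le_trans _ _ _ h₁ h₂ W hW := by
    obtain ⟨V, hV, hWV⟩ := h₂ W hW
    obtain ⟨U, hU, hVU⟩ := h₁ V hV
    exact ⟨U, hU, hWV.trans hVU⟩

instance : DecidableEq (OpenCover X) := Classical.decEq _

/-- The vertices of the nerve: the nonempty members of the cover. -/
def Vertex (𝒰 : OpenCover X) : Type :=
  {U : Opens X // U ∈ 𝒰.sets ∧ (U : Set X).Nonempty}

/-- The ordered pairs of vertices of the nerve whose intersection is nonempty. -/
def Edge (𝒰 : OpenCover X) : Type :=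
  {e : Vertex 𝒰 × Vertex 𝒰 // ((e.1.1 : Set X) ∩ (e.2.1 : Set X)).Nonempty}

/-- The coboundary `d⁰ : C⁰(𝒰, ℤ) → C¹(𝒰, ℤ)`. -/
def coboundary (𝒰 : OpenCover X) : (Vertex 𝒰 → ℤ) →+ (Edge 𝒰 → ℤ) where
  toFun f e := f e.1.2 - f e.1.1
  map_zero' := by ext e; simp
  map_add' f g := by ext e; simp only [Pi.add_apply]; ring

/-- `H⁰(𝒰, ℤ)`, the kernel of `d⁰`. -/
abbrev H0 (𝒰 : OpenCover X) : Type := (coboundary 𝒰).ker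

theorem H0.eq_of_inter {𝒰 : OpenCover X} (f : H0 𝒰) (U V : Vertex 𝒰)
    (h : ((U.1 : Set X) ∩ (V.1 : Set X)).Nonempty) : f.1 U = f.1 V := by
  have := congrFun ((AddMonoidHom.mem_ker).1 f.2) ⟨(U, V), h⟩
  have h2 : f.1 V - f.1 U = 0 := this
  omega

/-- A refinement function between the vertex sets of the nerves. -/
def refine {𝒰 𝒱 : OpenCover X} (h : 𝒰 ≤ 𝒱) (V : Vertex 𝒱) : Vertex 𝒰 :=
  ⟨(h V.1 V.2.1).choose, (h V.1 V.2.1).choose_spec.1,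
    V.2.2.mono (h V.1 V.2.1).choose_spec.2⟩

theorem le_refine {𝒰 𝒱 : OpenCover X} (h : 𝒰 ≤ 𝒱) (V : Vertex 𝒱) : V.1 ≤ (refine h V).1 :=
  (h V.1 V.2.1).choose_spec.2

/-- The map `H⁰(𝒰, ℤ) → H⁰(𝒱, ℤ)` induced by a refinement. -/
def res (𝒰 𝒱 : OpenCover X) (h : 𝒰 ≤ 𝒱) : H0 𝒰 →+ H0 𝒱 where
  toFun f := ⟨fun V => f.1 (refine h V), by
    rw [AddMonoidHom.mem_ker]
    funext e
    refine sub_eq_zero.2 (H0.eq_of_inter f _ _ ?_)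
    rw [inter_comm]
    exact e.2.mono (inter_subset_inter (le_refine h _) (le_refine h _))⟩
  map_zero' := rfl
  map_add' _ _ := rfl

/-- The induced map does not depend on the choice of the refinement function. -/
theorem res_apply {𝒰 𝒱 : OpenCover X} (h : 𝒰 ≤ 𝒱) (f : H0 𝒰) (V : Vertex 𝒱) (U : Vertex 𝒰)
    (hVU : V.1 ≤ U.1) : (res 𝒰 𝒱 h f).1 V = f.1 U :=
  H0.eq_of_inter f _ _ (V.2.2.mono (subset_inter (le_refine h V) hVU))

variable (X) in
/-- `Ȟ⁰(X, ℤ)`, the direct limit of `H⁰(𝒰, ℤ)` over all open covers `𝒰` of `X`. -/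
def Cech : Type := AddCommGroup.DirectLimit (fun 𝒰 : OpenCover X => H0 𝒰) res

instance : AddCommGroup (Cech X) :=
  inferInstanceAs (AddCommGroup (AddCommGroup.DirectLimit (fun 𝒰 : OpenCover X => H0 𝒰) res))

/-- The canonical map `H⁰(𝒰, ℤ) → Ȟ⁰(X, ℤ)`. -/
def toCech (𝒰 : OpenCover X) : H0 𝒰 →+ Cech X :=
  AddCommGroup.DirectLimit.of (fun 𝒰 : OpenCover X => H0 𝒰) res 𝒰

theorem toCech_res {𝒰 𝒱 : OpenCover X} (h : 𝒰 ≤ 𝒱) (f : H0 𝒰) :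
    toCech 𝒱 (res 𝒰 𝒱 h f) = toCech 𝒰 f :=
  AddCommGroup.DirectLimit.of_f h f

theorem Cech.hom_ext {A : Type} [AddCommGroup A] {a b : Cech X →+ A}
    (h : ∀ 𝒰 f, a (toCech 𝒰 f) = b (toCech 𝒰 f)) : a = b :=
  AddCommGroup.DirectLimit.hom_ext (f := res) (P := A)
    fun 𝒰 => AddMonoidHom.ext fun f => h 𝒰 f

/-- The pullback `φ⁻¹𝒰` of an open cover under a homeomorphism, consisting of the sets `V` with
`φ(V) ∈ 𝒰`. -/
def OpenCover.pullback (φ : X ≃ₜ Y) (𝒰 : OpenCover Y) : OpenCover X where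
  sets := {V | Opens.comap (φ.symm : C(Y, X)) V ∈ 𝒰.sets}
  covers x := by
    obtain ⟨U, hU, hx⟩ := 𝒰.covers (φ x)
    refine ⟨Opens.comap (φ : C(X, Y)) U, ?_, hx⟩
    have : Opens.comap (φ.symm : C(Y, X)) (Opens.comap (φ : C(X, Y)) U) = U := by
      ext y; simp
    simpa [this] using hU

/-- The vertex `φ(V)` of the nerve of `𝒰`, for a vertex `V` of the nerve of `φ⁻¹𝒰`. -/
def Vertex.push (φ : X ≃ₜ Y) {𝒰 : OpenCover Y} (V : Vertex (𝒰.pullback φ)) : Vertex 𝒰 :=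
  ⟨Opens.comap (φ.symm : C(Y, X)) V.1, V.2.1, by
    obtain ⟨x, hx⟩ := V.2.2
    exact ⟨φ x, by simpa using hx⟩⟩

/-- The map `H⁰(𝒰, ℤ) → H⁰(φ⁻¹𝒰, ℤ)` induced by a homeomorphism. -/
def pullH0 (φ : X ≃ₜ Y) (𝒰 : OpenCover Y) : H0 𝒰 →+ H0 (𝒰.pullback φ) where
  toFun f := ⟨fun V => f.1 (V.push φ), by
    rw [AddMonoidHom.mem_ker]
    funext e
    refine sub_eq_zero.2 (H0.eq_of_inter f _ _ ?_)
    obtain ⟨x, hx1, hx2⟩ := e.2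
    exact ⟨φ x, by simpa [Vertex.push] using hx2, by simpa [Vertex.push] using hx1⟩⟩
  map_zero' := rfl
  map_add' _ _ := rfl

theorem OpenCover.pullback_mono (φ : X ≃ₜ Y) {𝒰 𝒱 : OpenCover Y} (h : 𝒰 ≤ 𝒱) :
    𝒰.pullback φ ≤ 𝒱.pullback φ := by
  intro V hV
  obtain ⟨U, hU, hVU⟩ := h _ hV
  refine ⟨Opens.comap (φ : C(X, Y)) U, ?_, ?_⟩
  · have : Opens.comap (φ.symm : C(Y, X)) (Opens.comap (φ : C(X, Y)) U) = U := by
      ext y; simp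
    simpa [OpenCover.pullback, this] using hU
  · intro x hx
    exact hVU (show φ x ∈ Opens.comap (φ.symm : C(Y, X)) V by simpa using hx)

/-- The map `φ^* : Ȟ⁰(Y, ℤ) → Ȟ⁰(X, ℤ)` induced by a homeomorphism `φ : X → Y`. -/
def pull (φ : X ≃ₜ Y) : Cech Y →+ Cech X :=
  AddCommGroup.DirectLimit.lift (fun 𝒰 : OpenCover Y => H0 𝒰) res (Cech X)
    (fun 𝒰 => (toCech (𝒰.pullback φ)).comp (pullH0 φ 𝒰)) (by
      intro 𝒰 𝒱 h f
      have key : pullH0 φ 𝒱 (res 𝒰 𝒱 h f) =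
          res _ _ (OpenCover.pullback_mono φ h) (pullH0 φ 𝒰 f) := by
        apply Subtype.ext
        funext V
        refine (res_apply h f _ _ ?_)
        intro y hy
        exact le_refine (OpenCover.pullback_mono φ h) V hy
      simp only [AddMonoidHom.comp_apply]
      rw [key, toCech_res])

theorem pull_toCech (φ : X ≃ₜ Y) (𝒰 : OpenCover Y) (f : H0 𝒰) :
    pull φ (toCech 𝒰 f) = toCech (𝒰.pullback φ) (pullH0 φ 𝒰 f) :=
  AddCommGroup.DirectLimit.lift_of _ _ _ _ _

/-- Two classes given on a cover and on a refinement of it are equal if their values agree. -/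
theorem toCech_eq {𝒰 𝒱 : OpenCover X} (h : 𝒰 ≤ 𝒱) (f : H0 𝒰) (g : H0 𝒱)
    (hfg : ∀ V : Vertex 𝒱, ∃ U : Vertex 𝒰, V.1 ≤ U.1 ∧ f.1 U = g.1 V) :
    toCech 𝒰 f = toCech 𝒱 g := by
  rw [← toCech_res h f]
  congr 1
  apply Subtype.ext
  funext V
  obtain ⟨U, hVU, hU⟩ := hfg V
  rw [res_apply h f V U hVU, hU]

theorem pull_refl : pull (Homeomorph.refl X) = AddMonoidHom.id (Cech X) := by
  refine Cech.hom_ext fun 𝒰 f => ?_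
  rw [pull_toCech]
  symm
  exact toCech_eq (fun V hV => ⟨V, hV, le_rfl⟩) _ _ fun V => ⟨⟨V.1, V.2⟩, le_rfl, rfl⟩

theorem pull_trans (φ : X ≃ₜ Y) (ψ : Y ≃ₜ Z) :
    pull (φ.trans ψ) = (pull φ).comp (pull ψ) := by
  refine Cech.hom_ext fun 𝒰 f => ?_
  rw [AddMonoidHom.comp_apply, pull_toCech, pull_toCech, pull_toCech]
  exact toCech_eq (fun V hV => ⟨V, hV, le_rfl⟩) _ _ fun V => ⟨⟨V.1, V.2⟩, le_rfl, rfl⟩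

end CechZero

/-! ## The Cayley tree, its boundary, line patterns and the decomposition space -/

namespace LinePattern

open CechZero MulOpposite

/-- The free group `F` of rank `n`. -/
abbrev F (n : ℕ) : Type := FreeGroup (Fin n)

/-- The Cayley graph `𝒯` of `F` with respect to the free basis; `F` acts on it on the left. -/
abbrev tree (n : ℕ) : SimpleGraph (F n) := SimpleGraph.mulCayley (range FreeGroup.of)

theorem tree_adj_smul {n : ℕ} (g : F n) {a b : F n} (h : (tree n).Adj a b) :
    (tree n).Adj (g * a) (g * b) := by
  rw [SimpleGraph.mulCayley_adj'] at h ⊢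
  obtain ⟨hne, s, hs, h | h⟩ := h
  · exact ⟨by simpa using hne, s, hs, Or.inl (by rw [mul_assoc, h])⟩
  · exact ⟨by simpa using hne, s, hs, Or.inr (by rw [mul_assoc, ← h])⟩

/-- A geodesic ray in the tree `𝒯`: an infinite edge path without backtracking. -/
structure Ray (n : ℕ) where
  /-- the vertices of the ray -/
  pt : ℕ → F n
  adj : ∀ k, (tree n).Adj (pt k) (pt (k + 1))
  noBacktrack : ∀ k, pt (k + 2) ≠ pt k

/-- Two rays are asymptotic if they coincide from some point on, up to a shift. -/
instance rayRel (n : ℕ) : Setoid (Ray n) where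
  r ρ τ := ∃ a b, ∀ k, ρ.pt (a + k) = τ.pt (b + k)
  iseqv :=
    { refl := fun _ => ⟨0, 0, fun _ => rfl⟩
      symm := fun ⟨a, b, h⟩ => ⟨b, a, fun k => (h k).symm⟩
      trans := by
        rintro ρ τ υ ⟨a, b, h⟩ ⟨c, d, h'⟩
        refine ⟨a + c, d + b, fun k => ?_⟩
        rw [show a + c + k = a + (c + k) by omega, h, show b + (c + k) = c + (b + k) by omega, h',
          show d + b + k = d + (b + k) by omega] }

/-- The boundary `∂_∞ F = ∂_∞ 𝒯`: geodesic rays up to being asymptotic. -/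
def Boundary (n : ℕ) : Type := Quotient (rayRel n)

/-- The end of a ray. -/
def Ray.limit {n : ℕ} (ρ : Ray n) : Boundary n := Quotient.mk (rayRel n) ρ

/-- The shadow `S^x(v)`: the boundary points `ξ` such that the geodesic `[x, ξ]` contains `v`. -/
def shadow {n : ℕ} (x v : F n) : Set (Boundary n) :=
  {ξ | ∃ ρ : Ray n, ρ.pt 0 = x ∧ (∃ k, ρ.pt k = v) ∧ ρ.limit = ξ}

/-- The topology on `∂_∞ F` generated by the shadows. The shadows from any one fixed base point
generate the same topology, because every other shadow is a finite union of shadows from it. -/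
instance (n : ℕ) : TopologicalSpace (Boundary n) :=
  generateFrom {S | ∃ x v, S = shadow x v}

instance (n : ℕ) : SMul (F n) (Ray n) where
  smul g ρ :=
    { pt := fun k => g * ρ.pt k
      adj := fun k => tree_adj_smul g (ρ.adj k)
      noBacktrack := fun k h => ρ.noBacktrack k (mul_left_cancel h) }

theorem Ray.smul_pt {n : ℕ} (g : F n) (ρ : Ray n) (k : ℕ) : (g • ρ).pt k = g * ρ.pt k := rfl

/-- The left action of `F` on `∂_∞ F`. -/
instance (n : ℕ) : MulAction (F n) (Boundary n) where
  smul g := Quotient.map (g • ·) fun ρ τ ⟨a, b, h⟩ =>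
    ⟨a, b, fun k => by simp only [Ray.smul_pt, h]⟩
  one_smul ξ := by
    induction ξ using Quotient.inductionOn with
    | h ρ => exact Quotient.sound ⟨0, 0, fun k => by simp [Ray.smul_pt]⟩
  mul_smul g h ξ := by
    induction ξ using Quotient.inductionOn with
    | h ρ => exact Quotient.sound ⟨0, 0, fun k => by simp [Ray.smul_pt, mul_assoc]⟩

theorem Ray.smul_limit {n : ℕ} (g : F n) (ρ : Ray n) : g • ρ.limit = (g • ρ).limit := rfl

theorem preimage_shadow {n : ℕ} (g x v : F n) :
    (fun ξ : Boundary n => g • ξ) ⁻¹' shadow x v = shadow (g⁻¹ * x) (g⁻¹ * v) := by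
  ext ξ
  constructor
  · rintro ⟨ρ, h0, ⟨k, hk⟩, h⟩
    refine ⟨g⁻¹ • ρ, by simp [Ray.smul_pt, h0], ⟨k, by simp [Ray.smul_pt, hk]⟩, ?_⟩
    rw [← Ray.smul_limit, h, inv_smul_smul]
  · rintro ⟨ρ, h0, ⟨k, hk⟩, h⟩
    refine ⟨g • ρ, by simp [Ray.smul_pt, h0], ⟨k, by simp [Ray.smul_pt, hk]⟩, ?_⟩
    rw [← Ray.smul_limit, h]

instance (n : ℕ) : ContinuousConstSMul (F n) (Boundary n) where
  continuous_const_smul g := by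
    refine continuous_generateFrom_iff.2 ?_
    rintro S ⟨x, v, rfl⟩
    rw [preimage_shadow]
    exact isOpen_generateFrom_of_mem ⟨_, _, rfl⟩

/-- A bi-infinite geodesic in the tree `𝒯`. -/
structure Geodesic (n : ℕ) where
  /-- the vertices of the geodesic -/
  pt : ℤ → F n
  adj : ∀ k, (tree n).Adj (pt k) (pt (k + 1))
  noBacktrack : ∀ k, pt (k + 2) ≠ pt k

/-- The ray of a bi-infinite geodesic in the positive direction. -/
def Geodesic.posRay {n : ℕ} (l : Geodesic n) : Ray n where
  pt k := l.pt k
  adj k := by exact_mod_cast l.adj k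
  noBacktrack k := by exact_mod_cast l.noBacktrack k

/-- The ray of a bi-infinite geodesic in the negative direction. -/
def Geodesic.negRay {n : ℕ} (l : Geodesic n) : Ray n where
  pt k := l.pt (-k)
  adj k := by
    have h := (l.adj (-((k + 1 : ℕ) : ℤ))).symm
    rwa [show (-((k + 1 : ℕ) : ℤ)) + 1 = -(k : ℤ) by push_cast; ring] at h
  noBacktrack k := by
    have h := (l.noBacktrack (-((k + 2 : ℕ) : ℤ))).symm
    rwa [show (-((k + 2 : ℕ) : ℤ)) + 2 = -(k : ℤ) by push_cast; ring] at h

/-- `l` is the line of the coset `{g w^k}_k`, that is, the axis of `g w g⁻¹`: the bi-infinite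
geodesic along which `g w g⁻¹` translates. Its ends are the limits of `g w^k` as `k → ±∞`, and it
passes through all the `g w^k` if `w` is cyclically reduced. If `w = 1` there is no such line. -/
def Geodesic.IsLineOf {n : ℕ} (l : Geodesic n) (g w : F n) : Prop :=
  ∃ m : ℤ, 0 < m ∧ ∀ k, l.pt (k + m) = g * w * g⁻¹ * l.pt k

/-- The line pattern `ℒ` associated to a set `W` of elements of `F`. -/
def pattern {n : ℕ} (W : Set (F n)) : Set (Geodesic n) :=
  {l | ∃ g : F n, ∃ w ∈ W, l.IsLineOf g w}

/-- The relation identifying the two end points of each line in `ℒ`. -/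
def endRel {n : ℕ} (W : Set (F n)) (ξ η : Boundary n) : Prop :=
  ∃ l ∈ pattern W, l.posRay.limit = ξ ∧ l.negRay.limit = η

/-- The decomposition space `𝒟`, the quotient of `∂_∞ F` by the equivalence relation generated by
`endRel`, with the quotient topology. -/
def Decomp {n : ℕ} (W : Set (F n)) : Type := Quot (endRel W)

section

variable {n : ℕ} {W : Set (F n)}

instance : TopologicalSpace (Decomp W) :=
  inferInstanceAs (TopologicalSpace (Quot (endRel W)))

variable (W) in
/-- The quotient projection `q : ∂_∞ F → 𝒟`. -/
def proj : Boundary n → Decomp W := Quot.mk (endRel W)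

/-- The translate of a bi-infinite geodesic. -/
def Geodesic.translate (g : F n) (l : Geodesic n) : Geodesic n where
  pt k := g * l.pt k
  adj k := tree_adj_smul g (l.adj k)
  noBacktrack k h := l.noBacktrack k (mul_left_cancel h)

theorem translate_mem_pattern (g : F n) {l : Geodesic n} (h : l ∈ pattern W) :
    l.translate g ∈ pattern W := by
  obtain ⟨a, w, hw, m, hm, hl⟩ := h
  refine ⟨g * a, w, hw, m, hm, fun k => ?_⟩
  simp only [Geodesic.translate, hl]
  group

theorem endRel_smul (g : F n) {ξ η : Boundary n} (h : endRel W ξ η) :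
    endRel W (g • ξ) (g • η) := by
  obtain ⟨l, hl, rfl, rfl⟩ := h
  exact ⟨l.translate g, translate_mem_pattern g hl, rfl, rfl⟩

/-- The action of `F` on `∂_∞ F` descends to `𝒟`. -/
instance : MulAction (F n) (Decomp W) where
  smul g := Quot.map (g • ·) fun _ _ h => endRel_smul g h
  one_smul d := by
    induction d using Quot.inductionOn with
    | h ξ => exact congrArg (Quot.mk (endRel W)) (one_smul (F n) ξ)
  mul_smul g h d := by
    induction d using Quot.inductionOn with
    | h ξ => exact congrArg (Quot.mk (endRel W)) (mul_smul g h ξ)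

instance : ContinuousConstSMul (F n) (Decomp W) where
  continuous_const_smul g :=
    continuous_quot_lift _ (continuous_quot_mk.comp (continuous_const_smul g))

/-- The right action of `F` on `Ȟ⁰(𝒟, ℤ)`: a class `c` is sent by `g` to its pullback under the
homeomorphism `d ↦ g d` of `𝒟`. A right action of `F` is a left action of `Fᵐᵒᵖ`. -/
instance : DistribMulAction (F n)ᵐᵒᵖ (Cech (Decomp W)) where
  smul g c := pull (Homeomorph.smul g.unop) c
  one_smul c := by
    change pull (Homeomorph.smul (1 : F n)) c = c
    have h : (Homeomorph.smul (1 : F n) : Decomp W ≃ₜ Decomp W) = Homeomorph.refl _ := by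
      ext d; exact one_smul (F n) d
    rw [h, pull_refl]; rfl
  mul_smul g h c := by
    change pull (Homeomorph.smul (h.unop * g.unop)) c =
      pull (Homeomorph.smul g.unop) (pull (Homeomorph.smul h.unop) c)
    have e : (Homeomorph.smul (h.unop * g.unop) : Decomp W ≃ₜ Decomp W) =
        (Homeomorph.smul g.unop).trans (Homeomorph.smul h.unop) := by
      ext d; exact mul_smul h.unop g.unop d
    rw [e, pull_trans]; rfl
  smul_zero g := map_zero (pull (Homeomorph.smul g.unop))
  smul_add g := map_add (pull (Homeomorph.smul g.unop))

/-! ## Subtrees, Whitehead graphs, supports -/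

/-- The vertex set of a (possibly empty) subtree of `𝒯`. -/
def IsSubtree (X : Set (F n)) : Prop := ((tree n).induce X).Preconnected

/-- The hull of a set of vertices: the smallest subtree containing it. -/
def hull (S : Set (F n)) : Set (F n) := ⋂₀ {Y | IsSubtree Y ∧ S ⊆ Y}

/-- The ball of radius `R` centred at the identity vertex. -/
def ball (n R : ℕ) : Set (F n) := {v | v.norm ≤ R}

/-- The vertices of the Whitehead graph `Wh(X)`: the vertices of `𝒯` adjacent to `X`. -/
def WhVertex (X : Set (F n)) : Type := {a : F n // a ∉ X ∧ ∃ x ∈ X, (tree n).Adj x a}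

variable (W) in
/-- Adjacency in the Whitehead graph `Wh(X)`: some line of the pattern passes through both vertices.
(The multiplicities of the edges play no role here.) -/
def WhAdj {X : Set (F n)} (a b : WhVertex X) : Prop :=
  a ≠ b ∧ ∃ l ∈ pattern W, (∃ i, l.pt i = a.1) ∧ ∃ j, l.pt j = b.1

/-- The shadow of a vertex `a` of `Wh(X)` from `X`: the boundary points separated from `X` by `a`.
This is the shadow `S^x(a)` for every `x ∈ X`. -/
def WhShadow {X : Set (F n)} (a : WhVertex X) : Set (Boundary n) := ⋃ x ∈ X, shadow x a.1

/-- `𝒰` is an open cover of `𝒟` associated to the subtree `X`. For the empty subtree it is the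
trivial cover `{𝒟}`. For a nonempty subtree `X` its members are open sets `U a`, indexed by the
vertices `a` of `Wh(X)`, such that `U a` contains the image of the shadow of `a`, two of them meet
exactly when there is an edge between their indices, and there are no triple intersections. -/
def IsCoverOf (X : Set (F n)) (𝒰 : OpenCover (Decomp W)) : Prop :=
  (X = ∅ ∧ 𝒰.sets = {⊤}) ∨
  (X.Nonempty ∧ ∃ U : WhVertex X → Opens (Decomp W),
    𝒰.sets = range U ∧
    (∀ a, proj W '' WhShadow a ⊆ U a) ∧
    (∀ a b, a ≠ b → (((U a : Set (Decomp W)) ∩ U b).Nonempty ↔ WhAdj W a b)) ∧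
    (∀ a b c, a ≠ b → b ≠ c → a ≠ c → (U a : Set (Decomp W)) ∩ U b ∩ U c = ∅))

/-- The class `c` is supported on the finite subtree `X`: it is represented by an element of
`H⁰(𝒰, ℤ)` for a cover `𝒰` associated to `X`. -/
def SupportedOn (c : Cech (Decomp W)) (X : Set (F n)) : Prop :=
  X.Finite ∧ IsSubtree X ∧ ∃ 𝒰 : OpenCover (Decomp W), IsCoverOf X 𝒰 ∧ ∃ f, toCech 𝒰 f = c

/-- `X` is a support of the class `c`: a minimal finite subtree on which `c` is supported. -/
def IsSupport (c : Cech (Decomp W)) (X : Set (F n)) : Prop := Minimal (SupportedOn c) X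

/-! ## The presentation map -/

/-- The free right `ℤF`-module `ℤF^k`; `x j` is the coefficient `∑_i n_{ij} g_{ij}` of `e_j`. -/
abbrev FreeMod (n k : ℕ) : Type := Fin k → MonoidAlgebra ℤ (F n)

/-- The homomorphism `p : ℤF^k → Ȟ⁰(𝒟, ℤ)` of right `F`-modules with `p(e_j) = σ_j`, that is,
`p(∑ n_{ij} e_j g_{ij}) = ∑ n_{ij} σ_j g_{ij}`. -/
def presMap {k : ℕ} (σ : Fin k → Cech (Decomp W)) : FreeMod n k →+ Cech (Decomp W) where
  toFun x := ∑ j, (x j).coeff.sum fun g m => m • (op g • σ j)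
  map_zero' := by simp
  map_add' x y := by
    rw [← Finset.sum_add_distrib]
    refine Finset.sum_congr rfl fun j _ => ?_
    rw [Pi.add_apply, MonoidAlgebra.coeff_add]
    exact Finsupp.sum_add_index' (by simp) (by intros; rw [add_smul])

theorem presMap_apply {k : ℕ} (σ : Fin k → Cech (Decomp W)) (x : FreeMod n k) :
    presMap σ x = ∑ j, (x j).coeff.sum fun g m => m • (op g • σ j) := rfl

theorem presMap_single {k : ℕ} (σ : Fin k → Cech (Decomp W)) (j : Fin k) (g : F n) (m : ℤ) :
    presMap σ (Pi.single j (MonoidAlgebra.single g m)) = m • (op g • σ j) := by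
  rw [presMap_apply, Finset.sum_eq_single j]
  · simp [MonoidAlgebra.coeff_single]
  · intro i _ hi
    simp [Pi.single_eq_of_ne hi]
  · simp

/-- `p` is a homomorphism of right `F`-modules. -/
theorem presMap_mul {k : ℕ} (σ : Fin k → Cech (Decomp W)) (x : FreeMod n k) (h : F n) :
    presMap σ (fun j => x j * MonoidAlgebra.single h 1) = op h • presMap σ x := by
  have key : ∀ (c : Cech (Decomp W)) (y : MonoidAlgebra ℤ (F n)),
      ((y * MonoidAlgebra.single h 1).coeff.sum fun g m => m • (op g • c)) =
        op h • (y.coeff.sum fun g m => m • (op g • c)) := by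
    intro c y
    induction y using MonoidAlgebra.induction_linear with
    | zero => simp
    | add y z hy hz =>
      rw [add_mul, MonoidAlgebra.coeff_add, MonoidAlgebra.coeff_add,
        Finsupp.sum_add_index' (by simp) (by intros; rw [add_smul]),
        Finsupp.sum_add_index' (by simp) (by intros; rw [add_smul]), hy, hz, smul_add]
    | single g m =>
      rw [MonoidAlgebra.single_mul_single]
      rw [MonoidAlgebra.coeff_single, MonoidAlgebra.coeff_single,
        Finsupp.sum_single_index (by simp), Finsupp.sum_single_index (by simp), mul_one, op_mul,
        mul_smul, smul_comm]
  rw [presMap_apply, presMap_apply, Finset.smul_sum]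
  exact Finset.sum_congr rfl fun j _ => key _ _

/-- The support of an element `x = ∑ n_{ij} e_j g_{ij}` of `ℤF^k`, namely
`hull (⋃ g_{ij}⁻¹ X_j)`, where `X_j` is the support of the `j`-th generator. -/
def relSupport {k : ℕ} (X : Fin k → Set (F n)) (x : FreeMod n k) : Set (F n) :=
  hull (⋃ j, ⋃ g ∈ (x j).coeff.support, (fun v => g⁻¹ * v) '' X j)

end

/-- A list of words in the letters `a_i^{±1}`, `i < n`, as input data for an algorithm: the letter
`a_i` is `(i, true)` and `a_i⁻¹` is `(i, false)`. -/
def encode {n : ℕ} (ws : List (List (Fin n × Bool))) : List (List (ℕ × Bool)) :=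
  ws.map fun w => w.map fun s => (s.1.val, s.2)

/-- The elements of `F` represented by a list of words. -/
def wordSet {n : ℕ} (ws : List (List (Fin n × Bool))) : Set (F n) :=
  {u | ∃ w ∈ ws, u = FreeGroup.mk w}

end LinePattern

end

/-! A class is the same thing as a locally constant function `f` on the boundary with equal values
at the two ends of each line. It is supported on a nonempty finite subtree exactly when `f` is
constant behind every edge leaving the subtree (`SupportedOn.constOff`, `supportedOn_of_constOff`).
Every such `f` is constant off some ball, but the radius depends on `f`. The heart of the proof cuts
`f` into pieces whose size depends only on the rank and the words.

Only boundedly many lines cross a given edge. The Whitehead graph of depth `r` behind the edge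
partitions their ends, and the partition gets finer as `r` grows. Up to translation there are
finitely many edges, so the partitions stop changing at a computable `r`, and then for good
(`stable_of_bound`, `Stable.succ`). As `f` is constant on the blocks at a sufficiently deep level,
it is constant on the blocks at level `r` (`Stable.eq_of_rel`). Replacing each boundary point by a
representative of its component behind the edge leading to it from `v` turns `f` into a function
`f_v` that still respects the lines and is constant off the ball of radius `r` about `v`; an edge
`e` gives `f_e` likewise. In a large ball `f = ∑ f_v - ∑ f_e` (`eq_sum_parts`): with edges oriented
towards `ξ`, each vertex except the last one on the way to `ξ` cancels against the edge leaving it.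

Take `R₀ = r`. Each part is a translate of a class on `B_{R₀}`, so it lifts to the free module close
to its vertex or edge, and `p` is surjective. For the kernel, let `K` contain all relations near
single vertices. The lifts of the parts are additive modulo `K`, so assembling them gives a
homomorphism from classes to the free module modulo `K`. It sends `σ_j g` to `e_j g`: far from `g⁻¹`
a vertex part equals the part of the edge towards `g⁻¹` and cancels with it, and what remains
differs from `e_j g` by one local relation (`Presented.assembleHom_generator`). Hence every `x` with
`p x = 0` vanishes modulo `K` (`Presented.ker_le`).

It remains to see that local relations have small support. Outside rank one, a support of a class on
`B_R` lies in `B_{R+1}` (`IsSupport.subset_ball`). In rank one a support may be any single vertex,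
but there the group acts trivially on classes and the kernel is found directly (`ker_le_rankOne`).
-/

noncomputable section

namespace LinePattern

open CechZero MulOpposite

/-! ## The metric of the Cayley tree -/

section Tree

variable {n : ℕ}

/-- The letter `a_i` or `a_i⁻¹`. -/
def letter (s : Fin n × Bool) : F n := FreeGroup.mk [s]

theorem letter_not (i : Fin n) (b : Bool) : letter (i, !b) = (letter (i, b))⁻¹ := by
  simp [letter, FreeGroup.inv_mk, FreeGroup.invRev]

theorem norm_letter (s : Fin n × Bool) : (letter s).norm = 1 := by
  simp [letter, FreeGroup.norm, FreeGroup.toWord_mk]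

/-- The distance in the tree. -/
def treeDist (a b : F n) : ℕ := (a⁻¹ * b).norm

theorem treeDist_smul (g a b : F n) : treeDist (g * a) (g * b) = treeDist a b := by
  simp [treeDist, mul_assoc]

theorem treeDist_comm (a b : F n) : treeDist a b = treeDist b a := by
  rw [treeDist, treeDist, ← FreeGroup.norm_inv_eq]; simp

theorem treeDist_triangle (a b c : F n) : treeDist a c ≤ treeDist a b + treeDist b c := by
  have := FreeGroup.norm_mul_le (a⁻¹ * b) (b⁻¹ * c)
  simpa [treeDist, mul_assoc] using this

theorem treeDist_eq_zero {a b : F n} : treeDist a b = 0 ↔ a = b := by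
  rw [treeDist, FreeGroup.norm_eq_zero, inv_mul_eq_one]

@[simp] theorem treeDist_self (a : F n) : treeDist a a = 0 := treeDist_eq_zero.2 rfl

theorem treeDist_one (a : F n) : treeDist 1 a = a.norm := by simp [treeDist]

theorem adj_iff_letter {a b : F n} : (tree n).Adj a b ↔ ∃ s, b = a * letter s := by
  rw [SimpleGraph.mulCayley_adj']
  constructor
  · rintro ⟨-, _, ⟨i, rfl⟩, h | h⟩
    · exact ⟨(i, true), h.symm⟩
    · refine ⟨(i, false), ?_⟩
      rw [show (i, false) = (i, !true) from rfl, letter_not, h]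
      exact (mul_inv_cancel_right _ _).symm
  · rintro ⟨⟨i, b⟩, rfl⟩
    refine ⟨fun h => ?_, FreeGroup.of i, ⟨i, rfl⟩, ?_⟩
    · have := norm_letter (i, b)
      rw [left_eq_mul.1 h, FreeGroup.norm_one] at this
      omega
    · cases b
      · right
        rw [show (i, false) = (i, !true) from rfl, letter_not]
        exact (inv_mul_cancel_right _ _).symm
      · left; rfl

/-- The tail is already reduced, so cancellation can only happen at the front. This dichotomy is the
source of the tree geometry: distances to a fixed vertex change by exactly one along an edge, and
the neighbour nearer to it is unique. -/
theorem toWord_letter_mul (s : Fin n × Bool) (w : F n) :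
    (w.toWord = (s.1, !s.2) :: (letter s * w).toWord) ∨
      ((letter s * w).toWord = s :: w.toWord) := by
  have h : (letter s * w).toWord = FreeGroup.reduce (s :: w.toWord) := by
    rw [FreeGroup.toWord_mul, letter, FreeGroup.toWord_mk, FreeGroup.reduce_singleton]; rfl
  rw [h, FreeGroup.reduce.cons, FreeGroup.reduce_toWord]
  rcases hw : w.toWord with - | ⟨t, l⟩
  · right; rfl
  · by_cases hc : s.1 = t.1 ∧ s.2 = !t.2
    · left
      simp only [hc, and_self, if_true]
      obtain ⟨h1, h2⟩ := hc
      exact congrArg (· :: l) (Prod.ext rfl (by simp))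
    · right
      simp [hc]

theorem norm_letter_mul (s : Fin n × Bool) (w : F n) :
    (letter s * w).norm = w.norm + 1 ∨ (letter s * w).norm + 1 = w.norm := by
  rcases toWord_letter_mul s w with h | h
  · right; simp [FreeGroup.norm, h]
  · left; simp [FreeGroup.norm, h]

theorem adj_dist {a b : F n} (h : (tree n).Adj a b) (c : F n) :
    treeDist a c = treeDist b c + 1 ∨ treeDist b c = treeDist a c + 1 := by
  obtain ⟨⟨i, t⟩, rfl⟩ := adj_iff_letter.1 h
  have := norm_letter_mul (i, !t) (a⁻¹ * c)
  rw [letter_not] at this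
  simp only [treeDist, mul_inv_rev, mul_assoc] at this ⊢
  omega

theorem adj_dist_unique {a b b' c : F n} (h : (tree n).Adj a b) (h' : (tree n).Adj a b')
    (hb : treeDist b c < treeDist a c) (hb' : treeDist b' c < treeDist a c) : b = b' := by
  obtain ⟨⟨i, t⟩, rfl⟩ := adj_iff_letter.1 h
  obtain ⟨⟨j, u⟩, rfl⟩ := adj_iff_letter.1 h'
  have h1 := toWord_letter_mul (i, !t) (a⁻¹ * c)
  have h2 := toWord_letter_mul (j, !u) (a⁻¹ * c)
  rw [letter_not] at h1 h2
  simp only [treeDist, mul_inv_rev, mul_assoc, FreeGroup.norm] at hb hb'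
  rcases h1 with h1 | h1
  · rcases h2 with h2 | h2
    · rw [h1] at h2
      simp only [Bool.not_not, List.cons.injEq, Prod.mk.injEq] at h2
      obtain ⟨⟨rfl, rfl⟩, -⟩ := h2
      rfl
    · rw [h2] at hb'; simp at hb'
  · rw [h1] at hb; simp at hb

theorem exists_step {a c : F n} (h : a ≠ c) :
    ∃ b, (tree n).Adj a b ∧ treeDist a c = treeDist b c + 1 := by
  have hw : (a⁻¹ * c).toWord ≠ [] := by
    rw [Ne, FreeGroup.toWord_eq_nil_iff, inv_mul_eq_one]; exact h
  obtain ⟨s, l, hl⟩ := List.exists_cons_of_ne_nil hw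
  refine ⟨a * letter s, adj_iff_letter.2 ⟨s, rfl⟩, ?_⟩
  have h4 : ((letter s)⁻¹ * (a⁻¹ * c)).toWord =
      FreeGroup.reduce ((s.1, !s.2) :: (a⁻¹ * c).toWord) := by
    rw [← letter_not, FreeGroup.toWord_mul, letter, FreeGroup.toWord_mk,
      FreeGroup.reduce_singleton]; rfl
  rw [FreeGroup.reduce.cons, FreeGroup.reduce_toWord, hl] at h4
  simp only [and_self, if_true] at h4
  simp [treeDist, mul_inv_rev, mul_assoc, FreeGroup.norm, h4, hl]

/-- The neighbour of `a` on the geodesic from `a` to `c`. -/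
def step (a c : F n) : F n := by
  classical exact if h : a = c then a else (exists_step h).choose

theorem step_adj {a c : F n} (h : a ≠ c) : (tree n).Adj a (step a c) := by
  rw [step, dif_neg h]; exact (exists_step h).choose_spec.1

theorem step_dist {a c : F n} (h : a ≠ c) : treeDist a c = treeDist (step a c) c + 1 := by
  rw [step, dif_neg h]; exact (exists_step h).choose_spec.2

@[simp] theorem step_self (a : F n) : step a a = a := by rw [step, dif_pos rfl]

theorem eq_step {a b c : F n} (h : (tree n).Adj a b) (hb : treeDist b c < treeDist a c) :
    b = step a c := by
  have hne : a ≠ c := by rintro rfl; simp at hb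
  exact adj_dist_unique h (step_adj hne) hb (by have := step_dist hne; omega)

theorem adj_iff_dist {a b : F n} : (tree n).Adj a b ↔ treeDist a b = 1 := by
  constructor
  · intro h
    obtain ⟨s, rfl⟩ := adj_iff_letter.1 h
    simp [treeDist, norm_letter]
  · intro h
    have hne : a ≠ b := by rintro rfl; simp at h
    have h1 := step_dist hne
    rw [h] at h1
    have : step a b = b := treeDist_eq_zero.1 (by omega)
    rw [← this]; exact step_adj hne

/-- Each edge is oriented towards `c` in exactly one way. -/
theorem step_or_step {a b : F n} (h : (tree n).Adj a b) (c : F n) :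
    (step a c = b ∧ step b c ≠ a ∧ a ≠ c) ∨ (step b c = a ∧ step a c ≠ b ∧ b ≠ c) := by
  rcases adj_dist h c with hd | hd
  · left
    have hne : a ≠ c := by rintro rfl; simp at hd
    refine ⟨(eq_step h (by omega)).symm, fun hb => ?_, hne⟩
    by_cases hbc : b = c
    · rw [hbc, step_self] at hb; exact hne hb.symm
    · have := step_dist hbc; rw [hb] at this; omega
  · right
    have hne : b ≠ c := by rintro rfl; simp at hd
    refine ⟨(eq_step h.symm (by omega)).symm, fun hb => ?_, hne⟩
    by_cases hbc : a = c
    · rw [hbc, step_self] at hb; exact hne hb.symm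
    · have := step_dist hbc; rw [hb] at this; omega

theorem tree_induction {P : F n → Prop} (c : F n) (h0 : P c)
    (hs : ∀ a b, (tree n).Adj a b → P a → P b) (x : F n) : P x := by
  induction hk : treeDist x c generalizing x with
  | zero => rwa [treeDist_eq_zero.1 hk]
  | succ k ih =>
    have hne : x ≠ c := by rintro rfl; simp at hk
    exact hs _ _ (step_adj hne).symm (ih _ (by have := step_dist hne; omega))

/-- If the ends of an edge `p q` are on different sides of the edge `x y`, then the two edges
coincide. -/
theorem crossing_edge {p q x y : F n} (hpq : (tree n).Adj p q) (hxy : (tree n).Adj x y)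
    (hp : treeDist p x < treeDist p y) (hq : treeDist q y < treeDist q x) : p = x ∧ q = y := by
  have e1 := adj_dist hxy p
  have e2 := adj_dist hxy q
  have e3 := adj_dist hpq x
  have e4 := adj_dist hpq y
  rw [treeDist_comm x p, treeDist_comm y p] at e1
  rw [treeDist_comm x q, treeDist_comm y q] at e2
  by_cases hpx : p = x
  · refine ⟨hpx, ?_⟩
    subst hpx
    simp at e3 e2 e1
    exact treeDist_eq_zero.1 (by omega)
  · exfalso
    have h1 := step_dist hpx
    have h2 : treeDist (step p x) y < treeDist p y := by
      have := treeDist_triangle (step p x) x y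
      have := adj_iff_dist.1 hxy
      omega
    have h3 := adj_dist_unique hpq (step_adj hpx) (c := y) (by omega) h2
    rw [← h3] at h1
    omega

end Tree

/-! ## Rays and boundary points -/

section Rays

variable {n : ℕ}

/-- The previous vertex is the only neighbour nearer to the start, so a path that does not return to
it must move away. -/
theorem geodesic_of_noBacktrack {p : ℕ → F n} (hadj : ∀ k, (tree n).Adj (p k) (p (k + 1)))
    (hne : ∀ k, p (k + 2) ≠ p k) (k : ℕ) : treeDist (p k) (p 0) = k := by
  have key : ∀ k, treeDist (p k) (p 0) = k ∧ treeDist (p (k + 1)) (p 0) = k + 1 := by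
    intro k
    induction k with
    | zero =>
      refine ⟨by simp, ?_⟩
      rw [treeDist_comm]; exact adj_iff_dist.1 (hadj 0)
    | succ k ih =>
      refine ⟨ih.2, ?_⟩
      rcases adj_dist (hadj (k + 1)) (p 0) with h | h
      · exact absurd (adj_dist_unique (hadj (k + 1)) (hadj k).symm (c := p 0) (by omega) (by omega))
          (hne k)
      · rw [show k + 1 + 1 = k + 1 + 1 from rfl, h, ih.2]
  exact (key k).1

namespace Ray

theorem dist_zero (ρ : Ray n) (k : ℕ) : treeDist (ρ.pt k) (ρ.pt 0) = k :=
  geodesic_of_noBacktrack ρ.adj ρ.noBacktrack k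

@[ext] theorem ext {ρ τ : Ray n} (h : ∀ k, ρ.pt k = τ.pt k) : ρ = τ := by
  cases ρ; cases τ; congr; exact funext h

theorem pt_eq_step (ρ : Ray n) (k : ℕ) : ρ.pt k = step (ρ.pt (k + 1)) (ρ.pt 0) :=
  eq_step (ρ.adj k).symm (by rw [dist_zero, dist_zero]; omega)

/-- The ray obtained by dropping the first `m` vertices. -/
def drop (ρ : Ray n) (m : ℕ) : Ray n where
  pt k := ρ.pt (m + k)
  adj k := ρ.adj (m + k)
  noBacktrack k := ρ.noBacktrack (m + k)

/-- The ray obtained by putting a vertex in front. -/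
def cons (ρ : Ray n) (x : F n) (hx : (tree n).Adj x (ρ.pt 0)) (hne : ρ.pt 1 ≠ x) : Ray n where
  pt k := Nat.casesOn k x ρ.pt
  adj k := by
    cases k with
    | zero => exact hx
    | succ k => exact ρ.adj k
  noBacktrack k := by
    cases k with
    | zero => exact hne
    | succ k => exact ρ.noBacktrack k

theorem limit_eq_iff {ρ τ : Ray n} :
    ρ.limit = τ.limit ↔ ∃ a b, ∀ k, ρ.pt (a + k) = τ.pt (b + k) :=
  Quotient.eq (r := rayRel n)

theorem limit_drop (ρ : Ray n) (m : ℕ) : (ρ.drop m).limit = ρ.limit :=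
  limit_eq_iff.2 ⟨0, m, fun k => by simp [drop]⟩

theorem limit_cons (ρ : Ray n) (x : F n) (hx : (tree n).Adj x (ρ.pt 0)) (hne : ρ.pt 1 ≠ x) :
    (ρ.cons x hx hne).limit = ρ.limit :=
  limit_eq_iff.2 ⟨1, 0, fun k => by rw [Nat.add_comm 1 k, Nat.zero_add]; rfl⟩

theorem pt_eq_of_le {ρ τ : Ray n} (h0 : ρ.pt 0 = τ.pt 0) {m : ℕ} (h : ρ.pt m = τ.pt m) :
    ∀ k ≤ m, ρ.pt k = τ.pt k := by
  induction m with
  | zero => intro k hk; obtain rfl : k = 0 := by omega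
            exact h
  | succ m ih =>
    intro k hk
    rcases Nat.lt_or_ge m k with hlt | hle
    · obtain rfl : k = m + 1 := by omega
      exact h
    · exact ih (by rw [pt_eq_step ρ m, pt_eq_step τ m, h, h0]) k hle

/-- The distance to the common starting point rules out a shift between the two rays. From any
common vertex, walking back to the start is forced. -/
theorem eq_of_limit {ρ τ : Ray n} (h0 : ρ.pt 0 = τ.pt 0) (h : ρ.limit = τ.limit) : ρ = τ := by
  obtain ⟨a, b, hab⟩ := limit_eq_iff.1 h
  have e : a = b := by
    have h1 := hab 0
    have h2 := ρ.dist_zero a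
    have h3 := τ.dist_zero b
    simp only [Nat.add_zero] at h1
    rw [h1, h0, h3] at h2
    exact h2.symm
  subst e
  ext k
  refine pt_eq_of_le h0 (hab k) k (by omega)

end Ray

theorem exists_ray (x : F n) (ξ : Boundary n) : ∃ ρ : Ray n, ρ.pt 0 = x ∧ ρ.limit = ξ := by
  induction ξ using Quotient.inductionOn with
  | h ρ =>
    change ∃ τ : Ray n, τ.pt 0 = x ∧ τ.limit = ρ.limit
    refine tree_induction (P := fun x => ∃ τ : Ray n, τ.pt 0 = x ∧ τ.limit = ρ.limit)
      (ρ.pt 0) ⟨ρ, rfl, rfl⟩ ?_ x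
    rintro a b hab ⟨τ, rfl, hτ⟩
    by_cases h : τ.pt 1 = b
    · exact ⟨τ.drop 1, h, by rw [Ray.limit_drop, hτ]⟩
    · exact ⟨τ.cons b hab.symm h, rfl, by rw [Ray.limit_cons, hτ]⟩

/-- The ray from `x` to `ξ`. -/
def rayTo (x : F n) (ξ : Boundary n) : Ray n := (exists_ray x ξ).choose

@[simp] theorem rayTo_zero (x : F n) (ξ : Boundary n) : (rayTo x ξ).pt 0 = x :=
  (exists_ray x ξ).choose_spec.1

@[simp] theorem rayTo_limit (x : F n) (ξ : Boundary n) : (rayTo x ξ).limit = ξ :=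
  (exists_ray x ξ).choose_spec.2

theorem rayTo_eq (ρ : Ray n) : rayTo (ρ.pt 0) ρ.limit = ρ :=
  Ray.eq_of_limit (rayTo_zero _ _) (rayTo_limit _ _)

/-- The neighbour of `x` on the ray from `x` to `ξ`. -/
def nxt (x : F n) (ξ : Boundary n) : F n := (rayTo x ξ).pt 1

theorem nxt_adj (x : F n) (ξ : Boundary n) : (tree n).Adj x (nxt x ξ) := by
  have := (rayTo x ξ).adj 0
  rwa [rayTo_zero] at this

theorem nxt_ray (ρ : Ray n) (k : ℕ) : nxt (ρ.pt k) ρ.limit = ρ.pt (k + 1) := by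
  have := rayTo_eq (ρ.drop k)
  rw [Ray.limit_drop] at this
  change rayTo (ρ.pt k) ρ.limit = _ at this
  rw [nxt, this]; rfl

theorem nxt_rayTo (x : F n) (ξ : Boundary n) (k : ℕ) :
    nxt ((rayTo x ξ).pt k) ξ = (rayTo x ξ).pt (k + 1) := by
  have := nxt_ray (rayTo x ξ) k
  rwa [rayTo_limit] at this

theorem nxt_nxt_ne (x : F n) (ξ : Boundary n) : nxt (nxt x ξ) ξ ≠ x := by
  have h := nxt_rayTo x ξ 1
  have h2 := (rayTo x ξ).noBacktrack 0
  rw [rayTo_zero] at h2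
  change nxt ((rayTo x ξ).pt 1) ξ ≠ x
  rw [h]; exact h2

theorem nxt_eq_of_ne {x y : F n} {ξ : Boundary n} (h : (tree n).Adj x y) (hne : nxt x ξ ≠ y) :
    nxt y ξ = x := by
  have e : (tree n).Adj y ((rayTo x ξ).pt 0) := by rw [rayTo_zero]; exact h.symm
  have := nxt_ray ((rayTo x ξ).cons y e hne) 0
  rw [Ray.limit_cons (rayTo x ξ) y e hne, rayTo_limit] at this
  exact this.trans (rayTo_zero x ξ)

/-- Each edge is oriented towards `ξ` in exactly one way. -/
theorem nxt_eq_iff {x y : F n} {ξ : Boundary n} (h : (tree n).Adj x y) :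
    nxt x ξ = y ↔ nxt y ξ ≠ x := by
  constructor
  · rintro rfl; exact nxt_nxt_ne x ξ
  · intro h2
    by_contra h3
    exact h2 (nxt_eq_of_ne h h3)

theorem rayTo_smul (g x : F n) (ξ : Boundary n) : rayTo (g * x) (g • ξ) = g • rayTo x ξ := by
  have := rayTo_eq (g • rayTo x ξ)
  rw [← Ray.smul_limit, rayTo_limit, Ray.smul_pt, rayTo_zero] at this
  exact this

theorem nxt_smul (g x : F n) (ξ : Boundary n) : nxt (g * x) (g • ξ) = g * nxt x ξ := by
  rw [nxt, rayTo_smul]; rfl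

theorem rayTo_dist (x : F n) (ξ : Boundary n) (k : ℕ) : treeDist x ((rayTo x ξ).pt k) = k := by
  have := (rayTo x ξ).dist_zero k
  rwa [rayTo_zero, treeDist_comm] at this

theorem rayTo_pt_eq_of_le {x : F n} {ξ η : Boundary n} {m : ℕ}
    (h : (rayTo x ξ).pt m = (rayTo x η).pt m) : ∀ k ≤ m, (rayTo x ξ).pt k = (rayTo x η).pt k :=
  Ray.pt_eq_of_le (by simp) h

theorem boundary_ext {x : F n} {ξ η : Boundary n}
    (h : ∀ k, (rayTo x ξ).pt k = (rayTo x η).pt k) : ξ = η := by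
  rw [← rayTo_limit x ξ, Ray.ext h, rayTo_limit]

/-- If the next vertex after `v` in direction `ξ` is further away from `c` than `v`, then `v` lies
on the ray from `c` to `ξ`. -/
theorem rayTo_pt_dist (c : F n) {v : F n} {ξ : Boundary n}
    (h : treeDist c (nxt v ξ) = treeDist c v + 1) : (rayTo c ξ).pt (treeDist c v) = v := by
  induction hk : treeDist c v generalizing v with
  | zero => rw [rayTo_zero, treeDist_eq_zero.1 hk]
  | succ k ih =>
    have hne : v ≠ c := by rintro rfl; simp at hk
    have h1 := step_dist hne
    rw [treeDist_comm, hk, treeDist_comm] at h1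
    have h2 : nxt (step v c) ξ = v := by
      apply nxt_eq_of_ne (step_adj hne)
      intro h3
      rw [h3] at h; omega
    have h3 := ih (v := step v c) (by rw [h2]; omega) (by omega)
    have h4 := nxt_rayTo c ξ k
    rw [h3, h2] at h4
    exact h4.symm

theorem rayTo_pt_eq_of_nxt {c : F n} {ξ η : Boundary n} {k : ℕ}
    (h : nxt ((rayTo c ξ).pt k) η = (rayTo c ξ).pt (k + 1)) :
    ∀ i ≤ k + 1, (rayTo c η).pt i = (rayTo c ξ).pt i := by
  have h1 := rayTo_pt_dist c (v := (rayTo c ξ).pt k) (ξ := η)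
    (by rw [h, rayTo_dist, rayTo_dist])
  rw [rayTo_dist] at h1
  refine rayTo_pt_eq_of_le ?_
  rw [← nxt_rayTo, h1, h]

theorem mem_shadow_iff {x v : F n} {ξ : Boundary n} :
    ξ ∈ shadow x v ↔ ∃ k, (rayTo x ξ).pt k = v := by
  constructor
  · rintro ⟨ρ, rfl, h, rfl⟩
    rwa [rayTo_eq]
  · intro h
    exact ⟨rayTo x ξ, by simp, h, by simp⟩

/-- The boundary points behind the edge from `x` to `y`. -/
def edgeShadow (x y : F n) : Set (Boundary n) := {ξ | nxt x ξ = y}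

theorem mem_edgeShadow {x y : F n} {ξ : Boundary n} : ξ ∈ edgeShadow x y ↔ nxt x ξ = y := Iff.rfl

theorem edgeShadow_eq_shadow {x y : F n} (h : (tree n).Adj x y) :
    edgeShadow x y = shadow x y := by
  ext ξ
  rw [mem_shadow_iff]
  constructor
  · intro h; exact ⟨1, h⟩
  · rintro ⟨k, hk⟩
    have h1 := rayTo_dist x ξ k
    rw [hk, adj_iff_dist.1 h] at h1
    rw [← h1] at hk
    exact hk

theorem isOpen_edgeShadow {x y : F n} (h : (tree n).Adj x y) : IsOpen (edgeShadow x y) := by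
  rw [edgeShadow_eq_shadow h]
  exact isOpen_generateFrom_of_mem ⟨_, _, rfl⟩

/-- The sets behind the edges of a ray form a neighbourhood basis of its limit. The form "for all `k
≥ K`" is what makes the induction pass through intersections. -/
theorem exists_edgeShadow_subset {U : Set (Boundary n)} (hU : IsOpen U) (c : F n)
    {ξ : Boundary n} (hξ : ξ ∈ U) :
    ∃ K, ∀ k ≥ K, edgeShadow ((rayTo c ξ).pt k) ((rayTo c ξ).pt (k + 1)) ⊆ U := by
  induction hU with
  | basic s hs =>
    obtain ⟨x, v, rfl⟩ := hs
    obtain ⟨j, hj⟩ := mem_shadow_iff.1 hξ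
    obtain ⟨a, b, hab⟩ := Ray.limit_eq_iff.1 ((rayTo_limit c ξ).trans (rayTo_limit x ξ).symm)
    refine ⟨a + j, fun k hk η hη => ?_⟩
    obtain ⟨i, rfl⟩ := Nat.exists_eq_add_of_le (show a ≤ k by omega)
    rw [mem_edgeShadow, hab, Nat.add_assoc a, hab, ← Nat.add_assoc] at hη
    exact mem_shadow_iff.2 ⟨j, by rw [rayTo_pt_eq_of_nxt hη j (by omega), hj]⟩
  | univ => exact ⟨0, fun _ _ => subset_univ _⟩
  | inter s t _ _ hs ht =>
    obtain ⟨K, hK⟩ := hs hξ.1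
    obtain ⟨K', hK'⟩ := ht hξ.2
    exact ⟨max K K', fun k hk => subset_inter (hK k (le_trans (le_max_left _ _) hk))
      (hK' k (le_trans (le_max_right _ _) hk))⟩
  | sUnion S _ ih =>
    obtain ⟨s, hs, hξs⟩ := hξ
    obtain ⟨K, hK⟩ := ih s hs hξs
    exact ⟨K, fun k hk => (hK k hk).trans (subset_sUnion_of_mem hs)⟩

/-- Two rays from the identity with different limits part at a first vertex, and the two edges
leaving it there separate the limits. -/
instance : T2Space (Boundary n) where
  t2 ξ η hne := by
    have : ∃ k, (rayTo 1 ξ).pt (k + 1) ≠ (rayTo 1 η).pt (k + 1) := by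
      by_contra h
      push Not at h
      exact hne (boundary_ext (x := 1) fun k => by cases k <;> simp [h])
    classical
    have hk := Nat.find_spec this
    have hmin : (rayTo 1 ξ).pt (Nat.find this) = (rayTo 1 η).pt (Nat.find this) := by
      rcases hf : Nat.find this with - | m
      · simp
      · have := Nat.find_min this (m := m) (by omega)
        push Not at this
        exact this
    set k := Nat.find this
    have h1 := nxt_rayTo 1 ξ k
    have h2 := nxt_rayTo 1 η k
    refine ⟨_, _, isOpen_edgeShadow (nxt_adj ((rayTo 1 ξ).pt k) ξ),
      isOpen_edgeShadow (nxt_adj ((rayTo 1 ξ).pt k) η), rfl, rfl, ?_⟩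
    rw [Set.disjoint_left]
    intro ζ h3 h4
    rw [mem_edgeShadow] at h3 h4
    rw [h3, h1, hmin, h2] at h4
    exact hk h4

/-- The boundary points behind an edge are those behind the continuing edges. -/
theorem nxt_of_nxt_ne {x y : F n} {ξ : Boundary n} (h : (tree n).Adj x y) (hne : nxt y ξ ≠ x) :
    nxt x ξ = y := (nxt_eq_iff h).2 hne

end Rays

/-! ## Lines of the pattern and their end points -/

section Lines

variable {n : ℕ} {W : Set (F n)}

namespace Geodesic

/-- The geodesic traversed in the opposite direction. -/
def rev (l : Geodesic n) : Geodesic n where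
  pt k := l.pt (-k)
  adj k := by
    have h := (l.adj (-(k + 1))).symm
    rwa [show -(k + 1) + 1 = -k by ring] at h
  noBacktrack k := by
    have h := (l.noBacktrack (-(k + 2))).symm
    rwa [show -(k + 2) + 2 = -k by ring] at h

/-- The geodesic with its parametrization shifted. -/
def shift (l : Geodesic n) (i : ℤ) : Geodesic n where
  pt k := l.pt (i + k)
  adj k := by have h := l.adj (i + k); rwa [add_assoc] at h
  noBacktrack k := by have h := l.noBacktrack (i + k); rwa [add_assoc] at h

theorem rev_negRay (l : Geodesic n) : l.rev.negRay = l.posRay :=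
  Ray.ext fun k => by simp [rev, negRay, posRay]

theorem shift_posRay_limit (l : Geodesic n) (i : ℤ) :
    (l.shift i).posRay.limit = l.posRay.limit := by
  refine Ray.limit_eq_iff.2 ⟨(-i).toNat, i.toNat, fun k => ?_⟩
  simp only [shift, posRay]
  congr 1
  push_cast
  omega

theorem nxt_posRay (l : Geodesic n) (i : ℤ) : nxt (l.pt i) l.posRay.limit = l.pt (i + 1) := by
  have h := nxt_ray (l.shift i).posRay 0
  rw [shift_posRay_limit] at h
  simpa [shift, posRay] using h

theorem dist_add (l : Geodesic n) (i : ℤ) (k : ℕ) : treeDist (l.pt i) (l.pt (i + k)) = k := by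
  have h := (l.shift i).posRay.dist_zero k
  rw [treeDist_comm] at h
  simpa [shift, posRay] using h

theorem pt_add_mul {l : Geodesic n} {m : ℕ} {t : F n} (h : ∀ k, l.pt (k + m) = t * l.pt k)
    (k : ℤ) (j : ℕ) : l.pt (k + j * m) = t ^ j * l.pt k := by
  induction j with
  | zero => simp
  | succ j ih =>
    rw [pow_succ', mul_assoc, ← ih, ← h]
    congr 1; push_cast; ring

/-- After passing to the common period `m * m'`, the two translations agree at a common vertex, and
the action on vertices is free, so they are equal. Translating back, the lines also agree in the
negative direction. This is why a boundary point is an end of at most one line and the classes of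
the decomposition have at most two points. -/
theorem negRay_limit_eq {l l' : Geodesic n} {m m' : ℕ} {t u : F n} (hm : 0 < m) (hm' : 0 < m')
    (h : ∀ k, l.pt (k + m) = t * l.pt k) (h' : ∀ k, l'.pt (k + m') = u * l'.pt k)
    (hl : l.posRay.limit = l'.posRay.limit) : l.negRay.limit = l'.negRay.limit := by
  obtain ⟨a, b, hab⟩ := Ray.limit_eq_iff.1 hl
  replace hab : ∀ k : ℕ, l.pt (a + k) = l'.pt (b + k) := fun k => by
    have := hab k
    simpa [posRay] using this
  have hT : ∀ k, l.pt (k + (m * m' : ℕ)) = t ^ m' * l.pt k := fun k => by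
    rw [← pt_add_mul h k m']; congr 1; push_cast; ring
  have hU : ∀ k, l'.pt (k + (m * m' : ℕ)) = u ^ m * l'.pt k := fun k => by
    rw [← pt_add_mul h' k m]; congr 1
  have hTU : t ^ m' = u ^ m := by
    have h1 := hT (a : ℤ)
    rw [hab, hU] at h1
    have h2 := hab 0
    simp only [Nat.cast_zero, add_zero] at h2
    rw [h2] at h1
    exact (mul_right_cancel h1).symm
  have hneg : ∀ k : ℕ, l.pt (a - k) = l'.pt (b - k) := fun k => by
    have h1 := pt_add_mul hT (a - k) k
    have h2 := pt_add_mul hU (b - k) k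
    -- Moving `k` steps back and then `k` common periods forward lands `k * c` steps ahead, where
    -- the two lines are known to agree.
    obtain ⟨c, hc⟩ : ∃ c : ℕ, m * m' = c + 1 := Nat.exists_eq_add_one.2 (Nat.mul_pos hm hm')
    have h3 := hab (k * c)
    rw [show (a : ℤ) - k + k * (m * m' : ℕ) = a + (k * c : ℕ) by rw [hc]; push_cast; ring] at h1
    rw [show (b : ℤ) - k + k * (m * m' : ℕ) = b + (k * c : ℕ) by rw [hc]; push_cast; ring] at h2
    rw [h1, h2, hTU] at h3
    exact mul_left_cancel h3
  refine Ray.limit_eq_iff.2 ⟨b, a, fun k => ?_⟩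
  have := hneg (a + b + k)
  simp only [negRay]
  rw [show (-((b + k : ℕ) : ℤ)) = a - (a + b + k : ℕ) by push_cast; ring,
    show (-((a + k : ℕ) : ℤ)) = b - (a + b + k : ℕ) by push_cast; ring, this]

variable (W) in
/-- The geodesic is a line of the pattern, in one of its two orientations. -/
def IsAxis (l : Geodesic n) : Prop :=
  ∃ g u : F n, (u ∈ W ∨ u⁻¹ ∈ W) ∧ ∃ m : ℕ, 0 < m ∧ ∀ k, l.pt (k + m) = g * u * g⁻¹ * l.pt k

theorem isAxis_of_mem {l : Geodesic n} (h : l ∈ pattern W) : l.IsAxis W := by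
  obtain ⟨g, w, hw, m, hm, h⟩ := h
  obtain ⟨m, rfl⟩ := Int.eq_ofNat_of_zero_le hm.le
  exact ⟨g, w, Or.inl hw, m, by exact_mod_cast hm, h⟩

theorem rev_periodic {l : Geodesic n} {m : ℤ} {g u : F n}
    (h : ∀ k, l.pt (k + m) = g * u * g⁻¹ * l.pt k) (k : ℤ) :
    l.rev.pt (k + m) = g * u⁻¹ * g⁻¹ * l.rev.pt k := by
  have := h (-(k + m))
  simp only [rev]
  rw [show -(k + m) + m = -k by ring] at this
  rw [this]; group

theorem IsAxis.rev {l : Geodesic n} (h : l.IsAxis W) : l.rev.IsAxis W := by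
  obtain ⟨g, u, hu, m, hm, h⟩ := h
  exact ⟨g, u⁻¹, by rw [inv_inv]; exact hu.symm, m, hm, rev_periodic h⟩

theorem IsAxis.mem_or {l : Geodesic n} (h : l.IsAxis W) :
    l ∈ pattern W ∨ l.rev ∈ pattern W := by
  obtain ⟨g, u, hu | hu, m, hm, h⟩ := h
  · exact Or.inl ⟨g, u, hu, m, by exact_mod_cast hm, h⟩
  · exact Or.inr ⟨g, u⁻¹, hu, m, by exact_mod_cast hm, rev_periodic h⟩

theorem IsAxis.negRay_limit_eq {l l' : Geodesic n} (h : l.IsAxis W) (h' : l'.IsAxis W)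
    (hl : l.posRay.limit = l'.posRay.limit) : l.negRay.limit = l'.negRay.limit := by
  obtain ⟨g, u, -, m, hm, h⟩ := h
  obtain ⟨g', u', -, m', hm', h'⟩ := h'
  exact Geodesic.negRay_limit_eq hm hm' h h' hl

/-- The translation length of a conjugate of `u` is at most the length of `u`. -/
theorem period_le {l : Geodesic n} {m : ℕ} {g u : F n}
    (h : ∀ k, l.pt (k + m) = g * u * g⁻¹ * l.pt k) : m ≤ u.norm := by
  by_contra hlt
  push Not at hlt
  set C := (g⁻¹ * l.pt 0).norm with hC
  -- The `j`-th power of the translation moves `l.pt 0` by `j * m`, and by at most `2 * C + j *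
  -- u.norm`. If `m` exceeds `u.norm`, then `j ≤ 2 * C`, so `j = 2 * C + 1` is impossible.
  have h1 := pt_add_mul h 0 (2 * C + 1)
  have h2 := l.dist_add 0 ((2 * C + 1) * m)
  have hpow : ∀ j, (u ^ j).norm ≤ j * u.norm := by
    intro j
    induction j with
    | zero => simp
    | succ j ih =>
      rw [pow_succ]
      have := FreeGroup.norm_mul_le (u ^ j) u
      linarith
  have hconj : ∀ j, (g * u * g⁻¹) ^ j = g * u ^ j * g⁻¹ := fun j => conj_pow
  rw [Nat.cast_mul, h1, hconj] at h2
  have h3 := FreeGroup.norm_mul_le ((l.pt 0)⁻¹ * g) (u ^ (2 * C + 1) * (g⁻¹ * l.pt 0))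
  have h4 := FreeGroup.norm_mul_le (u ^ (2 * C + 1)) (g⁻¹ * l.pt 0)
  have h5 : ((l.pt 0)⁻¹ * g).norm = C := by
    rw [hC, ← FreeGroup.norm_inv_eq]; simp
  have h6 : treeDist (l.pt 0) (g * u ^ (2 * C + 1) * g⁻¹ * l.pt 0) =
      ((l.pt 0)⁻¹ * g * (u ^ (2 * C + 1) * (g⁻¹ * l.pt 0))).norm := by
    rw [treeDist]; group
  have h7 := hpow (2 * C + 1)
  rw [h6] at h2
  nlinarith

/-- A geodesic whose ends are on the two sides of an edge passes through this edge. -/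
theorem exists_crossing (l : Geodesic n) {x y : F n} (hxy : (tree n).Adj x y)
    (hp : l.posRay.limit ∈ edgeShadow x y) (hn : l.negRay.limit ∉ edgeShadow x y) :
    ∃ i, l.pt i = x ∧ l.pt (i + 1) = y := by
  have key : ∀ {x y : F n} {ξ : Boundary n}, nxt x ξ = y → ∀ k,
      treeDist ((rayTo x ξ).pt (k + 1)) y < treeDist ((rayTo x ξ).pt (k + 1)) x := by
    rintro x _ ξ rfl k
    have h1 := ((rayTo x ξ).drop 1).dist_zero k
    have h2 := rayTo_dist x ξ (k + 1)
    rw [treeDist_comm] at h2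
    rw [h2]
    simp only [Ray.drop, Nat.add_zero] at h1
    rw [Nat.add_comm k 1]
    change treeDist ((rayTo x ξ).pt (1 + k)) (nxt x ξ) = k at h1
    omega
  have hn' : nxt y l.negRay.limit = x := nxt_eq_of_ne hxy hn
  obtain ⟨a, b, hab⟩ := Ray.limit_eq_iff.1 (rayTo_limit x l.posRay.limit)
  obtain ⟨c, d, hcd⟩ := Ray.limit_eq_iff.1 (rayTo_limit y l.negRay.limit)
  have h1 := key hp a
  have h2 := key hn' c
  rw [hab 1] at h1
  rw [hcd 1] at h2
  simp only [posRay, negRay] at h1 h2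
  -- Discrete intermediate value argument: the line is on the side of `x` at index `-(d + 1)` and on
  -- the side of `y` at index `b + 1`, so it changes sides at some edge.
  have : ∃ k : ℕ, ¬ (treeDist (l.pt (-((d + 1 : ℕ) : ℤ) + k)) y <
      treeDist (l.pt (-((d + 1 : ℕ) : ℤ) + k)) x) ∧
      treeDist (l.pt (-((d + 1 : ℕ) : ℤ) + k + 1)) y <
        treeDist (l.pt (-((d + 1 : ℕ) : ℤ) + k + 1)) x := by
    by_contra hcon
    push Not at hcon
    have hall : ∀ k : ℕ, treeDist (l.pt (-((d + 1 : ℕ) : ℤ) + k)) x ≤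
        treeDist (l.pt (-((d + 1 : ℕ) : ℤ) + k)) y := by
      intro k
      induction k with
      | zero => simpa using h2.le
      | succ k ih =>
        have := hcon k ih
        rwa [show -((d + 1 : ℕ) : ℤ) + (k + 1 : ℕ) = -((d + 1 : ℕ) : ℤ) + k + 1 by
          push_cast; ring]
    have := hall (d + 1 + (b + 1))
    rw [show -((d + 1 : ℕ) : ℤ) + (d + 1 + (b + 1) : ℕ) = (b + 1 : ℕ) by push_cast; ring] at this
    omega
  obtain ⟨k, hk1, hk2⟩ := this
  have h3 := adj_dist hxy (l.pt (-((d + 1 : ℕ) : ℤ) + k))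
  rw [treeDist_comm x, treeDist_comm y] at h3
  exact ⟨_, crossing_edge (l.adj _) hxy (by omega) hk2⟩

end Geodesic

/-! ### Line ends at an edge and their number -/

variable (W) in
/-- The two boundary points are the end points of a line of the pattern. -/
def Partner (ξ η : Boundary n) : Prop := endRel W ξ η ∨ endRel W η ξ

theorem Partner.symm {ξ η : Boundary n} (h : Partner W ξ η) : Partner W η ξ := Or.symm h

theorem Partner.smul (g : F n) {ξ η : Boundary n} (h : Partner W ξ η) :
    Partner W (g • ξ) (g • η) := h.imp (endRel_smul g) (endRel_smul g)

theorem partner_iff {ξ η : Boundary n} : Partner W ξ η ↔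
    ∃ l : Geodesic n, l.IsAxis W ∧ l.posRay.limit = ξ ∧ l.negRay.limit = η := by
  constructor
  · rintro (⟨l, hl, h1, h2⟩ | ⟨l, hl, h1, h2⟩)
    · exact ⟨l, Geodesic.isAxis_of_mem hl, h1, h2⟩
    · exact ⟨l.rev, (Geodesic.isAxis_of_mem hl).rev, h2, by rw [Geodesic.rev_negRay]; exact h1⟩
  · rintro ⟨l, hl, h1, h2⟩
    rcases hl.mem_or with h | h
    · exact Or.inl ⟨l, h, h1, h2⟩
    · exact Or.inr ⟨l.rev, h, h2, by rw [Geodesic.rev_negRay]; exact h1⟩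

theorem Partner.unique {ξ η η' : Boundary n} (h : Partner W ξ η) (h' : Partner W ξ η') :
    η = η' := by
  obtain ⟨l, hl, rfl, rfl⟩ := partner_iff.1 h
  obtain ⟨l', hl', h1, rfl⟩ := partner_iff.1 h'
  exact hl.negRay_limit_eq hl' h1.symm

variable (W) in
/-- The end points behind the edge from `x` to `y` of the lines that pass through this edge. -/
def ends (x y : F n) : Set (Boundary n) :=
  {ξ | ξ ∈ edgeShadow x y ∧ ∃ η, η ∉ edgeShadow x y ∧ Partner W ξ η}

/-- A line through `x` is determined by the translation `t` along it, since it contains all `t ^ k *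
x`. The element `x⁻¹ * t * x` has norm equal to the translation length, which is at most the length
of the word, so it lies in the ball of radius `Λ`. -/
theorem exists_injOn_ends {Λ : ℕ} (hW : ∀ w ∈ W, w.norm ≤ Λ) {x y : F n}
    (hxy : (tree n).Adj x y) :
    ∃ φ : Boundary n → F n, InjOn φ (ends W x y) ∧ MapsTo φ (ends W x y) (ball n Λ) := by
  have h1 : ∀ ξ, ξ ∈ ends W x y → ∃ s : F n, s ∈ ball n Λ ∧ ∃ (l : Geodesic n) (m : ℕ) (t : F n),
      0 < m ∧ l.pt 0 = x ∧ (∀ k, l.pt (k + m) = t * l.pt k) ∧ l.posRay.limit = ξ ∧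
      s = x⁻¹ * t * x := by
    rintro ξ ⟨hξ, η, hη, hp⟩
    obtain ⟨l, hl, rfl, rfl⟩ := partner_iff.1 hp
    obtain ⟨i, rfl, -⟩ := l.exists_crossing hxy hξ hη
    obtain ⟨g, u, hu, m, hm, h⟩ := hl
    refine ⟨(l.pt i)⁻¹ * (g * u * g⁻¹) * l.pt i, ?_, l.shift i, m, g * u * g⁻¹, hm,
      by simp [Geodesic.shift], fun k => ?_, l.shift_posRay_limit i, rfl⟩
    · have h2 := l.dist_add i m
      rw [h, treeDist, ← mul_assoc] at h2
      have h3 := Geodesic.period_le h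
      have h4 : u.norm ≤ Λ := by
        rcases hu with hu | hu
        · exact hW _ hu
        · rw [← FreeGroup.norm_inv_eq]; exact hW _ hu
      change _ ≤ Λ
      omega
    · simp only [Geodesic.shift]
      rw [← h]; congr 1; ring
  choose! φ hφ using h1
  refine ⟨φ, fun ξ hξ ξ' hξ' he => ?_, fun ξ hξ => (hφ ξ hξ).1⟩
  obtain ⟨-, l, m, t, hm, h0, h, hl, hs⟩ := hφ ξ hξ
  obtain ⟨-, l', m', t', -, h0', h', hl', hs'⟩ := hφ ξ' hξ'
  have ht : t = t' := by
    have := hs.symm.trans (he.trans hs')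
    exact mul_left_cancel (mul_right_cancel this)
  subst ht
  have hmm : m = m' := by
    have h3 := l.dist_add 0 m
    have h4 := l'.dist_add 0 m'
    rw [h, h0] at h3
    rw [h', h0', h3] at h4
    exact h4
  subst hmm
  rw [← hl, ← hl']
  congr 1
  ext k
  have h5 : l.posRay.pt (k * m) = l'.posRay.pt (k * m) := by
    have h3 := Geodesic.pt_add_mul h 0 k
    have h4 := Geodesic.pt_add_mul h' 0 k
    simp only [Geodesic.posRay]
    rw [zero_add] at h3 h4
    rw [Nat.cast_mul, h3, h4, h0, h0']
  exact Ray.pt_eq_of_le (by simp [Geodesic.posRay, h0, h0']) h5 k (Nat.le_mul_of_pos_right k hm)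

/-- A ball of radius `t` in the tree is contained in a finite set with `(2n+1)^t` elements. -/
theorem exists_finset_ball (n t : ℕ) :
    ∃ B : Finset (F n), ball n t ⊆ B ∧ B.card ≤ (2 * n + 1) ^ t := by
  classical
  induction t with
  | zero =>
    refine ⟨{1}, fun v hv => ?_, by simp⟩
    have : v.norm = 0 := Nat.le_zero.1 hv
    simpa using FreeGroup.norm_eq_zero.1 this
  | succ t ih =>
    obtain ⟨B, hB, hc⟩ := ih
    set L : Finset (F n) := insert 1 (Finset.univ.image letter)
    have hL : L.card ≤ 2 * n + 1 := by
      refine (Finset.card_insert_le _ _).trans (Nat.add_le_add_right (Finset.card_image_le.trans ?_) 1)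
      simp [Nat.mul_comm]
    refine ⟨Finset.image₂ (fun a b => b * a) L B, fun v hv => ?_, ?_⟩
    · rw [Finset.mem_coe, Finset.mem_image₂]
      by_cases h : v = 1
      · subst h
        exact ⟨1, by simp [L], 1, hB (by simp [ball]), by simp⟩
      · have h1 := step_dist h
        obtain ⟨s, hs⟩ := adj_iff_letter.1 (step_adj h).symm
        rw [treeDist_comm, treeDist_one, treeDist_comm, treeDist_one] at h1
        have hv : v.norm ≤ t + 1 := hv
        exact ⟨letter s, by simp [L], step v 1, hB (show _ ≤ t by omega), hs.symm⟩
    · refine (Finset.card_image₂_le _ _ _).trans ?_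
      rw [pow_succ, Nat.mul_comm]
      exact Nat.mul_le_mul hc hL

theorem ball_finite (n t : ℕ) : (ball n t).Finite := by
  obtain ⟨B, hB, -⟩ := exists_finset_ball n t
  exact B.finite_toSet.subset hB

theorem ends_finite {Λ : ℕ} (hW : ∀ w ∈ W, w.norm ≤ Λ) {x y : F n} (hxy : (tree n).Adj x y) :
    (ends W x y).Finite := by
  obtain ⟨φ, h1, h2⟩ := exists_injOn_ends hW hxy
  exact Finite.of_injOn h2 h1 (ball_finite n Λ)

theorem ends_ncard_le {Λ : ℕ} (hW : ∀ w ∈ W, w.norm ≤ Λ) {x y : F n} (hxy : (tree n).Adj x y) :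
    (ends W x y).ncard ≤ (2 * n + 1) ^ Λ := by
  obtain ⟨φ, h1, h2⟩ := exists_injOn_ends hW hxy
  obtain ⟨B, hB, hc⟩ := exists_finset_ball n Λ
  refine le_trans ?_ hc
  rw [← Set.ncard_coe_finset]
  exact Set.ncard_le_ncard_of_injOn φ (fun ξ hξ => hB (h2 hξ)) h1 B.finite_toSet

end Lines

/-! ## Stabilization of the connectivity behind an edge -/

section Connectivity

variable {n : ℕ} {W : Set (F n)}

theorem edgeShadow_subset {x y z : F n} (h : (tree n).Adj x y) (hz : z ≠ x) :
    edgeShadow y z ⊆ edgeShadow x y := fun _ hξ =>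
  nxt_of_nxt_ne h (by rw [mem_edgeShadow.1 hξ]; exact hz)

theorem rayTo_nxt (x : F n) (ξ : Boundary n) (k : ℕ) :
    (rayTo (nxt x ξ) ξ).pt k = (rayTo x ξ).pt (k + 1) := by
  have h := rayTo_eq ((rayTo x ξ).drop 1)
  rw [Ray.limit_drop, rayTo_limit] at h
  change rayTo (nxt x ξ) ξ = _ at h
  rw [h, Ray.drop, Nat.add_comm]

variable (W) in
/-- Boundary points behind the edge from `x` to `y` are related at level `r` if they lie in the same
connected component of the Whitehead graph of the part of the tree behind this edge of depth `r`. -/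
def rel : ℕ → F n → F n → Boundary n → Boundary n → Prop
  | 0, _, _ => fun _ _ => True
  | r + 1, x, y => Relation.EqvGen fun ξ η =>
      (∃ z, z ≠ x ∧ (tree n).Adj y z ∧ ξ ∈ edgeShadow y z ∧ η ∈ edgeShadow y z ∧ rel r y z ξ η) ∨
        (ξ ∈ edgeShadow x y ∧ η ∈ edgeShadow x y ∧ Partner W ξ η)

theorem rel_refl (r : ℕ) (x y : F n) (ξ : Boundary n) : rel W r x y ξ ξ := by
  cases r
  · trivial
  · exact Relation.EqvGen.refl _

theorem rel_symm {r : ℕ} {x y : F n} {ξ η : Boundary n} (h : rel W r x y ξ η) :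
    rel W r x y η ξ := by
  cases r
  · trivial
  · exact Relation.EqvGen.symm _ _ h

theorem rel_trans {r : ℕ} {x y : F n} {ξ η ζ : Boundary n} (h : rel W r x y ξ η)
    (h' : rel W r x y η ζ) : rel W r x y ξ ζ := by
  cases r
  · trivial
  · exact Relation.EqvGen.trans _ _ _ h h'

theorem rel_of_partner (r : ℕ) {x y : F n} {ξ η : Boundary n} (hξ : ξ ∈ edgeShadow x y)
    (hη : η ∈ edgeShadow x y) (h : Partner W ξ η) : rel W r x y ξ η := by
  cases r
  · trivial
  · exact Relation.EqvGen.rel _ _ (Or.inr ⟨hξ, hη, h⟩)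

theorem rel_succ_of_rel {r : ℕ} {x y z : F n} {ξ η : Boundary n} (hz : z ≠ x)
    (hyz : (tree n).Adj y z) (hξ : ξ ∈ edgeShadow y z) (hη : η ∈ edgeShadow y z)
    (h : rel W r y z ξ η) : rel W (r + 1) x y ξ η :=
  Relation.EqvGen.rel _ _ (Or.inl ⟨z, hz, hyz, hξ, hη, h⟩)

theorem rel_of_succ {r : ℕ} {x y : F n} {ξ η : Boundary n} (h : rel W (r + 1) x y ξ η) :
    rel W r x y ξ η := by
  induction r generalizing x y ξ η with
  | zero => trivial
  | succ r ih =>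
    refine Relation.EqvGen.mono (fun α β hab => ?_) _ _ h
    exact hab.imp_left fun ⟨z, h1, h2, h3, h4, h5⟩ => ⟨z, h1, h2, h3, h4, ih h5⟩

theorem mem_edgeShadow_smul (g : F n) {x y : F n} {ξ : Boundary n} :
    g • ξ ∈ edgeShadow (g * x) (g * y) ↔ ξ ∈ edgeShadow x y := by
  rw [mem_edgeShadow, mem_edgeShadow, nxt_smul, mul_left_cancel_iff]

theorem rel_smul (g : F n) {r : ℕ} {x y : F n} {ξ η : Boundary n} (h : rel W r x y ξ η) :
    rel W r (g * x) (g * y) (g • ξ) (g • η) := by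
  induction r generalizing x y ξ η with
  | zero => trivial
  | succ r ih =>
    induction h with
    | rel α β hab =>
      rcases hab with ⟨z, h1, h2, h3, h4, h5⟩ | ⟨h1, h2, h3⟩
      · exact rel_succ_of_rel (fun h => h1 (mul_left_cancel h)) (tree_adj_smul g h2)
          ((mem_edgeShadow_smul g).2 h3) ((mem_edgeShadow_smul g).2 h4) (ih h5)
      · exact rel_of_partner _ ((mem_edgeShadow_smul g).2 h1) ((mem_edgeShadow_smul g).2 h2)
          (h3.smul g)
    | refl α => exact rel_refl _ _ _ _
    | symm α β _ h => exact rel_symm h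
    | trans α β γ _ _ h h' => exact rel_trans h h'

theorem ends_smul (g : F n) {x y : F n} {ξ : Boundary n} (h : ξ ∈ ends W x y) :
    g • ξ ∈ ends W (g * x) (g * y) := by
  obtain ⟨h1, η, h2, h3⟩ := h
  exact ⟨(mem_edgeShadow_smul g).2 h1, g • η, fun h => h2 ((mem_edgeShadow_smul g).1 h), h3.smul g⟩

theorem ends_of_ends {x y : F n} {ξ : Boundary n} (hxy : (tree n).Adj x y)
    (h : ξ ∈ ends W x y) : ξ ∈ ends W y (nxt y ξ) := by
  obtain ⟨h1, η, h2, h3⟩ := h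
  exact ⟨rfl, η, fun h => h2 (edgeShadow_subset hxy ((nxt_eq_iff hxy).1 h1) h), h3⟩

variable (W) in
/-- The partitions of the sets of line ends behind edges do not change from level `r` to `r + 1`. -/
def Stable (r : ℕ) : Prop := ∀ x y, (tree n).Adj x y → ∀ ξ ∈ ends W x y, ∀ η ∈ ends W x y,
  rel W r x y ξ η → rel W (r + 1) x y ξ η

/-- The relation at level `r + 1` behind an edge is glued, along lines, from the relations at level
`r` behind the next edges. Lines between different next edges have their ends in `ends` there, where
stability allows level `r + 1` in place of level `r`. -/
theorem Stable.succ {r : ℕ} (h : Stable W r) : Stable W (r + 1) := by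
  intro x y hxy ξ hξ η hη hr
  -- `B ζ` says that the class of `ζ` at level `r` behind its next edge contains a line end already
  -- joined to `ξ` at level `r + 2`. The detour through a line end is needed because stability says
  -- nothing about other points. `B` holds for `ξ` and is invariant under the relation at level `r +
  -- 1`.
  let B : Boundary n → Prop := fun ζ => nxt x ζ = y ∧ ∃ ζ' ∈ ends W y (nxt y ζ),
    rel W r y (nxt y ζ) ζ ζ' ∧ rel W (r + 2) x y ξ ζ'
  have up : ∀ {ζ ζ' : Boundary n}, nxt x ζ = y → ζ ∈ ends W y (nxt y ζ) →
      ζ' ∈ ends W y (nxt y ζ) → rel W r y (nxt y ζ) ζ ζ' → rel W (r + 2) x y ζ ζ' := by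
    intro ζ ζ' h0 h1 h2 h3
    exact rel_succ_of_rel ((nxt_eq_iff hxy).1 h0) (nxt_adj _ _) h1.1 h2.1
      (h _ _ (nxt_adj _ _) _ h1 _ h2 h3)
  have half : ∀ {α β : Boundary n}, α ∈ edgeShadow x y → β ∈ edgeShadow x y → Partner W α β →
      B α → B β := by
    rintro α β hα hβ hp ⟨h0, ζ', h1, h2, h3⟩
    by_cases hz : nxt y α = nxt y β
    · refine ⟨hβ, ζ', hz ▸ h1, ?_, h3⟩
      rw [← hz]
      exact rel_trans (rel_symm (rel_of_partner r rfl hz.symm hp)) h2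
    · have hα' : α ∈ ends W y (nxt y α) := ⟨rfl, β, fun h => hz (Eq.symm h), hp⟩
      have hβ' : β ∈ ends W y (nxt y β) := ⟨rfl, α, hz, hp.symm⟩
      refine ⟨hβ, β, hβ', rel_refl _ _ _ _, ?_⟩
      exact rel_trans (rel_trans h3 (rel_symm (up h0 hα' h1 h2))) (rel_of_partner _ hα hβ hp)
  have key : ∀ {α β : Boundary n}, rel W (r + 1) x y α β → (B α ↔ B β) := by
    intro α β hab
    induction hab with
    | rel α β hab =>
      rcases hab with ⟨z, h1, h2, rfl, h4, h5⟩ | ⟨h1, h2, h3⟩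
      · have h4 : nxt y β = nxt y α := h4
        have hα : nxt x α = y := nxt_of_nxt_ne hxy h1
        have hβ : nxt x β = y := nxt_of_nxt_ne hxy (by rw [h4]; exact h1)
        simp only [B, h4, hα, hβ, true_and]
        exact ⟨fun ⟨ζ', a, b, c⟩ => ⟨ζ', a, rel_trans (rel_symm h5) b, c⟩,
          fun ⟨ζ', a, b, c⟩ => ⟨ζ', a, rel_trans h5 b, c⟩⟩
      · exact ⟨half h1 h2 h3, half h2 h1 h3.symm⟩
    | refl α => rfl
    | symm α β _ h => exact h.symm
    | trans α β γ _ _ h h' => exact h.trans h'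
  obtain ⟨h0, ζ', h1, h2, h3⟩ :=
    (key hr).1 ⟨hξ.1, ξ, ends_of_ends hxy hξ, rel_refl _ _ _ _, rel_refl _ _ _ _⟩
  exact rel_trans h3 (rel_symm (up h0 (ends_of_ends hxy hη) h1 h2))

/-! ### A uniform level of stability -/

variable (W) in
/-- The pairs of related ends behind the edges at the identity. -/
def relPairs (r : ℕ) : Set ((Fin n × Bool) × Boundary n × Boundary n) :=
  {p | p.2.1 ∈ ends W 1 (letter p.1) ∧ p.2.2 ∈ ends W 1 (letter p.1) ∧
    rel W r 1 (letter p.1) p.2.1 p.2.2}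

theorem adj_one_letter (s : Fin n × Bool) : (tree n).Adj 1 (letter s) :=
  adj_iff_letter.2 ⟨s, (one_mul _).symm⟩

theorem relPairs_finite_ncard {Λ : ℕ} (hW : ∀ w ∈ W, w.norm ≤ Λ) (r : ℕ) :
    (relPairs W r).Finite ∧
      (relPairs W r).ncard ≤ 2 * n * ((2 * n + 1) ^ Λ * (2 * n + 1) ^ Λ) := by
  classical
  have hf : ∀ s, (ends W 1 (letter s)).Finite := fun s => ends_finite hW (adj_one_letter s)
  let T : Finset ((Fin n × Bool) × Boundary n × Boundary n) :=
    Finset.univ.biUnion fun s : Fin n × Bool =>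
      ((hf s).toFinset ×ˢ (hf s).toFinset).image (Prod.mk s)
  have hsub : relPairs W r ⊆ T := by
    rintro ⟨s, ξ, η⟩ ⟨h1, h2, -⟩
    simp only [T, Finset.coe_biUnion, Set.mem_iUnion]
    refine ⟨s, Finset.mem_univ _, ?_⟩
    simpa using ⟨h1, h2⟩
  refine ⟨T.finite_toSet.subset hsub, (Set.ncard_le_ncard hsub T.finite_toSet).trans ?_⟩
  rw [Set.ncard_coe_finset]
  refine (Finset.card_biUnion_le_card_mul _ _ ((2 * n + 1) ^ Λ * (2 * n + 1) ^ Λ)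
    fun s _ => ?_).trans ?_
  · refine Finset.card_image_le.trans ?_
    rw [Finset.card_product]
    have := ends_ncard_le hW (adj_one_letter s)
    rw [Set.ncard_eq_toFinset_card _ (hf s)] at this
    exact Nat.mul_le_mul this this
  · simp [Nat.mul_comm]

theorem relPairs_anti (r : ℕ) : relPairs W (r + 1) ⊆ relPairs W r :=
  fun _ ⟨h1, h2, h3⟩ => ⟨h1, h2, rel_of_succ h3⟩

/-- Every edge is a translate of an edge starting at the identity, and the relation is equivariant.
-/
theorem stable_of_relPairs {r : ℕ} (h : relPairs W r ⊆ relPairs W (r + 1)) : Stable W r := by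
  intro x y hxy ξ hξ η hη hr
  obtain ⟨s, rfl⟩ := adj_iff_letter.1 hxy
  have h1 := ends_smul x⁻¹ hξ
  have h2 := ends_smul x⁻¹ hη
  have h3 := rel_smul x⁻¹ hr
  rw [inv_mul_cancel, inv_mul_cancel_left] at h1 h2 h3
  have h4 := rel_smul x (h (show (s, x⁻¹ • ξ, x⁻¹ • η) ∈ relPairs W r from ⟨h1, h2, h3⟩)).2.2
  simpa using h4

/-- The sets `relPairs W q` decrease, and the first has at most `r` elements, so they cannot shrink
strictly at every `q ≤ r`. Once stable, the partitions remain stable up to level `r`. -/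
theorem stable_of_bound {Λ r : ℕ} (hW : ∀ w ∈ W, w.norm ≤ Λ)
    (hr : 2 * n * ((2 * n + 1) ^ Λ * (2 * n + 1) ^ Λ) ≤ r) : Stable W r := by
  have : ∃ q ≤ r, Stable W q := by
    by_contra hcon
    push Not at hcon
    have key : ∀ q ≤ r + 1, (relPairs W q).ncard + q ≤ (relPairs W 0).ncard := by
      intro q hq
      induction q with
      | zero => simp
      | succ q ih =>
        have h1 := ih (by omega)
        have h2 : (relPairs W (q + 1)).ncard < (relPairs W q).ncard := by
          refine Set.ncard_lt_ncard ⟨relPairs_anti q, fun h => ?_⟩ (relPairs_finite_ncard hW q).1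
          exact hcon q (by omega) (stable_of_relPairs h)
        omega
    have h1 := key (r + 1) le_rfl
    have h2 := (relPairs_finite_ncard hW 0).2
    omega
  obtain ⟨q, hq, h⟩ := this
  clear hr
  induction hq with
  | refl => exact h
  | step _ ih => exact ih.succ

end Connectivity
/-! ## Functions on the boundary and their local parts -/

section Parts

variable {n : ℕ} {W : Set (F n)}

theorem rayTo_two (x : F n) (ξ : Boundary n) : (rayTo x ξ).pt 2 = nxt (nxt x ξ) ξ :=
  (nxt_rayTo x ξ 1).symm

theorem rayTo_of_mem {x y : F n} {ξ : Boundary n} (h : ξ ∈ edgeShadow x y) (k : ℕ) :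
    (rayTo y ξ).pt k = (rayTo x ξ).pt (k + 1) := by
  rw [← mem_edgeShadow.1 h, rayTo_nxt]

variable (W) in
/-- The function takes equal values at the two ends of each line of the pattern. -/
def LineInvariant (f : Boundary n → ℤ) : Prop := ∀ ξ η, Partner W ξ η → f ξ = f η

/-- The function is constant behind each edge that leaves the ball of radius `R` about `c`. -/
def BallConst (f : Boundary n → ℤ) (c : F n) (R : ℕ) : Prop :=
  ∀ ξ η, (rayTo c ξ).pt (R + 1) = (rayTo c η).pt (R + 1) → f ξ = f η

/-- The analogue of `BallConst` for the part of the boundary behind an edge. -/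
def EdgeConst (f : Boundary n → ℤ) (R : ℕ) (x y : F n) : Prop :=
  ∀ ξ ∈ edgeShadow x y, ∀ η ∈ edgeShadow x y,
    (rayTo x ξ).pt (R + 1) = (rayTo x η).pt (R + 1) → f ξ = f η

theorem EdgeConst.mono {f : Boundary n → ℤ} {R R' : ℕ} {x y : F n} (h : EdgeConst f R x y)
    (hR : R ≤ R') : EdgeConst f R' x y := fun ξ hξ η hη he =>
  h ξ hξ η hη (rayTo_pt_eq_of_le he _ (by omega))

theorem exists_not_edgeConst {f : Boundary n → ℤ} {x y : F n} (hxy : (tree n).Adj x y)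
    (h : ∀ R, ¬ EdgeConst f R x y) :
    ∃ z, z ≠ x ∧ (tree n).Adj y z ∧ ∀ R, ¬ EdgeConst f R y z := by
  by_contra hcon
  push Not at hcon
  have h1 : ∀ s : Fin n × Bool, ∃ R, y * letter s ≠ x → EdgeConst f R y (y * letter s) := by
    intro s
    by_cases hs : y * letter s = x
    · exact ⟨0, fun h => absurd hs h⟩
    · obtain ⟨R, hR⟩ := hcon _ hs (adj_iff_letter.2 ⟨s, rfl⟩)
      exact ⟨R, fun _ => hR⟩
  choose R hR using h1
  refine h (Finset.univ.sup R + 1) fun ξ hξ η hη he => ?_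
  have e1 : nxt y ξ = nxt y η := by
    have h3 := rayTo_pt_eq_of_le he 2 (by omega)
    rw [rayTo_two, rayTo_two] at h3
    rwa [mem_edgeShadow.1 hξ, mem_edgeShadow.1 hη] at h3
  obtain ⟨s, hs⟩ := adj_iff_letter.1 (nxt_adj y ξ)
  have h4 : y * letter s ≠ x := by rw [← hs]; exact (nxt_eq_iff hxy).1 hξ
  refine ((hR s h4).mono (Finset.le_sup (Finset.mem_univ s))) ξ hs η (e1.symm.trans hs) ?_
  rw [rayTo_of_mem hξ, rayTo_of_mem hη, he]

/-- König's lemma: if no depth works behind an edge, then none works behind one of the finitely many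
next edges. Repeating this yields a ray, and local constancy at its limit gives a contradiction. -/
theorem exists_edgeConst {f : Boundary n → ℤ} (hf : IsLocallyConstant f) {x y : F n}
    (hxy : (tree n).Adj x y) : ∃ R, EdgeConst f R x y := by
  by_contra hcon
  push Not at hcon
  let T := {e : F n × F n // (tree n).Adj e.1 e.2 ∧ ∀ R, ¬ EdgeConst f R e.1 e.2}
  have hstep : ∀ e : T, ∃ e' : T, e'.1.1 = e.1.2 ∧ e'.1.2 ≠ e.1.1 := by
    rintro ⟨⟨a, b⟩, h1, h2⟩
    obtain ⟨z, h3, h4, h5⟩ := exists_not_edgeConst h1 h2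
    exact ⟨⟨(b, z), h4, h5⟩, rfl, h3⟩
  choose g hg using hstep
  let s : ℕ → T := fun k => Nat.rec ⟨(x, y), hxy, hcon⟩ (fun _ e => g e) k
  have hs : ∀ k, (s (k + 1)).1.1 = (s k).1.2 := fun k => (hg (s k)).1
  let ρ : Ray n :=
    { pt := fun k => (s k).1.1
      adj := fun k => by rw [hs]; exact (s k).2.1
      noBacktrack := fun k => by
        change (s (k + 1 + 1)).1.1 ≠ _; rw [hs (k + 1)]; exact (hg (s k)).2 }
  obtain ⟨K, hK⟩ := exists_edgeShadow_subset (hf.isOpen_fiber (f ρ.limit)) (ρ.pt 0)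
    (ξ := ρ.limit) rfl
  have h1 := hK K le_rfl
  rw [rayTo_eq] at h1
  refine (s K).2.2 0 fun ξ hξ η hη _ => ?_
  have e : (s K).1.2 = ρ.pt (K + 1) := (hs K).symm
  rw [e] at hξ hη
  exact (h1 hξ : f ξ = _).trans (h1 hη : f η = _).symm

theorem exists_ballConst {f : Boundary n → ℤ} (hf : IsLocallyConstant f) (c : F n) :
    ∃ R, BallConst f c R := by
  have h : ∀ s : Fin n × Bool, ∃ R, EdgeConst f R c (c * letter s) := fun s =>
    exists_edgeConst hf (adj_iff_letter.2 ⟨s, rfl⟩)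
  choose R hR using h
  refine ⟨Finset.univ.sup R, fun ξ η he => ?_⟩
  have h1 : nxt c ξ = nxt c η := rayTo_pt_eq_of_le he 1 (by omega)
  obtain ⟨s, hs⟩ := adj_iff_letter.1 (nxt_adj c ξ)
  exact ((hR s).mono (Finset.le_sup (Finset.mem_univ s))) ξ hs η (h1.symm.trans hs) he

theorem EdgeConst.of_succ {f : Boundary n → ℤ} {R : ℕ} {x y z : F n} (hxy : (tree n).Adj x y)
    (h : EdgeConst f (R + 1) x y) (hz : z ≠ x) : EdgeConst f R y z := by
  intro ξ hξ η hη he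
  have hξ' := edgeShadow_subset hxy hz hξ
  have hη' := edgeShadow_subset hxy hz hη
  refine h ξ hξ' η hη' ?_
  rw [← rayTo_of_mem hξ', ← rayTo_of_mem hη', he]

/-- The level of the relation matches the depth of constancy: passing to a next edge lowers both by
one, and at level zero the function is constant behind the whole edge. -/
theorem eq_of_rel {f : Boundary n → ℤ} (hf : LineInvariant W f) {R : ℕ} {x y : F n}
    (hxy : (tree n).Adj x y) (h : EdgeConst f R x y) {ξ η : Boundary n} (hξ : ξ ∈ edgeShadow x y)
    (hη : η ∈ edgeShadow x y) (hr : rel W R x y ξ η) : f ξ = f η := by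
  induction R generalizing x y ξ η with
  | zero => exact h ξ hξ η hη (hξ.trans hη.symm)
  | succ R ih =>
    clear hξ hη
    induction hr with
    | rel α β hab =>
      rcases hab with ⟨z, h1, h2, h3, h4, h5⟩ | ⟨h1, h2, h3⟩
      · exact ih h2 (h.of_succ hxy h1) h3 h4 h5
      · exact hf _ _ h3
    | refl α => rfl
    | symm α β _ h => exact h.symm
    | trans α β γ _ _ h h' => exact h.trans h'

/-- The depth at which `f` becomes constant depends on `f`, but stability promotes a relation
between line ends from level `r` to every deeper level. So one `r` serves all functions at once. -/
theorem Stable.eq_of_rel {f : Boundary n → ℤ} {r : ℕ} (hr : Stable W r) (hf : LineInvariant W f)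
    (hc : IsLocallyConstant f) {x y : F n} (hxy : (tree n).Adj x y) {ξ η : Boundary n}
    (hξ : ξ ∈ ends W x y) (hη : η ∈ ends W x y) (h : rel W r x y ξ η) : f ξ = f η := by
  have key : ∀ k, Stable W (r + k) ∧ rel W (r + k) x y ξ η := by
    intro k
    induction k with
    | zero => exact ⟨hr, h⟩
    | succ k ih => exact ⟨ih.1.succ, ih.1 x y hxy ξ hξ η hη ih.2⟩
  obtain ⟨R, hR⟩ := exists_edgeConst hc hxy
  exact LinePattern.eq_of_rel hf hxy (hR.mono (Nat.le_add_left R r)) hξ.1 hη.1 (key R).2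

/-- This bounds the support of the parts: representatives depend only on the first `r + 1` steps of
the ray. -/
theorem rel_of_rayTo {r : ℕ} {x : F n} {ξ η : Boundary n}
    (h : (rayTo x ξ).pt (r + 1) = (rayTo x η).pt (r + 1)) : rel W r x (nxt x ξ) ξ η := by
  induction r generalizing x with
  | zero => trivial
  | succ r ih =>
    have h1 : nxt x ξ = nxt x η := rayTo_pt_eq_of_le h 1 (by omega)
    have h2 : nxt (nxt x ξ) ξ = nxt (nxt x ξ) η := by
      have := rayTo_pt_eq_of_le h 2 (by omega)
      rw [rayTo_two, rayTo_two, ← h1] at this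
      exact this
    refine rel_succ_of_rel (nxt_nxt_ne x ξ) (nxt_adj _ _) rfl h2.symm (ih ?_)
    rw [rayTo_nxt, h1, rayTo_nxt, h]

/-! ### Parts of a function at vertices and edges -/

open Classical in
/-- An element that satisfies `P` if there is one, and otherwise a base point behind the edge from
`x` to `y` (or `ξ` if there is no such point). -/
def pick (P : Boundary n → Prop) (x y : F n) (ξ : Boundary n) : Boundary n :=
  if h : ∃ η, P η then h.choose
  else if h : (edgeShadow x y).Nonempty then h.choose else ξ

variable (W) in
/-- A representative of the component of `ξ` behind the edge from `x` to `y`: an end of a line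
through the edge if the component contains one, and a base point otherwise. -/
def rep (r : ℕ) (x y : F n) (ξ : Boundary n) : Boundary n :=
  pick (fun η => η ∈ ends W x y ∧ rel W r x y ξ η) x y ξ

theorem rep_mem (r : ℕ) {x y : F n} {ξ : Boundary n} (h : ξ ∈ edgeShadow x y) :
    rep W r x y ξ ∈ edgeShadow x y := by
  rw [rep, pick]
  split_ifs with h1 h2
  · exact h1.choose_spec.1.1
  · exact h2.choose_spec
  · exact h

/-- The choice depends only on the predicate, which is the same for related points. The last default
in `pick` does not occur, since `ξ` itself shows that there are points behind the edge. -/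
theorem rep_eq {r : ℕ} {x y : F n} {ξ η : Boundary n} (hξ : ξ ∈ edgeShadow x y)
    (h : rel W r x y ξ η) : rep W r x y ξ = rep W r x y η := by
  have e : (fun ζ => ζ ∈ ends W x y ∧ rel W r x y ξ ζ) =
      fun ζ => ζ ∈ ends W x y ∧ rel W r x y η ζ := by
    funext ζ
    exact propext (and_congr_right fun _ =>
      ⟨fun h' => rel_trans (rel_symm h) h', fun h' => rel_trans h h'⟩)
  have hne : (edgeShadow x y).Nonempty := ⟨ξ, hξ⟩
  rw [rep, rep, e, pick, pick]
  split_ifs <;> rfl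

theorem apply_rep {f : Boundary n → ℤ} {r : ℕ} (hr : Stable W r) (hf : LineInvariant W f)
    (hc : IsLocallyConstant f) {x y : F n} (hxy : (tree n).Adj x y) {ξ : Boundary n}
    (hξ : ξ ∈ ends W x y) : f (rep W r x y ξ) = f ξ := by
  have h : ∃ η, η ∈ ends W x y ∧ rel W r x y ξ η := ⟨ξ, hξ, rel_refl _ _ _ _⟩
  rw [rep, pick, dif_pos h]
  exact (hr.eq_of_rel hf hc hxy hξ h.choose_spec.1 h.choose_spec.2).symm

variable (W) in
/-- The part of `f` at the vertex `v`. -/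
def vertexPart (r : ℕ) (f : Boundary n → ℤ) (v : F n) (ξ : Boundary n) : ℤ :=
  f (rep W r v (nxt v ξ) ξ)

variable (W) in
open Classical in
/-- The part of `f` at the edge from `x` to `y`. -/
def edgePart (r : ℕ) (f : Boundary n → ℤ) (x y : F n) (ξ : Boundary n) : ℤ :=
  if nxt x ξ = y then f (rep W r x y ξ) else f (rep W r y x ξ)

theorem edgePart_comm (r : ℕ) (f : Boundary n → ℤ) {x y : F n} (hxy : (tree n).Adj x y) :
    edgePart W r f x y = edgePart W r f y x := by
  funext ξ
  rw [edgePart, edgePart]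
  by_cases h : nxt x ξ = y
  · rw [if_pos h, if_neg ((nxt_eq_iff hxy).1 h)]
  · rw [if_neg h, if_pos (nxt_eq_of_ne hxy h)]

/-- If both ends of a line are behind the same edge at `v`, they are related and share a
representative. Otherwise the line passes through `v`, and at each of its ends the representative
has the same value of `f` as the end. -/
theorem vertexPart_invariant {f : Boundary n → ℤ} {r : ℕ} (hr : Stable W r)
    (hf : LineInvariant W f) (hc : IsLocallyConstant f) (v : F n) :
    LineInvariant W (vertexPart W r f v) := by
  intro ξ η hp
  rw [vertexPart, vertexPart]
  by_cases h : nxt v ξ = nxt v η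
  · rw [← h, rep_eq rfl (rel_of_partner r rfl h.symm hp)]
  · rw [apply_rep hr hf hc (nxt_adj v ξ) ⟨rfl, η, fun h' => h (Eq.symm h'), hp⟩,
      apply_rep hr hf hc (nxt_adj v η) ⟨rfl, ξ, h, hp.symm⟩]
    exact hf _ _ hp

theorem edgePart_invariant {f : Boundary n → ℤ} {r : ℕ} (hr : Stable W r)
    (hf : LineInvariant W f) (hc : IsLocallyConstant f) {x y : F n} (hxy : (tree n).Adj x y) :
    LineInvariant W (edgePart W r f x y) := by
  have key : ∀ ξ η, Partner W ξ η → nxt x ξ = y → nxt x η ≠ y →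
      f (rep W r x y ξ) = f (rep W r y x η) := by
    intro ξ η hp h1 h2
    rw [apply_rep hr hf hc hxy ⟨h1, η, h2, hp⟩, apply_rep hr hf hc hxy.symm
      ⟨nxt_eq_of_ne hxy h2, ξ, (nxt_eq_iff hxy).1 h1, hp.symm⟩]
    exact hf _ _ hp
  intro ξ η hp
  rw [edgePart, edgePart]
  split_ifs with h1 h2 h2
  · rw [rep_eq h1 (rel_of_partner r h1 h2 hp)]
  · exact key ξ η hp h1 h2
  · exact (key η ξ hp.symm h2 h1).symm
  · have h3 := nxt_eq_of_ne hxy h1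
    rw [rep_eq h3 (rel_of_partner r h3 (nxt_eq_of_ne hxy h2) hp)]

theorem vertexPart_ballConst (r : ℕ) (f : Boundary n → ℤ) (v : F n) :
    BallConst (vertexPart W r f v) v r := by
  intro ξ η h
  have h1 : nxt v ξ = nxt v η := rayTo_pt_eq_of_le h 1 (by omega)
  rw [vertexPart, vertexPart, ← h1, rep_eq rfl (rel_of_rayTo h)]

theorem edgePart_ballConst (r : ℕ) (f : Boundary n → ℤ) {x y : F n} (hxy : (tree n).Adj x y) :
    BallConst (edgePart W r f x y) x r := by
  intro ξ η h
  have h1 : nxt x ξ = nxt x η := rayTo_pt_eq_of_le h 1 (by omega)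
  rw [edgePart, edgePart, ← h1]
  split_ifs with h2
  · subst h2
    rw [rep_eq rfl (rel_of_rayTo h)]
  · have h3 : nxt y ξ = x := nxt_eq_of_ne hxy h2
    have h4 : nxt y η = x := nxt_eq_of_ne hxy (h1 ▸ h2)
    have h5 : rel W r y x ξ η := by
      have : (rayTo y ξ).pt (r + 1) = (rayTo y η).pt (r + 1) := by
        rw [← rayTo_nxt, ← rayTo_nxt, h3, h4]
        exact rayTo_pt_eq_of_le h r (by omega)
      have h6 := rel_of_rayTo (W := W) this
      rwa [h3] at h6
    rw [rep_eq h3 h5]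

/-- The two parts use the same representative behind the edge from `v` to `u`. Elsewhere both
representatives are behind the edge from `u` to `v`, where `f` is constant. This is the cancellation
far from the support of `f`. -/
theorem vertexPart_eq_edgePart (r : ℕ) {f : Boundary n → ℤ} {u v : F n} (huv : (tree n).Adj u v)
    (h : ∀ ξ ∈ edgeShadow u v, ∀ η ∈ edgeShadow u v, f ξ = f η) :
    vertexPart W r f v = edgePart W r f v u := by
  funext ξ
  rw [vertexPart, edgePart]
  split_ifs with h1
  · rw [h1]
  · have h2 : nxt u ξ = v := nxt_eq_of_ne huv.symm h1
    exact h _ (edgeShadow_subset huv h1 (rep_mem r rfl)) _ (rep_mem r h2)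

/-- A function that is constant behind the edges leaving a ball is constant behind all edges
outside of the ball that point away from the centre. -/
theorem BallConst.const {f : Boundary n → ℤ} {c : F n} {R : ℕ} (h : BallConst f c R) {u v : F n}
    (hd : treeDist c v = treeDist c u + 1) (hv : R < treeDist c v) :
    ∀ ξ ∈ edgeShadow u v, ∀ η ∈ edgeShadow u v, f ξ = f η := by
  have key : ∀ ξ ∈ edgeShadow u v, (rayTo c ξ).pt (treeDist c u + 1) = v := by
    intro ξ hξ
    have := rayTo_pt_dist c (v := u) (ξ := ξ) (by rw [mem_edgeShadow.1 hξ, hd])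
    rw [← nxt_rayTo, this, mem_edgeShadow.1 hξ]
  intro ξ hξ η hη
  exact h ξ η (rayTo_pt_eq_of_le ((key ξ hξ).trans (key η hη).symm) _ (by omega))

variable (W) in
/-- The part of `f` at an unoriented edge. -/
def edgePart' (r : ℕ) (f : Boundary n → ℤ) (e : Sym2 (F n)) : Boundary n → ℤ :=
  edgePart W r f (Quot.out e).1 (Quot.out e).2

theorem edgePart'_mk (r : ℕ) (f : Boundary n → ℤ) {x y : F n} (hxy : (tree n).Adj x y) :
    edgePart' W r f s(x, y) = edgePart W r f x y := by
  have h : s((Quot.out s(x, y)).1, (Quot.out s(x, y)).2) = s(x, y) := Quot.out_eq s(x, y)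
  rw [edgePart']
  rcases Sym2.eq_iff.1 h with ⟨h1, h2⟩ | ⟨h1, h2⟩
  · rw [h1, h2]
  · rw [h1, h2, edgePart_comm r f hxy.symm]

/-! ### Recovering a function from its parts -/

open Classical in
/-- The edges of the tree between vertices of a finite set. -/
def edgesIn (Y : Finset (F n)) : Finset (Sym2 (F n)) := {e ∈ Y.sym2 | e ∈ (tree n).edgeSet}

open Classical in
/-- A sum over edges, rewritten as a sum over vertices by means of an orientation in which each
vertex is the source of at most one edge. -/
theorem sum_edgesIn {A : Type} [AddCommMonoid A] {o : F n → F n}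
    (ho : ∀ a b, (tree n).Adj a b → (o a = b ∧ o b ≠ a) ∨ (o b = a ∧ o a ≠ b))
    (Y : Finset (F n)) (φ : Sym2 (F n) → A) :
    ∑ e ∈ edgesIn Y, φ e =
      ∑ v ∈ {v ∈ Y | (tree n).Adj v (o v) ∧ o v ∈ Y}, φ s(v, o v) := by
  symm
  refine Finset.sum_bij (fun v _ => s(v, o v)) ?_ ?_ ?_ fun _ _ => rfl
  · intro v hv
    simp only [Finset.mem_filter] at hv
    simp only [edgesIn, Finset.mem_filter, Finset.mk_mem_sym2_iff, SimpleGraph.mem_edgeSet]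
    exact ⟨⟨hv.1, hv.2.2⟩, hv.2.1⟩
  · intro v hv w hw h
    simp only [Finset.mem_filter] at hv hw
    rcases Sym2.eq_iff.1 h with ⟨h1, -⟩ | ⟨h1, h2⟩
    · exact h1
    · exfalso
      rcases ho v w (h2 ▸ hv.2.1) with ⟨-, h4⟩ | ⟨-, h4⟩
      · exact h4 h1.symm
      · exact h4 h2
  · intro e he
    induction e using Sym2.ind with
    | _ a b =>
      simp only [edgesIn, Finset.mem_filter, Finset.mk_mem_sym2_iff,
        SimpleGraph.mem_edgeSet] at he
      obtain ⟨⟨ha, hb⟩, hab⟩ := he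
      rcases ho a b hab with ⟨h, -⟩ | ⟨h, -⟩
      · exact ⟨a, by simp [ha, h, hab, hb], by rw [h]⟩
      · exact ⟨b, by simp [ha, h, hab.symm, hb], by rw [h, Sym2.eq_swap]⟩

/-- A function that is constant outside of a ball is recovered from its parts in this ball. -/
theorem eq_sum_parts {f : Boundary n → ℤ} (r : ℕ) {c : F n} {R : ℕ} (h : BallConst f c R)
    {Y : Finset (F n)} (hY : ∀ v, v ∈ Y ↔ treeDist c v ≤ R) :
    f = ∑ v ∈ Y, vertexPart W r f v - ∑ e ∈ edgesIn Y, edgePart' W r f e := by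
  classical
  funext ξ
  -- Each edge is oriented towards `ξ`; its part then has, at `ξ`, the same value as the part at its
  -- source.
  rw [Pi.sub_apply, Finset.sum_apply, Finset.sum_apply,
    sum_edgesIn (o := fun v => nxt v ξ) (fun a b hab => ?_) Y]
  swap
  · by_cases h1 : nxt a ξ = b
    · exact Or.inl ⟨h1, (nxt_eq_iff hab).1 h1⟩
    · exact Or.inr ⟨nxt_eq_of_ne hab h1, h1⟩
  have e1 : ∀ v, edgePart' W r f s(v, nxt v ξ) ξ = vertexPart W r f v ξ := by
    intro v
    rw [edgePart'_mk r f (nxt_adj v ξ), edgePart, if_pos rfl, vertexPart]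
  simp only [e1]
  -- The last vertex of the ball on the ray to `ξ` is the only one whose outgoing edge leaves the
  -- ball, so its part survives alone. Its value is `f ξ`, because the representative is behind the
  -- same leaving edge as `ξ`.
  set v₀ := (rayTo c ξ).pt R
  have hv₀ : {v ∈ Y | (tree n).Adj v (nxt v ξ) ∧ nxt v ξ ∈ Y} = Y.erase v₀ := by
    ext v
    simp only [Finset.mem_filter, Finset.mem_erase, nxt_adj, true_and]
    constructor
    · rintro ⟨h1, h2⟩
      refine ⟨?_, h1⟩
      rintro rfl
      rw [nxt_rayTo, hY, rayTo_dist] at h2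
      omega
    · rintro ⟨h1, h2⟩
      refine ⟨h2, ?_⟩
      by_contra h3
      rw [hY] at h2 h3
      have h4 := adj_dist (nxt_adj v ξ) c
      rw [treeDist_comm v, treeDist_comm (nxt v ξ)] at h4
      have h5 := rayTo_pt_dist c (v := v) (ξ := ξ) (by omega)
      have h6 : treeDist c v = R := by omega
      rw [h6] at h5
      exact h1 h5.symm
  have hmem : v₀ ∈ Y := by rw [hY, rayTo_dist]
  rw [hv₀, ← Finset.add_sum_erase Y _ hmem, add_sub_cancel_right, vertexPart]
  apply h
  exact (rayTo_pt_eq_of_nxt ((rep_mem r rfl).trans (nxt_rayTo c ξ R)) _ le_rfl).symm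

end Parts
end LinePattern

namespace CechZero

/-! ## Classes in degree zero as functions -/

section Evaluation

variable {X Y : Type} [TopologicalSpace X] [TopologicalSpace Y]

instance : IsDirectedOrder (OpenCover X) where
  directed 𝒰 𝒱 := by
    refine ⟨⟨{O | ∃ U ∈ 𝒰.sets, ∃ V ∈ 𝒱.sets, O = U ⊓ V}, fun x => ?_⟩, ?_, ?_⟩
    · obtain ⟨U, hU, hx⟩ := 𝒰.covers x
      obtain ⟨V, hV, hx'⟩ := 𝒱.covers x
      exact ⟨U ⊓ V, ⟨U, hU, V, hV, rfl⟩, hx, hx'⟩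
    · rintro _ ⟨U, hU, V, hV, rfl⟩
      exact ⟨U, hU, inf_le_left⟩
    · rintro _ ⟨U, hU, V, hV, rfl⟩
      exact ⟨V, hV, inf_le_right⟩

instance : Nonempty (OpenCover X) := ⟨⟨{⊤}, fun _ => ⟨⊤, rfl, trivial⟩⟩⟩

theorem exists_toCech (c : Cech X) : ∃ 𝒰 f, toCech 𝒰 f = c :=
  AddCommGroup.DirectLimit.induction_on (C := fun c => ∃ 𝒰 f, toCech 𝒰 f = c) c
    fun 𝒰 f => ⟨𝒰, f, rfl⟩

/-- The member of a cover that is chosen for a point, as a vertex of the nerve. -/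
def vertexAt (𝒰 : OpenCover X) (x : X) : Vertex 𝒰 :=
  ⟨(𝒰.covers x).choose, (𝒰.covers x).choose_spec.1, ⟨x, (𝒰.covers x).choose_spec.2⟩⟩

/-- The function on `X` given by an element of `H⁰(𝒰, ℤ)`. -/
def evalH0 (𝒰 : OpenCover X) : H0 𝒰 →+ (X → ℤ) where
  toFun f x := f.1 (vertexAt 𝒰 x)
  map_zero' := rfl
  map_add' _ _ := rfl

theorem evalH0_apply {𝒰 : OpenCover X} (f : H0 𝒰) {x : X} {V : Vertex 𝒰} (h : x ∈ V.1) :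
    evalH0 𝒰 f x = f.1 V :=
  H0.eq_of_inter f _ _ ⟨x, (𝒰.covers x).choose_spec.2, h⟩

/-- The function on `X` given by a class. -/
def eval : Cech X →+ (X → ℤ) :=
  AddCommGroup.DirectLimit.lift (fun 𝒰 : OpenCover X => H0 𝒰) res (X → ℤ) evalH0 (by
    intro 𝒰 𝒱 h f
    funext x
    exact (evalH0_apply f (V := refine h (vertexAt 𝒱 x))
      (le_refine h (vertexAt 𝒱 x) (𝒱.covers x).choose_spec.2)).symm)

theorem eval_toCech (𝒰 : OpenCover X) (f : H0 𝒰) : eval (toCech 𝒰 f) = evalH0 𝒰 f :=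
  AddCommGroup.DirectLimit.lift_of _ _ _ _ _

/-- Every vertex of the nerve is a nonempty open set, so the function determines the value on it. -/
theorem eval_injective : Function.Injective (eval : Cech X →+ (X → ℤ)) := by
  rw [injective_iff_map_eq_zero]
  intro c hc
  obtain ⟨𝒰, f, rfl⟩ := exists_toCech c
  rw [eval_toCech] at hc
  have : f = 0 := by
    apply Subtype.ext
    funext V
    obtain ⟨x, hx⟩ := V.2.2
    rw [← evalH0_apply f hx, hc]; rfl
  rw [this, map_zero]

theorem eval_pull (φ : X ≃ₜ Y) (c : Cech Y) (x : X) : eval (pull φ c) x = eval c (φ x) := by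
  obtain ⟨𝒰, f, rfl⟩ := exists_toCech c
  rw [pull_toCech, eval_toCech, eval_toCech]
  symm
  refine evalH0_apply f (V := (vertexAt (𝒰.pullback φ) x).push φ) ?_
  have : x ∈ (vertexAt (𝒰.pullback φ) x).1 := ((𝒰.pullback φ).covers x).choose_spec.2
  simpa [Vertex.push] using this

theorem eval_eq_of_mem {𝒰 : OpenCover X} (f : H0 𝒰) {U : Opens X} (hU : U ∈ 𝒰.sets) {x y : X}
    (hx : x ∈ U) (hy : y ∈ U) : eval (toCech 𝒰 f) x = eval (toCech 𝒰 f) y := by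
  rw [eval_toCech, evalH0_apply f (V := ⟨U, hU, x, hx⟩) hx,
    evalH0_apply f (V := ⟨U, hU, x, hx⟩) hy]

theorem eval_isLocallyConstant (c : Cech X) : IsLocallyConstant (eval c) := by
  obtain ⟨𝒰, f, rfl⟩ := exists_toCech c
  rw [IsLocallyConstant.iff_exists_open]
  intro x
  obtain ⟨U, hU, hx⟩ := 𝒰.covers x
  exact ⟨U, U.2, hx, fun y hy => eval_eq_of_mem f hU hy hx⟩

theorem exists_eval_toCech (𝒰 : OpenCover X) (φ : X → ℤ)
    (h : ∀ U ∈ 𝒰.sets, ∀ x ∈ U, ∀ y ∈ U, φ x = φ y) : ∃ f : H0 𝒰, eval (toCech 𝒰 f) = φ := by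
  refine ⟨⟨fun V => φ V.2.2.choose, ?_⟩, ?_⟩
  · rw [AddMonoidHom.mem_ker]
    funext e
    refine sub_eq_zero.2 ?_
    obtain ⟨x, hx1, hx2⟩ := e.2
    exact (h _ e.1.2.2.1 _ e.1.2.2.2.choose_spec x hx2).trans
      (h _ e.1.1.2.1 x hx1 _ e.1.1.2.2.choose_spec)
  · funext x
    rw [eval_toCech]
    exact h _ (vertexAt 𝒰 x).2.1 _ (vertexAt 𝒰 x).2.2.choose_spec x (𝒰.covers x).choose_spec.2

end Evaluation

end CechZero

namespace LinePattern

open CechZero MulOpposite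

section Classes

variable {n : ℕ} {W : Set (F n)}

/-- The function on the boundary given by a class of the decomposition space. -/
def val : Cech (Decomp W) →+ (Boundary n → ℤ) where
  toFun c ξ := eval c (proj W ξ)
  map_zero' := by rw [map_zero]; rfl
  map_add' _ _ := by rw [map_add]; rfl

theorem val_apply (c : Cech (Decomp W)) (ξ : Boundary n) : val c ξ = eval c (proj W ξ) := rfl

theorem val_injective : Function.Injective (val : Cech (Decomp W) →+ (Boundary n → ℤ)) := by
  intro c c' h
  apply eval_injective
  funext d
  induction d using Quot.inductionOn with
  | h ξ => exact congrFun h ξ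

theorem val_smul (g : F n) (c : Cech (Decomp W)) (ξ : Boundary n) :
    val (op g • c) ξ = val c (g • ξ) :=
  eval_pull (Homeomorph.smul g) c (proj W ξ)

theorem proj_eq_of_partner {ξ η : Boundary n} (h : Partner W ξ η) : proj W ξ = proj W η := by
  rcases h with h | h
  · exact Quot.sound h
  · exact (Quot.sound h).symm

theorem val_invariant (c : Cech (Decomp W)) : LineInvariant W (val c) := by
  intro ξ η h
  rw [val_apply, val_apply, proj_eq_of_partner h]

theorem val_isLocallyConstant (c : Cech (Decomp W)) : IsLocallyConstant (val c) :=
  (eval_isLocallyConstant c).comp_continuous continuous_quot_mk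

end Classes

/-! ## Subtrees and the vertices of Whitehead graphs -/

section Subtrees

variable {n : ℕ} {W : Set (F n)} {X : Set (F n)}

/-- A path in `X` that avoids `step a b` can never cross the edge from `a` to it, so it stays on the
side of `a`, whereas `b` is on the other side. -/
theorem IsSubtree.step_mem (h : IsSubtree X) {a b : F n} (ha : a ∈ X) (hb : b ∈ X) :
    step a b ∈ X := by
  by_contra hs
  have hab : a ≠ b := by rintro rfl; rw [step_self] at hs; exact hs ha
  have hr := (SimpleGraph.reachable_iff_reflTransGen _ _).1 (h ⟨a, ha⟩ ⟨b, hb⟩)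
  have key : ∀ u : X, Relation.ReflTransGen ((tree n).induce X).Adj ⟨a, ha⟩ u →
      treeDist u.1 a < treeDist u.1 (step a b) := by
    intro u hu
    induction hu with
    | refl =>
      rw [treeDist_self, adj_iff_dist.1 (step_adj hab)]; exact Nat.one_pos
    | tail _ h1 ih =>
      rename_i v w _
      by_contra h2
      have h3 := adj_dist (step_adj hab) w.1
      rw [treeDist_comm a, treeDist_comm (step a b)] at h3
      have h4 := crossing_edge (SimpleGraph.comap_adj.1 h1) (step_adj hab) ih
        (show treeDist w.1 _ < treeDist w.1 _ by omega)
      exact hs (h4.2 ▸ w.2)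
  have h1 := key _ hr
  have h2 := step_dist hab
  rw [treeDist_comm, treeDist_comm (step a b)] at h2
  simp only at h1
  omega

theorem isSubtree_of_step_mem (h : ∀ a ∈ X, ∀ b ∈ X, step a b ∈ X) : IsSubtree X := by
  rintro ⟨a, ha⟩ ⟨b, hb⟩
  induction hk : treeDist a b generalizing a with
  | zero =>
    obtain rfl := treeDist_eq_zero.1 hk
    exact SimpleGraph.Reachable.refl _
  | succ k ih =>
    have hne : a ≠ b := by rintro rfl; simp at hk
    have h1 := step_dist hne
    refine SimpleGraph.Reachable.trans (SimpleGraph.Adj.reachable ?_)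
      (ih (step a b) (h a ha b hb) (by omega))
    exact SimpleGraph.comap_adj.2 (step_adj hne)

/-- The ball of radius `t` about `c`. -/
def ballAt (c : F n) (t : ℕ) : Set (F n) := {v | treeDist c v ≤ t}

theorem ballAt_one (t : ℕ) : ballAt (1 : F n) t = ball n t := by
  ext v; simp [ballAt, ball, treeDist_one]

theorem isSubtree_ballAt (c : F n) (t : ℕ) : IsSubtree (ballAt c t) := by
  refine isSubtree_of_step_mem fun a ha b hb => ?_
  by_cases hab : a = b
  · rw [hab, step_self]; exact hb
  have ha : treeDist c a ≤ t := ha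
  have hb : treeDist c b ≤ t := hb
  by_contra hs
  have hs : ¬ treeDist c (step a b) ≤ t := hs
  have h1 := adj_dist (step_adj hab) c
  rw [treeDist_comm a, treeDist_comm (step a b)] at h1
  -- Once the geodesic to `b` moves away from `c`, it keeps doing so: the only neighbour nearer to
  -- `c` is the vertex just left. So leaving the ball would force `b` outside.
  have key : ∀ (k : ℕ) (u v : F n), (tree n).Adj u v → step u b = v → treeDist v b = k →
      treeDist c v = treeDist c u + 1 → treeDist c v ≤ treeDist c b := by
    intro k
    induction k with
    | zero => intro u v _ _ h0 _; rw [treeDist_eq_zero.1 h0]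
    | succ k ih =>
      intro u v huv hu hk hd
      have hvb : v ≠ b := by rintro rfl; simp at hk
      have h2 := step_dist hvb
      have hvu : step v b ≠ u := by
        rcases step_or_step huv b with h | h
        · exact h.2.1
        · exact absurd hu h.2.1
      have h3 : treeDist c (step v b) = treeDist c v + 1 := by
        have h4 := adj_dist (step_adj hvb) c
        rw [treeDist_comm v c, treeDist_comm (step v b) c] at h4
        rcases h4 with h4 | h4
        · exact absurd (adj_dist_unique (step_adj hvb) huv.symm (c := c)
            (by rw [treeDist_comm, treeDist_comm v]; omega)
            (by rw [treeDist_comm, treeDist_comm v]; omega)) hvu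
        · exact h4
      have := ih v (step v b) (step_adj hvb) rfl (by omega) h3
      omega
  have := key _ a (step a b) (step_adj hab) rfl rfl (by omega)
  omega

theorem ballAt_finite (c : F n) (t : ℕ) : (ballAt c t).Finite :=
  (ball_finite n t).of_injOn (f := fun v => c⁻¹ * v) (fun _ hv => hv)
    (fun _ _ _ _ h => mul_left_cancel h)

theorem ballAt_encard_le (c : F n) (t : ℕ) :
    (ballAt c t).encard ≤ (((2 * n + 1) ^ t : ℕ) : ℕ∞) := by
  obtain ⟨B, hB, hc⟩ := exists_finset_ball n t
  have h1 : (ballAt c t).encard ≤ (B : Set (F n)).encard :=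
    Set.encard_le_encard_of_injOn (f := fun v => c⁻¹ * v) (fun v hv => hB hv)
      (fun _ _ _ _ h => mul_left_cancel h)
  refine h1.trans ?_
  rw [Set.encard_coe_eq_coe_finsetCard]
  exact_mod_cast hc

/-- The vertex of the subtree that is adjacent to a vertex of its Whitehead graph. -/
def WhVertex.root (a : WhVertex X) : F n := a.2.2.choose

theorem WhVertex.root_mem (a : WhVertex X) : a.root ∈ X := a.2.2.choose_spec.1

theorem WhVertex.root_adj (a : WhVertex X) : (tree n).Adj a.root a.1 := a.2.2.choose_spec.2

theorem WhVertex.dist_root (hX : IsSubtree X) (a : WhVertex X) {x : F n} (hx : x ∈ X) :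
    treeDist x a.1 = treeDist x a.root + 1 := by
  have h := adj_dist a.root_adj x
  rw [treeDist_comm a.root, treeDist_comm a.1] at h
  rcases h with h | h
  · exfalso
    refine a.2.1 ?_
    rw [eq_step a.root_adj (c := x) (by rw [treeDist_comm, treeDist_comm a.root]; omega)]
    exact hX.step_mem a.root_mem hx
  · exact h

theorem WhVertex.root_eq (hX : IsSubtree X) (a : WhVertex X) {x : F n} (hx : x ∈ X)
    (h : (tree n).Adj x a.1) : x = a.root := by
  have := a.dist_root hX hx
  rw [adj_iff_dist.1 h] at this
  exact treeDist_eq_zero.1 (by omega)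

/-- The boundary points behind a vertex of the Whitehead graph. -/
def WhVertex.behind (a : WhVertex X) : Set (Boundary n) := edgeShadow a.root a.1

theorem WhShadow_eq (hX : IsSubtree X) (a : WhVertex X) : WhShadow a = a.behind := by
  ext ξ
  simp only [WhShadow, Set.mem_iUnion, exists_prop]
  constructor
  · rintro ⟨x, hx, h⟩
    obtain ⟨k, hk⟩ := mem_shadow_iff.1 h
    have h1 := a.dist_root hX hx
    have h2 := rayTo_dist x ξ k
    rw [hk, h1] at h2
    subst h2
    have h3 := (rayTo x ξ).pt_eq_step (treeDist x a.root)
    rw [hk, rayTo_zero, ← eq_step a.root_adj.symm (c := x)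
      (by rw [treeDist_comm, treeDist_comm a.1]; omega)] at h3
    have h4 := nxt_rayTo x ξ (treeDist x a.root)
    rw [h3, hk] at h4
    exact h4
  · intro h
    refine ⟨a.root, a.root_mem, ?_⟩
    rw [← edgeShadow_eq_shadow a.root_adj]
    exact h

theorem exists_behind (hX : IsSubtree X) (hfin : X.Finite) (hne : X.Nonempty) (ξ : Boundary n) :
    ∃ a : WhVertex X, ξ ∈ a.behind := by
  obtain ⟨x, hx⟩ := hne
  have : ∃ k, (rayTo x ξ).pt k ∉ X := by
    by_contra h
    push Not at h
    refine (Set.infinite_of_injective_forall_mem (f := fun k => (rayTo x ξ).pt k) ?_ h) hfin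
    intro i j hij
    have := congrArg (treeDist x) hij
    simpa [rayTo_dist] using this
  classical
  have h1 := Nat.find_spec this
  rcases hk : Nat.find this with - | k
  · rw [hk, rayTo_zero] at h1; exact absurd hx h1
  · have h2 : (rayTo x ξ).pt k ∈ X := by
      by_contra h
      have := Nat.find_min' this h
      omega
    rw [hk] at h1
    let a : WhVertex X := ⟨(rayTo x ξ).pt (k + 1), h1, (rayTo x ξ).pt k, h2, (rayTo x ξ).adj k⟩
    refine ⟨a, ?_⟩
    have h3 := a.root_eq hX h2 ((rayTo x ξ).adj k)
    change nxt a.root ξ = (rayTo x ξ).pt (k + 1)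
    rw [← h3, nxt_rayTo]

theorem WhVertex.ext_behind (hX : IsSubtree X) {a b : WhVertex X} {ξ : Boundary n}
    (ha : ξ ∈ a.behind) (hb : ξ ∈ b.behind) : a = b := by
  have ha' : nxt a.root ξ = a.1 := ha
  have hb' : nxt b.root ξ = b.1 := hb
  by_cases h : a.root = b.root
  · exact Subtype.ext (by rw [← ha', h, hb'])
  · exfalso
    have h1 := rayTo_pt_dist b.root (v := a.root) (ξ := ξ)
      (by rw [ha', a.dist_root hX b.root_mem])
    obtain ⟨k, hk⟩ : ∃ k, treeDist b.root a.root = k + 1 :=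
      Nat.exists_eq_add_one.2 (Nat.pos_of_ne_zero fun h0 => h (treeDist_eq_zero.1 h0).symm)
    rw [hk, ← rayTo_of_mem hb] at h1
    have h2 := rayTo_dist b.1 ξ k
    rw [h1] at h2
    have h3 := b.dist_root hX a.root_mem
    rw [treeDist_comm, h2, treeDist_comm, hk] at h3
    omega

theorem WhVertex.dist_root_whVertex (hX : IsSubtree X) {a b : WhVertex X} (hab : a ≠ b) :
    treeDist b.1 a.1 = treeDist b.root a.1 + 1 := by
  have h1 := adj_dist b.root_adj a.1
  rcases h1 with h1 | h1
  · exfalso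
    have h2 := a.dist_root hX b.root_mem
    have h3 : treeDist b.root a.root ≠ 0 := by
      intro h0
      have : treeDist b.1 a.1 = 0 := by omega
      exact hab (Subtype.ext (treeDist_eq_zero.1 this).symm)
    have hne : b.root ≠ a.root := fun h => h3 (treeDist_eq_zero.2 h)
    have h4 := step_dist hne
    have h5 := treeDist_triangle (step b.root a.root) a.root a.1
    rw [adj_iff_dist.1 a.root_adj] at h5
    have h6 := adj_dist_unique b.root_adj (step_adj hne) (c := a.1) (by omega) (by omega)
    exact b.2.1 (h6 ▸ hX.step_mem b.root_mem a.root_mem)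
  · exact h1

theorem WhVertex.posRay_mem_behind (hX : IsSubtree X) {a b : WhVertex X} (hab : a ≠ b)
    {l : Geodesic n} {i j : ℤ} (hij : i < j) (hi : l.pt i = a.1) (hj : l.pt j = b.1) :
    l.posRay.limit ∈ b.behind := by
  have h1 := WhVertex.dist_root_whVertex hX hab
  obtain ⟨k, rfl⟩ : ∃ k : ℕ, j = i + (k + 1 : ℕ) := ⟨(j - i - 1).toNat, by push_cast; omega⟩
  have h2 := l.dist_add i k
  have h3 := l.dist_add i (k + 1)
  rw [hi, hj] at h3
  rw [hi] at h2
  have h4 : (tree n).Adj b.1 (l.pt (i + k)) := by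
    have := (l.adj (i + k)).symm
    rwa [show i + (k : ℤ) + 1 = i + (k + 1 : ℕ) by push_cast; ring, hj] at this
  have h5 : l.pt (i + k) = b.root := adj_dist_unique h4 b.root_adj.symm (c := a.1)
    (by rw [treeDist_comm, h2, treeDist_comm, h3]; omega) (by omega)
  have h6 := l.nxt_posRay (i + k)
  rw [h5, show i + (k : ℤ) + 1 = i + (k + 1 : ℕ) by push_cast; ring, hj] at h6
  exact h6

/-- A line meeting two distinct vertices adjacent to the subtree runs into both regions behind them,
and a line with ends in both regions crosses both edges. Intersections of members of a cover can
therefore be read off from line ends. -/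
theorem whAdj_iff (hX : IsSubtree X) {a b : WhVertex X} (hab : a ≠ b) :
    WhAdj W a b ↔ ∃ ξ ∈ a.behind, ∃ η ∈ b.behind, Partner W ξ η := by
  constructor
  · rintro ⟨-, l, hl, ⟨i, hi⟩, j, hj⟩
    have key : ∀ {a b : WhVertex X}, a ≠ b → ∀ {i j : ℤ}, i < j → l.pt i = a.1 → l.pt j = b.1 →
        l.posRay.limit ∈ b.behind ∧ l.negRay.limit ∈ a.behind := by
      intro a b hab i j hij hi hj
      refine ⟨WhVertex.posRay_mem_behind hX hab hij hi hj, ?_⟩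
      exact WhVertex.posRay_mem_behind hX hab.symm (l := l.rev) (i := -j) (j := -i) (by omega)
        (by simpa [Geodesic.rev] using hj) (by simpa [Geodesic.rev] using hi)
    have hp : Partner W l.posRay.limit l.negRay.limit := Or.inl ⟨l, hl, rfl, rfl⟩
    rcases lt_trichotomy i j with h | h | h
    · obtain ⟨h1, h2⟩ := key hab h hi hj
      exact ⟨_, h2, _, h1, hp.symm⟩
    · subst h; exact absurd (Subtype.ext (hi.symm.trans hj)) hab
    · obtain ⟨h1, h2⟩ := key hab.symm h hj hi
      exact ⟨_, h1, _, h2, hp⟩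
  · rintro ⟨ξ, hξ, η, hη, hp⟩
    refine ⟨hab, ?_⟩
    obtain ⟨l, hl, rfl, rfl⟩ := partner_iff.1 hp
    obtain ⟨i, -, hi⟩ := l.exists_crossing a.root_adj hξ
      (fun h => hab (WhVertex.ext_behind hX h hη))
    obtain ⟨j, -, hj⟩ := l.rev.exists_crossing b.root_adj hη
      (fun h => hab (WhVertex.ext_behind hX (by rwa [Geodesic.rev_negRay] at h) hξ).symm)
    rcases hl.mem_or with h | h
    · exact ⟨l, h, ⟨_, hi⟩, -(j + 1), hj⟩
    · exact ⟨l.rev, h, ⟨-(i + 1), by simp only [Geodesic.rev, neg_neg]; exact hi⟩, _, hj⟩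

theorem whVertex_finite (hfin : X.Finite) : Finite (WhVertex X) := by
  have : {a : F n | a ∉ X ∧ ∃ x ∈ X, (tree n).Adj x a}.Finite := by
    refine (hfin.image2 (fun x (s : Fin n × Bool) => x * letter s) Set.finite_univ).subset ?_
    rintro a ⟨-, x, hx, h⟩
    obtain ⟨s, rfl⟩ := adj_iff_letter.1 h
    exact ⟨x, hx, s, Set.mem_univ _, rfl⟩
  exact this

end Subtrees

/-! ## Covers associated to a subtree, and supports in terms of functions -/

section Supports

variable {n : ℕ} {W : Set (F n)} {X : Set (F n)}

/-- A neighbourhood of a line end which is, up to this line end, a union of classes. -/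
theorem exists_almost_saturated_nhd {Λ : ℕ} (hW : ∀ w ∈ W, w.norm ≤ Λ) {O : Set (Boundary n)}
    (hO : IsOpen O) {η : Boundary n} (hη : η ∈ O) :
    ∃ V : Set (Boundary n), IsOpen V ∧ η ∈ V ∧ V ⊆ O ∧
      ∀ ξ ∈ V, ξ ≠ η → ∀ ζ, Partner W ξ ζ → ζ ∈ V := by
  obtain ⟨K, hK⟩ := exists_edgeShadow_subset hO 1 hη
  have hsub := hK K le_rfl
  set p := (rayTo 1 η).pt K
  set q := (rayTo 1 η).pt (K + 1)
  have hpq : (tree n).Adj p q := (rayTo 1 η).adj K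
  have hmem : η ∈ edgeShadow p q := nxt_rayTo 1 η K
  -- Only finitely many lines leave through this edge. Removing their ends other than `η` keeps the
  -- set open, and all remaining points except possibly `η` have their partners in it.
  refine ⟨edgeShadow p q \ (ends W p q \ {η}), ?_, ⟨hmem, fun h => h.2 rfl⟩,
    sdiff_subset.trans hsub, ?_⟩
  · exact (isOpen_edgeShadow hpq).sdiff ((ends_finite hW hpq).subset sdiff_subset).isClosed
  · rintro ξ ⟨hξ, hξ'⟩ hne ζ hpζ
    have h1 : ζ ∈ edgeShadow p q := by
      by_contra h
      exact hξ' ⟨⟨hξ, ζ, h, hpζ⟩, hne⟩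
    refine ⟨h1, ?_⟩
    rintro ⟨⟨-, ζ', h2, h3⟩, -⟩
    exact h2 (hpζ.symm.unique h3 ▸ hξ)

theorem mem_iff_of_proj_eq {O : Set (Boundary n)} (hs : ∀ ξ ∈ O, ∀ ζ, Partner W ξ ζ → ζ ∈ O)
    (ξ ζ : Boundary n) (h : endRel W ξ ζ) : (ξ ∈ O) = (ζ ∈ O) :=
  propext ⟨fun h' => hs _ h' _ (Or.inl h), fun h' => hs _ h' _ (Or.inr h)⟩

/-- The open set of the decomposition space with a given saturated open preimage. -/
def saturatedOpens (O : Set (Boundary n)) (hO : IsOpen O)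
    (hs : ∀ ξ ∈ O, ∀ ζ, Partner W ξ ζ → ζ ∈ O) : Opens (Decomp W) :=
  ⟨{d | Quot.lift (fun ξ => ξ ∈ O) (mem_iff_of_proj_eq hs) d}, isOpen_coinduced.2 hO⟩

/-- Saturated open sets that contain the sets behind the vertices of the Whitehead graph, and that
intersect as prescribed by it. -/
theorem exists_saturated_cover {Λ : ℕ} (hW : ∀ w ∈ W, w.norm ≤ Λ) (hX : IsSubtree X)
    (hfin : X.Finite) (hne : X.Nonempty) :
    ∃ O : WhVertex X → Set (Boundary n), (∀ a, IsOpen (O a)) ∧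
      (∀ a, ∀ ξ ∈ O a, ∀ ζ, Partner W ξ ζ → ζ ∈ O a) ∧ (∀ a, a.behind ⊆ O a) ∧
      (∀ a b, a ≠ b → ∀ ξ ∈ O a, ξ ∈ O b → WhAdj W a b) ∧
      (∀ a b c, a ≠ b → b ≠ c → a ≠ c → ∀ ξ ∈ O a, ξ ∈ O b → ξ ∉ O c) ∧
      (∀ a, ∀ ξ ∈ O a, ∀ b : WhVertex X, ξ ∈ b.behind → a ≠ b →
        ∃ α ∈ a.behind, ∃ β ∈ b.behind, Partner W α β) := by
  have := whVertex_finite hfin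
  -- `C` consists of the finitely many ends of lines joining two regions. Their neighbourhoods are
  -- chosen disjoint, each within one region and saturated up to its centre.
  let C : Set (Boundary n) := ⋃ a : WhVertex X, ends W a.root a.1
  have hC : C.Finite := Set.finite_iUnion fun a => ends_finite hW a.root_adj
  obtain ⟨U, hU, hdisj⟩ := hC.t2_separation
  have hV : ∀ η ∈ C, ∃ V : Set (Boundary n), IsOpen V ∧ η ∈ V ∧ V ⊆ U η ∧
      (∀ a : WhVertex X, η ∈ a.behind → V ⊆ a.behind) ∧
      ∀ ξ ∈ V, ξ ≠ η → ∀ ζ, Partner W ξ ζ → ζ ∈ V := by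
    intro η hη
    obtain ⟨a, h1, -⟩ := Set.mem_iUnion.1 hη
    obtain ⟨V, h4, h5, h6, h7⟩ := exists_almost_saturated_nhd hW
      ((hU η).2.inter (isOpen_edgeShadow a.root_adj)) ⟨(hU η).1, h1⟩
    refine ⟨V, h4, h5, h6.trans inter_subset_left, fun b hb => ?_, h7⟩
    rw [WhVertex.ext_behind hX hb h1]
    exact h6.trans inter_subset_right
  choose! V hVo hVm hVU hVb hVs using hV
  -- `D a` contains the far ends of the lines leaving the region behind `a`; adding their
  -- neighbourhoods to this region makes it saturated. A point lies in one region and in at most one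
  -- neighbourhood, and the latter belongs to a single `a` because partners are unique. Hence there
  -- are no triple intersections.
  let D : WhVertex X → Set (Boundary n) :=
    fun a => {η | η ∈ C ∧ η ∉ a.behind ∧ ∃ ζ ∈ a.behind, Partner W η ζ}
  have hDunique : ∀ {a b : WhVertex X} {η η' ξ : Boundary n}, η ∈ D a → η' ∈ D b → ξ ∈ V η →
      ξ ∈ V η' → a = b := by
    rintro a b η η' ξ ⟨h1, -, ζ, h3, h4⟩ ⟨h1', -, ζ', h3', h4'⟩ hξ hξ'
    have he : η = η' := by
      by_contra h
      exact Set.disjoint_left.1 (hdisj h1 h1' h) (hVU η h1 hξ) (hVU η' h1' hξ')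
    subst he
    obtain rfl := h4.unique h4'
    exact WhVertex.ext_behind hX h3 h3'
  have hpair : ∀ {a b : WhVertex X} {η ξ : Boundary n}, η ∈ D a → ξ ∈ V η → ξ ∈ b.behind →
      ∃ α ∈ a.behind, ∃ β ∈ b.behind, Partner W α β := by
    rintro a b η ξ ⟨h1, -, ζ, h3, h4⟩ hξ hξb
    obtain ⟨c, hc⟩ := exists_behind hX hfin hne η
    obtain rfl := WhVertex.ext_behind hX (hVb η h1 c hc hξ) hξb
    exact ⟨ζ, h3, η, hc, h4.symm⟩
  let O : WhVertex X → Set (Boundary n) := fun a => a.behind ∪ ⋃ η ∈ D a, V η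
  have hO : ∀ {a : WhVertex X} {ξ : Boundary n}, ξ ∈ O a → ξ ∈ a.behind ∨ ∃ η ∈ D a, ξ ∈ V η := by
    intro a ξ h
    simpa [O] using h
  have hO' : ∀ {a : WhVertex X} {η ξ : Boundary n}, η ∈ D a → ξ ∈ V η → ξ ∈ O a := by
    intro a η ξ h h'
    exact Or.inr (Set.mem_biUnion h h')
  refine ⟨O, fun a => ?_, fun a ξ hξ ζ hp => ?_, fun a => subset_union_left,
    fun a b hab ξ ha hb => ?_, fun a b c hab hbc hac ξ ha hb hc => ?_, fun a ξ ha b hb hab => ?_⟩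
  · exact (isOpen_edgeShadow a.root_adj).union (isOpen_biUnion fun η h => hVo η h.1)
  · rcases hO hξ with h | ⟨η, h, h'⟩
    · by_cases hζ : ζ ∈ a.behind
      · exact Or.inl hζ
      · obtain ⟨b, hb⟩ := exists_behind hX hfin hne ζ
        have hζC : ζ ∈ C := Set.mem_iUnion.2 ⟨b, hb, ξ,
          fun h' => hζ ((WhVertex.ext_behind hX h h') ▸ hb), hp.symm⟩
        exact hO' ⟨hζC, hζ, ξ, h, hp.symm⟩ (hVm ζ hζC)
    · by_cases he : ξ = η
      · subst he
        obtain ⟨-, -, ζ', h1, h2⟩ := h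
        rw [hp.unique h2]
        exact Or.inl h1
      · exact hO' h (hVs η h.1 ξ h' he ζ hp)
  · rw [whAdj_iff hX hab]
    rcases hO ha with h | ⟨η, h, h'⟩
    · rcases hO hb with k | ⟨θ, k, k'⟩
      · exact absurd (WhVertex.ext_behind hX h k) hab
      · obtain ⟨α, h1, β, h2, h3⟩ := hpair k k' h
        exact ⟨β, h2, α, h1, h3.symm⟩
    · rcases hO hb with k | ⟨θ, k, k'⟩
      · exact hpair h h' k
      · exact absurd (hDunique h k h' k') hab
  · rcases hO ha with h | ⟨η, h, h'⟩ <;> rcases hO hb with k | ⟨θ, k, k'⟩ <;>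
      rcases hO hc with l | ⟨ι, l, l'⟩
    · exact hab (WhVertex.ext_behind hX h k)
    · exact hab (WhVertex.ext_behind hX h k)
    · exact hac (WhVertex.ext_behind hX h l)
    · exact hbc (hDunique k l k' l')
    · exact hbc (WhVertex.ext_behind hX k l)
    · exact hac (hDunique h l h' l')
    · exact hab (hDunique h k h' k')
    · exact hab (hDunique h k h' k')
  · rcases hO ha with h | ⟨η, h, h'⟩
    · exact absurd (WhVertex.ext_behind hX h hb) hab
    · exact hpair h h' hb

/-- The function is constant behind each vertex adjacent to `X`. -/
def ConstOff (f : Boundary n → ℤ) (X : Set (F n)) : Prop :=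
  ∀ x ∈ X, ∀ a ∉ X, (tree n).Adj x a → ∀ ξ ∈ edgeShadow x a, ∀ η ∈ edgeShadow x a, f ξ = f η

/-- `f` is constant on each enlarged region: a point added to the region of `a` lies behind some `b`
joined to `a` by a line, and this line equates the values on the two regions. So `f` descends to an
element of `H0` of the cover. -/
theorem exists_supportedOn {Λ : ℕ} (hW : ∀ w ∈ W, w.norm ≤ Λ) (hX : IsSubtree X)
    (hfin : X.Finite) (hne : X.Nonempty) {f : Boundary n → ℤ} (hf : LineInvariant W f)
    (hc : ConstOff f X) : ∃ c : Cech (Decomp W), SupportedOn c X ∧ val c = f := by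
  obtain ⟨O, hO, hs, hsub, hadj, htriple, hbe⟩ := exists_saturated_cover hW hX hfin hne
  let U : WhVertex X → Opens (Decomp W) := fun a => saturatedOpens (O a) (hO a) (hs a)
  let 𝒰 : OpenCover (Decomp W) := ⟨range U, fun d => by
    induction d using Quot.inductionOn with
    | h ξ =>
      obtain ⟨a, ha⟩ := exists_behind hX hfin hne ξ
      exact ⟨U a, ⟨a, rfl⟩, hsub a ha⟩⟩
  have hconst : ∀ a : WhVertex X, ∀ ξ ∈ a.behind, ∀ η ∈ a.behind, f ξ = f η := fun a =>
    hc _ a.root_mem _ a.2.1 a.root_adj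
  have hval : ∀ a, ∀ ξ ∈ O a, ∀ η ∈ a.behind, f ξ = f η := by
    intro a ξ hξ η hη
    obtain ⟨b, hb⟩ := exists_behind hX hfin hne ξ
    by_cases hab : a = b
    · subst hab; exact hconst a ξ hb η hη
    · obtain ⟨α, hα, β, hβ, hp⟩ := hbe a ξ hξ b hb hab
      rw [hconst b ξ hb β hβ, ← hf α β hp, hconst a α hα η hη]
  have hOne : ∀ a, ∀ ξ ∈ O a, ∃ η, η ∈ a.behind := by
    intro a ξ hξ
    obtain ⟨b, hb⟩ := exists_behind hX hfin hne ξ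
    by_cases hab : a = b
    · subst hab; exact ⟨ξ, hb⟩
    · obtain ⟨α, hα, -⟩ := hbe a ξ hξ b hb hab
      exact ⟨α, hα⟩
  let φ : Decomp W → ℤ := Quot.lift f fun ξ η h => hf ξ η (Or.inl h)
  obtain ⟨f', hf'⟩ := exists_eval_toCech 𝒰 φ (by
    rintro _ ⟨a, rfl⟩ d hd e he
    induction d using Quot.inductionOn with
    | h ξ =>
      induction e using Quot.inductionOn with
      | h ζ =>
        obtain ⟨η, hη⟩ := hOne a ξ hd
        exact (hval a ξ hd η hη).trans (hval a ζ he η hη).symm)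
  refine ⟨toCech 𝒰 f', ⟨hfin, hX, 𝒰, Or.inr ⟨hne, U, rfl, ?_, ?_, ?_⟩, f', rfl⟩, ?_⟩
  · intro a
    rw [WhShadow_eq hX]
    rintro _ ⟨ξ, hξ, rfl⟩
    exact hsub a hξ
  · intro a b hab
    constructor
    · rintro ⟨d, h1, h2⟩
      induction d using Quot.inductionOn with
      | h ξ => exact hadj a b hab ξ h1 h2
    · intro h
      obtain ⟨ξ, hξ, η, hη, hp⟩ := (whAdj_iff hX hab).1 h
      exact ⟨proj W ξ, hsub a hξ, hs b η (hsub b hη) ξ hp.symm⟩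
  · intro a b c hab hbc hac
    rw [Set.eq_empty_iff_forall_notMem]
    rintro d ⟨⟨h1, h2⟩, h3⟩
    induction d using Quot.inductionOn with
    | h ξ => exact htriple a b c hab hbc hac ξ h1 h2 h3
  · funext ξ
    rw [val_apply, hf']; rfl

theorem isSubtree_empty : IsSubtree (∅ : Set (F n)) :=
  isSubtree_of_step_mem fun _ h => h.elim

theorem isSubtree_singleton (x : F n) : IsSubtree {x} :=
  isSubtree_of_step_mem fun a ha b hb => by
    rw [mem_singleton_iff.1 ha, mem_singleton_iff.1 hb, step_self]; rfl

theorem supportedOn_empty {c : Cech (Decomp W)} (h : ∀ ξ η, val c ξ = val c η) :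
    SupportedOn c ∅ := by
  let 𝒰 : OpenCover (Decomp W) := ⟨{⊤}, fun _ => ⟨⊤, rfl, trivial⟩⟩
  obtain ⟨f, hf⟩ := exists_eval_toCech 𝒰 (eval c) (by
    rintro U - d - e -
    induction d using Quot.inductionOn with
    | h ξ =>
      induction e using Quot.inductionOn with
      | h ζ => exact h ξ ζ)
  exact ⟨finite_empty, isSubtree_empty, 𝒰, Or.inl ⟨rfl, rfl⟩, f, eval_injective hf⟩

theorem supportedOn_of_constOff {Λ : ℕ} (hW : ∀ w ∈ W, w.norm ≤ Λ) (hX : IsSubtree X)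
    (hfin : X.Finite) (hne : X.Nonempty) {c : Cech (Decomp W)} (hc : ConstOff (val c) X) :
    SupportedOn c X := by
  obtain ⟨c', h1, h2⟩ := exists_supportedOn hW hX hfin hne (val_invariant c) hc
  rwa [← val_injective h2]

theorem SupportedOn.constOff {c : Cech (Decomp W)} (h : SupportedOn c X) :
    ConstOff (val c) X := by
  obtain ⟨hfin, hX, 𝒰, hU, f, rfl⟩ := h
  rcases hU with ⟨rfl, -⟩ | ⟨-, U, hU, hsh, -⟩
  · intro x hx; exact hx.elim
  · intro x hx a ha hxa ξ hξ η hη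
    let v : WhVertex X := ⟨a, ha, x, hx, hxa⟩
    have hr : x = v.root := v.root_eq hX hx hxa
    have hmem : ∀ ζ ∈ edgeShadow x a, proj W ζ ∈ U v := by
      intro ζ hζ
      refine hsh v ⟨ζ, ?_, rfl⟩
      rw [WhShadow_eq hX, WhVertex.behind, ← hr]
      exact hζ
    exact eval_eq_of_mem f (hU ▸ ⟨v, rfl⟩) (hmem ξ hξ) (hmem η hη)

theorem ballConst_iff_constOff {f : Boundary n → ℤ} {c : F n} {R : ℕ} :
    BallConst f c R ↔ ConstOff f (ballAt c R) := by
  constructor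
  · intro h x hx a ha hxa
    have hx : treeDist c x ≤ R := hx
    have ha : ¬ treeDist c a ≤ R := ha
    have h1 := adj_dist hxa c
    rw [treeDist_comm x, treeDist_comm a] at h1
    exact h.const (u := x) (v := a) (by omega) (by omega)
  · intro h ξ η he
    refine h ((rayTo c ξ).pt R) (rayTo_dist c ξ R).le ((rayTo c ξ).pt (R + 1)) ?_
      ((rayTo c ξ).adj R) ξ (nxt_rayTo c ξ R) η ?_
    · change ¬ treeDist _ _ ≤ R
      rw [rayTo_dist]; omega
    · rw [mem_edgeShadow, rayTo_pt_eq_of_le he R (by omega), nxt_rayTo, he]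

/-- The functions given by the classes supported on the ball of radius `R`. -/
theorem SupportedOn.ballConst {c : Cech (Decomp W)} {R : ℕ} (h : SupportedOn c (ball n R)) :
    BallConst (val c) 1 R := by
  rw [ballConst_iff_constOff, ballAt_one]; exact h.constOff

theorem exists_supportedOn_ball {Λ : ℕ} (hW : ∀ w ∈ W, w.norm ≤ Λ) {f : Boundary n → ℤ}
    (hf : LineInvariant W f) {R : ℕ} (h : BallConst f 1 R) :
    ∃ c : Cech (Decomp W), SupportedOn c (ball n R) ∧ val c = f := by
  rw [ballConst_iff_constOff, ballAt_one] at h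
  refine exists_supportedOn hW ?_ (ball_finite n R) ⟨1, by simp [ball]⟩ hf h
  rw [← ballAt_one]; exact isSubtree_ballAt 1 R

theorem LineInvariant.smul {f : Boundary n → ℤ} (hf : LineInvariant W f) (g : F n) :
    LineInvariant W (fun ξ => f (g • ξ)) := fun _ _ h => hf _ _ (h.smul g)

theorem BallConst.smul {f : Boundary n → ℤ} {c : F n} {R : ℕ} (h : BallConst f c R) (g : F n) :
    BallConst (fun ξ => f (g • ξ)) (g⁻¹ * c) R := by
  intro ξ η he
  refine h _ _ ?_
  have h1 : ∀ ζ : Boundary n, (rayTo c (g • ζ)).pt (R + 1) = g * (rayTo (g⁻¹ * c) ζ).pt (R + 1) := by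
    intro ζ
    have := rayTo_smul g (g⁻¹ * c) ζ
    rw [mul_inv_cancel_left] at this
    rw [this]; rfl
  rw [h1, h1, he]

end Supports

/-! ## Generators and relations -/

section Presentation

variable {n : ℕ} {W : Set (F n)} {k : ℕ}

/-- The elements `∑ n_{ij} e_j g_{ij}` for which `g_{ij}` is always in the set `A j`. -/
def coeffIn (A : Fin k → Set (F n)) : AddSubgroup (FreeMod n k) where
  carrier := {x | ∀ j g, (x j).coeff g ≠ 0 → g ∈ A j}
  zero_mem' := fun j g h => absurd rfl h
  add_mem' := by
    intro x y hx hy j g h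
    by_cases h1 : (x j).coeff g = 0
    · refine hy j g fun h2 => h ?_
      rw [Pi.add_apply, MonoidAlgebra.coeff_add, Finsupp.add_apply, h1, h2, add_zero]
    · exact hx j g h1
  neg_mem' := by
    intro x hx j g h
    refine hx j g fun h2 => h ?_
    rw [Pi.neg_apply, MonoidAlgebra.coeff_neg, Finsupp.neg_apply, h2, neg_zero]

/-- The elements `∑ n_{ij} e_j g_{ij}` all of whose `g_{ij}⁻¹` are in the ball of radius `t`
about `c`. -/
def near (k : ℕ) (c : F n) (t : ℕ) : AddSubgroup (FreeMod n k) :=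
  coeffIn fun _ => {g | treeDist c g⁻¹ ≤ t}

theorem near_mono {c v : F n} {t s : ℕ} (h : treeDist c v + t ≤ s) : near k v t ≤ near k c s :=
  fun x hx j g hg => (treeDist_triangle c v g⁻¹).trans (by
    have h1 : treeDist v g⁻¹ ≤ t := hx j g hg
    omega)

/-- The basis element `e_j g` of the free module. -/
def basisElt (j : Fin k) (g : F n) : FreeMod n k := Pi.single j (MonoidAlgebra.single g 1)

theorem presMap_basisElt (σ : Fin k → Cech (Decomp W)) (j : Fin k) (g : F n) :
    presMap σ (basisElt j g) = op g • σ j := by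
  rw [basisElt, presMap_single, one_smul]

theorem basisElt_coeff_ne_zero {i j : Fin k} {g h : F n}
    (hne : ((basisElt j g : FreeMod n k) i).coeff h ≠ 0) : i = j ∧ h = g := by
  classical
  rw [basisElt] at hne
  by_cases hij : i = j
  · subst hij
    refine ⟨rfl, ?_⟩
    by_contra hgh
    rw [Pi.single_eq_same, MonoidAlgebra.coeff_single, Finsupp.single_apply,
      if_neg (Ne.symm hgh)] at hne
    exact hne rfl
  · rw [Pi.single_eq_of_ne hij] at hne
    exact absurd rfl hne

theorem basisElt_mem_coeffIn (j : Fin k) (g : F n) {A : Fin k → Set (F n)} (h : g ∈ A j) :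
    basisElt j g ∈ coeffIn A := by
  intro i h' hne
  obtain ⟨rfl, rfl⟩ := basisElt_coeff_ne_zero hne
  exact h

theorem basisElt_mem_near (j : Fin k) (g : F n) {c : F n} {t : ℕ} (h : treeDist c g⁻¹ ≤ t) :
    basisElt j g ∈ near k c t := basisElt_mem_coeffIn j g h

theorem eq_top_of_basisElt_mem {Q : AddSubgroup (FreeMod n k)} (h : ∀ j g, basisElt j g ∈ Q)
    (x : FreeMod n k) : x ∈ Q := by
  rw [← Finset.univ_sum_single x]
  refine Q.sum_mem fun j _ => ?_
  induction x j using MonoidAlgebra.induction_linear with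
  | zero => rw [Pi.single_zero]; exact Q.zero_mem
  | add y z hy hz => rw [Pi.single_add]; exact Q.add_mem hy hz
  | single g m =>
    have : (Pi.single j (MonoidAlgebra.single g m) : FreeMod n k) = m • basisElt j g := by
      rw [basisElt, ← Pi.single_smul, MonoidAlgebra.smul_single, smul_eq_mul, mul_one]
    rw [this]
    exact Q.zsmul_mem (h j g) m

theorem mul_single_mem_near {x : FreeMod n k} {t : ℕ} (hx : x ∈ near k 1 t) (v : F n) :
    (fun j => x j * MonoidAlgebra.single v⁻¹ 1) ∈ near k v t := by
  intro j g hg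
  have h1 : (x j).coeff (g * v) ≠ 0 := by
    intro h0
    apply hg
    have := MonoidAlgebra.coeff_mul_single_eq_coeff_mul (x := x j) (r := (1 : ℤ)) (m := v⁻¹)
      (m₁ := g) (g * v) fun m' _ => mul_inv_eq_iff_eq_mul
    rw [this, h0, zero_mul]
  have h2 := hx j _ h1
  change treeDist 1 (g * v)⁻¹ ≤ t at h2
  rwa [← treeDist_smul v, mul_one, mul_inv_rev, mul_inv_cancel_left] at h2

/-- Classes on a ball that are combinations of translates of the generators lift to elements of
the free module near the centre of the ball. -/
theorem exists_lift {Λ : ℕ} (hW : ∀ w ∈ W, w.norm ≤ Λ) {R r : ℕ} {σ : Fin k → Cech (Decomp W)}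
    (hgen : ∀ c, SupportedOn c (ball n r) →
      c ∈ AddSubgroup.closure {d | ∃ j, ∃ g ∈ ball n R, d = op g • σ j})
    (v : F n) {f : Boundary n → ℤ} (hf : LineInvariant W f) (hv : BallConst f v r) :
    ∃ x ∈ near k v R, val (presMap σ x) = f := by
  -- The function is moved to the identity, where the generation hypothesis applies, and the lift
  -- found there is moved back by right multiplication.
  have h1 := hv.smul v
  rw [inv_mul_cancel] at h1
  obtain ⟨c, hc, hcf⟩ := exists_supportedOn_ball hW (hf.smul v) h1
  have hle : AddSubgroup.closure {d | ∃ j, ∃ g ∈ ball n R, d = op g • σ j} ≤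
      (near k (1 : F n) R).map (presMap σ) := by
    rw [AddSubgroup.closure_le]
    rintro _ ⟨j, g, hg, rfl⟩
    refine ⟨basisElt j g, basisElt_mem_near j g ?_, presMap_basisElt σ j g⟩
    rw [treeDist_one, FreeGroup.norm_inv_eq]; exact hg
  obtain ⟨x, hx, hxc⟩ := hle (hgen c hc)
  refine ⟨_, mul_single_mem_near hx v, ?_⟩
  rw [presMap_mul, hxc]
  funext ξ
  rw [val_smul, hcf]
  simp

/-! ### Lifting the parts, modulo local relations -/

variable (W) in
open Classical in
/-- A lift of a function to the free module. -/
def lift (σ : Fin k → Cech (Decomp W)) (R : ℕ) (v : F n) (f : Boundary n → ℤ) : FreeMod n k :=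
  if h : ∃ x ∈ near k v R, val (presMap σ x) = f then h.choose else 0

theorem lift_mem_near (σ : Fin k → Cech (Decomp W)) (R : ℕ) (v : F n) (f : Boundary n → ℤ) :
    lift W σ R v f ∈ near k v R := by
  rw [lift]
  split_ifs with h
  · exact h.choose_spec.1
  · exact zero_mem _

/-- The hypotheses under which the presentation is studied: the generators are supported on a ball
of radius `R`, and functions that are constant off a ball of radius `r` have lifts. -/
structure Presented (W : Set (F n)) (σ : Fin k → Cech (Decomp W)) (R r : ℕ) : Prop where
  stable : Stable W r
  supp : ∀ j, SupportedOn (σ j) (ball n R)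
  exists_lift : ∀ v f, LineInvariant W f → BallConst f v r →
    ∃ x ∈ near k v R, val (presMap σ x) = f

variable {σ : Fin k → Cech (Decomp W)} {R r : ℕ}

theorem Presented.val_lift (H : Presented W σ R r) {v : F n} {f : Boundary n → ℤ}
    (hf : LineInvariant W f) (hv : BallConst f v r) :
    val (presMap σ (lift W σ R v f)) = f := by
  rw [lift, dif_pos (H.exists_lift v f hf hv)]
  exact (H.exists_lift v f hf hv).choose_spec.2

theorem Presented.val_lift_vertexPart (H : Presented W σ R r) (c : Cech (Decomp W)) (v : F n) :
    val (presMap σ (lift W σ R v (vertexPart W r (val c) v))) = vertexPart W r (val c) v :=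
  H.val_lift (vertexPart_invariant H.stable (val_invariant c) (val_isLocallyConstant c) v)
    (vertexPart_ballConst r _ v)

theorem Presented.val_lift_edgePart (H : Presented W σ R r) (c : Cech (Decomp W))
    {e : Sym2 (F n)} (he : e ∈ (tree n).edgeSet) :
    val (presMap σ (lift W σ R (Quot.out e).1 (edgePart' W r (val c) e))) =
      edgePart' W r (val c) e := by
  have h1 : (tree n).Adj (Quot.out e).1 (Quot.out e).2 := by
    have h : s((Quot.out e).1, (Quot.out e).2) = e := Quot.out_eq e
    rwa [← SimpleGraph.mem_edgeSet, h]
  exact H.val_lift (edgePart_invariant H.stable (val_invariant c) (val_isLocallyConstant c) h1)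
    (edgePart_ballConst r _ h1)

theorem mem_edgeSet_of_edgesIn {Y : Finset (F n)} {e : Sym2 (F n)} (h : e ∈ edgesIn Y) :
    e ∈ (tree n).edgeSet := by
  classical exact (Finset.mem_filter.1 h).2

variable (W) in
/-- The lift of a class assembled from lifts of its parts. -/
def assemble (σ : Fin k → Cech (Decomp W)) (R r : ℕ) (Y : Finset (F n)) (c : Cech (Decomp W)) :
    FreeMod n k :=
  ∑ v ∈ Y, lift W σ R v (vertexPart W r (val c) v) -
    ∑ e ∈ edgesIn Y, lift W σ R (Quot.out e).1 (edgePart' W r (val c) e)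

theorem Presented.presMap_assemble (H : Presented W σ R r) {Y : Finset (F n)} {v : F n} {t : ℕ}
    (hY : ∀ u, u ∈ Y ↔ treeDist v u ≤ t) {c : Cech (Decomp W)} (hc : BallConst (val c) v t) :
    presMap σ (assemble W σ R r Y c) = c := by
  apply val_injective
  rw [assemble, map_sub, map_sum, map_sum, map_sub, map_sum, map_sum]
  conv_rhs => rw [eq_sum_parts (W := W) r hc hY]
  congr 1
  · exact Finset.sum_congr rfl fun u _ => H.val_lift_vertexPart c u
  · exact Finset.sum_congr rfl fun e he => H.val_lift_edgePart c (mem_edgeSet_of_edgesIn he)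

theorem exists_finset_ballAt (v : F n) (t : ℕ) :
    ∃ Y : Finset (F n), ∀ u, u ∈ Y ↔ treeDist v u ≤ t :=
  ⟨(ballAt_finite v t).toFinset, fun u => by rw [Set.Finite.mem_toFinset]; rfl⟩

theorem Presented.surjective (H : Presented W σ R r) : Function.Surjective (presMap σ) := by
  intro c
  obtain ⟨t, ht⟩ := exists_ballConst (val_isLocallyConstant c) 1
  obtain ⟨Y, hY⟩ := exists_finset_ballAt (1 : F n) t
  exact ⟨_, H.presMap_assemble hY ht⟩

/-- The parts of a class, lifted to the free module modulo relations. -/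
def Presented.assembleHom (H : Presented W σ R r) (K : AddSubgroup (FreeMod n k))
    (hK : ∀ c, ∀ x ∈ near k c (2 * R + 1), presMap σ x = 0 → x ∈ K) (Y : Finset (F n)) :
    Cech (Decomp W) →+ FreeMod n k ⧸ K :=
  AddMonoidHom.mk' (fun c => QuotientAddGroup.mk' K (assemble W σ R r Y c)) (by
    -- Lifts are arbitrary choices and need not be additive, but the defect is a relation near `v`,
    -- hence in `K`.
    have key : ∀ (v : F n) (f g : Boundary n → ℤ),
        val (presMap σ (lift W σ R v f)) = f → val (presMap σ (lift W σ R v g)) = g →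
        val (presMap σ (lift W σ R v (f + g))) = f + g →
        QuotientAddGroup.mk' K (lift W σ R v (f + g)) =
          QuotientAddGroup.mk' K (lift W σ R v f) + QuotientAddGroup.mk' K (lift W σ R v g) := by
      intro v f g h1 h2 h3
      rw [← map_add, ← sub_eq_zero, ← map_sub]
      refine (QuotientAddGroup.eq_zero_iff _).2 (hK v _ ?_ ?_)
      · refine near_mono (v := v) (t := R) (by rw [treeDist_self]; omega) ?_
        exact sub_mem (lift_mem_near _ _ _ _)
          (add_mem (lift_mem_near _ _ _ _) (lift_mem_near _ _ _ _))
      · apply val_injective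
        rw [map_sub, map_add, map_sub, map_add, h1, h2, h3, sub_self, map_zero]
    intro c d
    simp only [assemble, map_sub, map_sum]
    have e1 : ∀ v, vertexPart W r (val (c + d)) v =
        vertexPart W r (val c) v + vertexPart W r (val d) v := by
      intro v; rw [map_add]; rfl
    have e2 : ∀ e, edgePart' W r (val (c + d)) e =
        edgePart' W r (val c) e + edgePart' W r (val d) e := by
      intro e
      rw [map_add]
      funext ξ
      simp only [edgePart', edgePart, Pi.add_apply]
      split_ifs <;> rfl
    rw [Finset.sum_congr rfl fun v _ => (by
        rw [e1]
        exact key v _ _ (H.val_lift_vertexPart c v) (H.val_lift_vertexPart d v)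
          (by rw [← e1]; exact H.val_lift_vertexPart (c + d) v) :
        QuotientAddGroup.mk' K (lift W σ R v (vertexPart W r (val (c + d)) v)) =
          QuotientAddGroup.mk' K (lift W σ R v (vertexPart W r (val c) v)) +
            QuotientAddGroup.mk' K (lift W σ R v (vertexPart W r (val d) v))),
      Finset.sum_congr rfl fun e he => (by
        have he := mem_edgeSet_of_edgesIn he
        rw [e2]
        exact key _ _ _ (H.val_lift_edgePart c he) (H.val_lift_edgePart d he)
          (by rw [← e2]; exact H.val_lift_edgePart (c + d) he) :
        QuotientAddGroup.mk' K (lift W σ R (Quot.out e).1 (edgePart' W r (val (c + d)) e)) =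
          QuotientAddGroup.mk' K (lift W σ R (Quot.out e).1 (edgePart' W r (val c) e)) +
            QuotientAddGroup.mk' K (lift W σ R (Quot.out e).1 (edgePart' W r (val d) e))),
      Finset.sum_add_distrib, Finset.sum_add_distrib]
    abel)

theorem Presented.assembleHom_apply (H : Presented W σ R r) {K : AddSubgroup (FreeMod n k)}
    (hK : ∀ c, ∀ x ∈ near k c (2 * R + 1), presMap σ x = 0 → x ∈ K) (Y : Finset (F n))
    (c : Cech (Decomp W)) :
    H.assembleHom K hK Y c = QuotientAddGroup.mk' K (assemble W σ R r Y c) := rfl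

open Classical in
/-- The assembled lift, with the edges matched with the vertices on their far side from `y`. -/
theorem assemble_eq {Y : Finset (F n)} (hY : IsSubtree (Y : Set (F n))) {y : F n} (hy : y ∈ Y)
    (c : Cech (Decomp W)) : assemble W σ R r Y c = lift W σ R y (vertexPart W r (val c) y) +
      ∑ v ∈ Y.erase y, (lift W σ R v (vertexPart W r (val c) v) -
        lift W σ R (Quot.out s(v, step v y)).1 (edgePart' W r (val c) s(v, step v y))) := by
  have ho : ∀ a b : F n, (tree n).Adj a b →
      (step a y = b ∧ step b y ≠ a) ∨ (step b y = a ∧ step a y ≠ b) := fun a b hab =>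
    (step_or_step hab y).imp (fun h => ⟨h.1, h.2.1⟩) (fun h => ⟨h.1, h.2.1⟩)
  have hfil : {v ∈ Y | (tree n).Adj v (step v y) ∧ step v y ∈ Y} = Y.erase y := by
    ext v
    simp only [Finset.mem_filter, Finset.mem_erase]
    constructor
    · rintro ⟨h1, h2, -⟩
      refine ⟨?_, h1⟩
      rintro rfl
      rw [step_self] at h2
      exact h2.ne rfl
    · rintro ⟨h1, h2⟩
      exact ⟨h2, step_adj h1, hY.step_mem (Finset.mem_coe.2 h2) (Finset.mem_coe.2 hy)⟩
  rw [assemble, sum_edgesIn (o := fun v => step v y) ho, hfil, ← Finset.add_sum_erase Y _ hy,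
    Finset.sum_sub_distrib, add_sub_assoc]

/-- The translate is constant off the ball of radius `R` about `g⁻¹`, so only the parts in this ball
contribute modulo `K`. Their assembled lift and `basisElt j g` have the same image and are both near
`g⁻¹`. -/
theorem Presented.assembleHom_generator (H : Presented W σ R r) {K : AddSubgroup (FreeMod n k)}
    (hK : ∀ c, ∀ x ∈ near k c (2 * R + 1), presMap σ x = 0 → x ∈ K) {Y : Finset (F n)}
    (hY : IsSubtree (Y : Set (F n))) (j : Fin k) (g : F n)
    (hg : ∀ v, treeDist g⁻¹ v ≤ R → v ∈ Y) :
    H.assembleHom K hK Y (op g • σ j) = QuotientAddGroup.mk' K (basisElt j g) := by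
  classical
  have hval : BallConst (val (op g • σ j)) g⁻¹ R := by
    have h1 := ((H.supp j).ballConst).smul g
    rw [mul_one] at h1
    have h2 : val (op g • σ j) = fun ξ => val (σ j) (g • ξ) := funext fun ξ => val_smul g _ ξ
    rwa [h2]
  obtain ⟨Y₀, hY₀⟩ := exists_finset_ballAt g⁻¹ R
  have hsub : Y₀ ⊆ Y := fun v hv => hg v ((hY₀ v).1 hv)
  have hY₀t : IsSubtree (Y₀ : Set (F n)) := by
    have : (Y₀ : Set (F n)) = ballAt g⁻¹ R := by ext v; exact hY₀ v
    rw [this]; exact isSubtree_ballAt _ _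
  have hmem : g⁻¹ ∈ Y₀ := by rw [hY₀]; simp
  have hedge : ∀ v, v ≠ g⁻¹ → (tree n).Adj (Quot.out s(v, step v g⁻¹)).1 v ∨
      (Quot.out s(v, step v g⁻¹)).1 = v := by
    intro v hv
    have h : s((Quot.out s(v, step v g⁻¹)).1, (Quot.out s(v, step v g⁻¹)).2) =
      s(v, step v g⁻¹) := Quot.out_eq _
    rcases Sym2.eq_iff.1 h with ⟨h1, -⟩ | ⟨h1, -⟩
    · exact Or.inr h1
    · rw [h1]; exact Or.inl (step_adj hv).symm
  have hdist : ∀ v, v ≠ g⁻¹ → treeDist v (Quot.out s(v, step v g⁻¹)).1 ≤ 1 := by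
    intro v hv
    rcases hedge v hv with h | h
    · exact (adj_iff_dist.1 h.symm).le
    · rw [h, treeDist_self]; omega
  -- Beyond the ball, each vertex is paired with its edge towards `g⁻¹`. The two parts coincide, so
  -- their lifts differ by a relation near that vertex.
  have h1 : H.assembleHom K hK Y (op g • σ j) = H.assembleHom K hK Y₀ (op g • σ j) := by
    rw [H.assembleHom_apply, H.assembleHom_apply, assemble_eq hY (hsub hmem),
      assemble_eq hY₀t hmem, map_add, map_add, map_sum, map_sum]
    congr 1
    symm
    refine Finset.sum_subset (Finset.erase_subset_erase _ hsub) fun v hv hv' => ?_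
    have hne : v ≠ g⁻¹ := (Finset.mem_erase.1 hv).1
    have hvY : R < treeDist g⁻¹ v := by
      by_contra h
      exact hv' (Finset.mem_erase.2 ⟨hne, (hY₀ v).2 (by omega)⟩)
    have hadj := step_adj hne
    have hd := step_dist hne
    rw [treeDist_comm, treeDist_comm (step v g⁻¹)] at hd
    have hparts : edgePart' W r (val (op g • σ j)) s(v, step v g⁻¹) =
        vertexPart W r (val (op g • σ j)) v := by
      rw [edgePart'_mk r _ hadj, vertexPart_eq_edgePart r hadj.symm (hval.const hd hvY)]
    refine (QuotientAddGroup.eq_zero_iff _).2 (hK v _ ?_ ?_)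
    · refine sub_mem (near_mono (by rw [treeDist_self]; omega) (lift_mem_near _ _ _ _))
        (near_mono ?_ (lift_mem_near _ _ _ _))
      have := hdist v hne
      omega
    · apply val_injective
      rw [map_sub, map_sub, H.val_lift_vertexPart,
        H.val_lift_edgePart _ ((SimpleGraph.mem_edgeSet _).2 hadj), hparts, sub_self, map_zero]
  rw [h1, H.assembleHom_apply, ← sub_eq_zero, ← map_sub]
  -- The radius `2 * R + 1` arises here: `R` to a vertex of the ball, one more to the chosen end of
  -- its edge, and `R` for the lift.
  refine (QuotientAddGroup.eq_zero_iff _).2 (hK g⁻¹ _ (sub_mem ?_ ?_) ?_)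
  · rw [assemble_eq hY₀t hmem]
    refine add_mem (near_mono (by rw [treeDist_self]; omega) (lift_mem_near _ _ _ _))
      (sum_mem fun v hv => ?_)
    have hne : v ≠ g⁻¹ := (Finset.mem_erase.1 hv).1
    have hv := (hY₀ v).1 (Finset.mem_erase.1 hv).2
    refine sub_mem (near_mono (by omega) (lift_mem_near _ _ _ _))
      (near_mono ?_ (lift_mem_near _ _ _ _))
    have := hdist v hne
    have := treeDist_triangle g⁻¹ v (Quot.out s(v, step v g⁻¹)).1
    omega
  · exact basisElt_mem_near j g (by rw [treeDist_self]; omega)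
  · rw [map_sub, H.presMap_assemble hY₀ hval, presMap_basisElt, sub_self]

/-- The relations are generated by those near single vertices. -/
theorem Presented.ker_le (H : Presented W σ R r) {K : AddSubgroup (FreeMod n k)}
    (hK : ∀ c, ∀ x ∈ near k c (2 * R + 1), presMap σ x = 0 → x ∈ K) :
    (presMap σ).ker ≤ K := by
  choose B hB using fun t => exists_finset_ballAt (1 : F n) t
  have hBt : ∀ t, IsSubtree (B t : Set (F n)) := fun t => by
    have : (B t : Set (F n)) = ballAt 1 t := by ext v; exact hB t v
    rw [this]; exact isSubtree_ballAt _ _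
  -- No finite ball serves all `x`, so the claim is that the assembled lift recovers `x` modulo `K`
  -- over every sufficiently large ball. Such `x` form a subgroup, so basis elements suffice.
  let Q : AddSubgroup (FreeMod n k) :=
    { carrier := {x | ∃ t₀, ∀ t ≥ t₀,
        H.assembleHom K hK (B t) (presMap σ x) = QuotientAddGroup.mk' K x}
      zero_mem' := ⟨0, fun t _ => by rw [map_zero, map_zero, map_zero]⟩
      add_mem' := by
        rintro x y ⟨t, ht⟩ ⟨s, hs⟩
        refine ⟨max t s, fun q hq => ?_⟩
        rw [map_add, map_add, map_add, ht q ((le_max_left _ _).trans hq),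
          hs q ((le_max_right _ _).trans hq)]
      neg_mem' := by
        rintro x ⟨t, ht⟩
        exact ⟨t, fun q hq => by rw [map_neg, map_neg, map_neg, ht q hq]⟩ }
  intro x hx
  obtain ⟨t, ht⟩ : x ∈ Q := by
    refine eq_top_of_basisElt_mem (Q := Q) (fun j g => ?_) x
    refine ⟨treeDist 1 g⁻¹ + R, fun t ht => ?_⟩
    rw [presMap_basisElt]
    refine H.assembleHom_generator hK (hBt t) j g fun v hv => (hB t v).2 ?_
    have := treeDist_triangle 1 g⁻¹ v
    omega
  have h := ht t le_rfl
  rw [AddMonoidHom.mem_ker.1 hx, map_zero] at h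
  exact (QuotientAddGroup.eq_zero_iff _).1 h.symm

end Presentation

/-! ## The position of the supports -/

section SupportPosition

variable {n : ℕ} {W : Set (F n)} {k : ℕ}

theorem letter_injective : Function.Injective (letter : Fin n × Bool → F n) := by
  intro s t h
  have := congrArg FreeGroup.toWord h
  simpa [letter, FreeGroup.toWord_mk] using this

theorem letter_mul_self_ne_one (s : Fin n × Bool) : letter s * letter s ≠ 1 := by
  intro h
  have h1 := eq_inv_of_mul_eq_one_left h
  obtain ⟨i, b⟩ := s
  rw [← letter_not] at h1
  have := congrArg Prod.snd (letter_injective h1)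
  simp at this

theorem edgeShadow_nonempty {x y : F n} (h : (tree n).Adj x y) : (edgeShadow x y).Nonempty := by
  obtain ⟨s, rfl⟩ := adj_iff_letter.1 h
  let ρ : Ray n :=
    { pt := fun k => x * letter s ^ k
      adj := fun k => adj_iff_letter.2 ⟨s, by rw [pow_succ, mul_assoc]⟩
      noBacktrack := fun k h => by
        have h1 := mul_left_cancel h
        rw [pow_add, mul_eq_left, pow_two] at h1
        exact letter_mul_self_ne_one s h1 }
  refine ⟨ρ.limit, ?_⟩
  have := nxt_ray ρ 0
  simpa [ρ, mem_edgeShadow] using this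

theorem exists_third_neighbour (hn : 2 ≤ n) (x a b : F n) :
    ∃ y, (tree n).Adj x y ∧ y ≠ a ∧ y ≠ b := by
  classical
  by_contra hcon
  push Not at hcon
  have h1 : Finset.univ.image (fun s : Fin n × Bool => x * letter s) ⊆ {a, b} := by
    intro y hy
    obtain ⟨s, -, rfl⟩ := Finset.mem_image.1 hy
    rw [Finset.mem_insert, Finset.mem_singleton]
    by_cases h : x * letter s = a
    · exact Or.inl h
    · exact Or.inr (hcon _ (adj_iff_letter.2 ⟨s, rfl⟩) h)
  have h2 := Finset.card_le_card h1
  rw [Finset.card_image_of_injective _ fun s t h => letter_injective (mul_left_cancel h)] at h2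
  have h3 := Finset.card_le_two (a := a) (b := b)
  simp at h2
  omega

/-- If the rank is not one, then the supports of a class supported on a ball are in the ball whose
radius is larger by one. -/
theorem IsSupport.subset_ball {Λ : ℕ} (hW : ∀ w ∈ W, w.norm ≤ Λ) (hn : n ≠ 1)
    {c : Cech (Decomp W)} {X : Set (F n)} (hX : IsSupport c X) {R : ℕ}
    (hc : SupportedOn c (ball n R)) : X ⊆ ball n (R + 1) := by
  by_contra hcon
  obtain ⟨x₁, hx₁, hx₁R⟩ := Set.not_subset.1 hcon
  -- A vertex of `X` farthest from the identity has at most one neighbour in `X`, namely the one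
  -- towards the identity.
  obtain ⟨x, hx, hmax⟩ := Set.exists_max_image X FreeGroup.norm hX.1.1 ⟨x₁, hx₁⟩
  have hxR : R + 2 ≤ x.norm := by
    have h1 : ¬ x₁.norm ≤ R + 1 := hx₁R
    have := hmax x₁ hx₁
    omega
  have hsub := hX.1.2.1
  have hoff := hX.1.constOff
  have hball := hc.ballConst
  have hx1 : x ≠ 1 := by rintro rfl; simp at hxR
  set x' := step x 1 with hx'
  have hadj : (tree n).Adj x x' := step_adj hx1
  have hd : treeDist 1 x = treeDist 1 x' + 1 := by
    rw [treeDist_comm, treeDist_comm 1]; exact step_dist hx1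
  rw [← treeDist_one] at hxR
  have hdown : ∀ u, (tree n).Adj x u → u ∈ X → u = x' := by
    intro u hu huX
    refine eq_step hu ?_
    have h1 := hmax u huX
    rw [← treeDist_one, ← treeDist_one, treeDist_comm 1, treeDist_comm 1] at h1
    have := adj_dist hu 1
    omega
  have hconst : ∀ ξ ∈ edgeShadow x' x, ∀ η ∈ edgeShadow x' x, val c ξ = val c η :=
    hball.const hd (by omega)
  by_cases hx'X : x' ∈ X
  · have hsup : SupportedOn c (X \ {x}) := by
      refine supportedOn_of_constOff hW (isSubtree_of_step_mem ?_)
        (hX.1.1.subset sdiff_subset) ⟨x', hx'X, hadj.ne.symm⟩ ?_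
      · rintro a ⟨ha, hax⟩ b ⟨hb, hbx⟩
        refine ⟨hsub.step_mem ha hb, fun h => ?_⟩
        have h : step a b = x := h
        have hab : a ≠ b := by rintro rfl; rw [step_self] at h; exact hax h
        have hxa : (tree n).Adj x a := by rw [← h]; exact (step_adj hab).symm
        have h1 := hdown a hxa ha
        have hxb : x ≠ b := fun h => hbx h.symm
        have h2 := hdown (step x b) (step_adj hxb) (hsub.step_mem hx hb)
        rcases step_or_step hxa b with h3 | h3
        · exact h3.2.1 h
        · exact h3.2.1 (h2.trans h1.symm)
      · rintro y ⟨hy, hyx⟩ a ha hya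
        by_cases hax : a = x
        · subst hax
          rw [hdown y hya.symm hy]
          exact hconst
        · exact hoff y hy a (fun h => ha ⟨h, hax⟩) hya
    exact (hX.2 hsup sdiff_subset hx).2 rfl
  -- Here the function is constant behind the edge from `x` to `x'`, and also behind the edge from
  -- `x''` to `x'`, as `x'` is still outside `B_R`; this is why the radius is `R + 1`. A third edge
  -- at `x'` makes the two regions overlap. They cover the boundary, so the class is constant and
  -- has empty support.
  · have hn2 : 2 ≤ n := by
      rcases n with - | - | n
      · exact absurd (Subsingleton.elim x 1) hx1
      · exact absurd rfl hn
      · omega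
    have hx'1 : x' ≠ 1 := by rintro h; rw [h] at hd; simp at hd; omega
    set x'' := step x' 1
    have hadj' : (tree n).Adj x' x'' := step_adj hx'1
    have hd' : treeDist 1 x' = treeDist 1 x'' + 1 := by
      rw [treeDist_comm, treeDist_comm 1]; exact step_dist hx'1
    have hconst' := hball.const hd' (by omega)
    obtain ⟨y, hy, hyx, hyx''⟩ := exists_third_neighbour hn2 x' x x''
    obtain ⟨ζ, hζ⟩ := edgeShadow_nonempty hy
    have hall : ∀ ξ, val c ξ = val c ζ := by
      intro ξ
      by_cases hξ : nxt x ξ = x'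
      · exact hoff x hx x' hx'X hadj ξ hξ ζ (edgeShadow_subset hadj hyx hζ)
      · refine hconst' ξ (nxt_of_nxt_ne hadj'.symm ?_) ζ (edgeShadow_subset hadj'.symm hyx'' hζ)
        rw [nxt_eq_of_ne hadj hξ]
        rintro h
        rw [h] at hd; omega
    exact hX.2 (supportedOn_empty fun ξ η => (hall ξ).trans (hall η).symm) (empty_subset X) hx

theorem relSupport_encard_le {X : Fin k → Set (F n)} {x : FreeMod n k} {c : F n} {t N : ℕ}
    (hx : x ∈ coeffIn fun j => {g | ∀ v ∈ X j, treeDist c (g⁻¹ * v) ≤ t})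
    (hN : (2 * n + 1) ^ t ≤ N) : (relSupport X x).encard ≤ (N : ℕ∞) := by
  have h1 : relSupport X x ⊆ ballAt c t := by
    refine Set.sInter_subset_of_mem ⟨isSubtree_ballAt c t, ?_⟩
    refine Set.iUnion_subset fun j => Set.iUnion₂_subset fun g hg => ?_
    rintro _ ⟨v, hv, rfl⟩
    exact hx j g (Finsupp.mem_support_iff.1 hg) v hv
  refine (Set.encard_le_encard h1).trans ((ballAt_encard_le c t).trans ?_)
  exact_mod_cast hN

end SupportPosition

/-! ## Rank one -/

section RankOne

variable {W : Set (F 1)} {k : ℕ}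

theorem rayTo_rankOne {x : F 1} {ξ : Boundary 1} {s : Fin 1 × Bool}
    (h : nxt x ξ = x * letter s) (m : ℕ) : (rayTo x ξ).pt m = x * letter s ^ m := by
  have key : ∀ m, (rayTo x ξ).pt m = x * letter s ^ m ∧
      (rayTo x ξ).pt (m + 1) = x * letter s ^ (m + 1) := by
    intro m
    induction m with
    | zero => exact ⟨by simp, by rw [zero_add, pow_one]; exact h⟩
    | succ m ih =>
      refine ⟨ih.2, ?_⟩
      obtain ⟨t, ht⟩ := adj_iff_letter.1 ((rayTo x ξ).adj (m + 1))
      by_cases hts : t = s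
      · rw [ht, ih.2, hts, mul_assoc, ← pow_succ]
      · exfalso
        refine (rayTo x ξ).noBacktrack m ?_
        have hinv : letter t = (letter s)⁻¹ := by
          obtain ⟨i, b⟩ := s
          obtain ⟨j, d⟩ := t
          obtain rfl := Subsingleton.elim i j
          rw [← letter_not]
          congr 2
          cases b <;> cases d <;> simp_all
        rw [ht, ih.1, ih.2, hinv, pow_succ]
        group
  exact (key m).1

theorem boundary_eq_of_nxt_rankOne {x : F 1} {ξ η : Boundary 1} (h : nxt x ξ = nxt x η) :
    ξ = η := by
  obtain ⟨s, hs⟩ := adj_iff_letter.1 (nxt_adj x ξ)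
  exact boundary_ext (x := x) fun m => by
    rw [rayTo_rankOne hs, rayTo_rankOne (h.symm.trans hs)]

/-- Translation by a letter shifts a ray from the identity along itself, forwards or backwards, so
the end is fixed. -/
theorem smul_rankOne (g : F 1) (ξ : Boundary 1) : g • ξ = ξ := by
  refine tree_induction (P := fun g : F 1 => g • ξ = ξ) 1 (one_smul _ ξ) ?_ g
  intro a b hab ha
  obtain ⟨s, rfl⟩ := adj_iff_letter.1 hab
  rw [mul_smul]
  suffices h : letter s • ξ = ξ by rw [h, ha]
  obtain ⟨t, ht⟩ := adj_iff_letter.1 (nxt_adj 1 ξ)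
  have hρ := rayTo_rankOne ht
  rw [← rayTo_limit 1 ξ, Ray.smul_limit, Ray.limit_eq_iff]
  simp only [Ray.smul_pt, hρ, one_mul]
  by_cases hts : t = s
  · exact ⟨0, 1, fun m => by rw [hts, ← pow_succ', zero_add, Nat.add_comm]⟩
  · refine ⟨1, 0, fun m => ?_⟩
    have hinv : letter s = (letter t)⁻¹ := by
      obtain ⟨i, b⟩ := s
      obtain ⟨j, d⟩ := t
      obtain rfl := Subsingleton.elim i j
      rw [← letter_not]
      congr 2
      cases b <;> cases d <;> simp_all
    rw [hinv, Nat.add_comm 1 m, pow_succ', inv_mul_cancel_left, zero_add]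

/-- Behind each edge there is only one boundary point, so every class is supported on every single
vertex. Minimality gives a support at most one vertex but does not bound its position. -/
theorem IsSupport.subset_singleton {Λ : ℕ} (hW : ∀ w ∈ W, w.norm ≤ Λ) {c : Cech (Decomp W)}
    {X : Set (F 1)} (hX : IsSupport c X) {x : F 1} (hx : x ∈ X) : X ⊆ {x} := by
  refine hX.2 (supportedOn_of_constOff hW (isSubtree_singleton x) (finite_singleton x)
    (singleton_nonempty x) ?_) (singleton_subset_iff.2 hx)
  intro y _ a _ _ ξ hξ η hη
  rw [boundary_eq_of_nxt_rankOne ((mem_edgeShadow.1 hξ).trans (mem_edgeShadow.1 hη).symm)]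

theorem smul_cech_rankOne (g : F 1) (c : Cech (Decomp W)) : op g • c = c :=
  val_injective (funext fun ξ => by rw [val_smul, smul_rankOne])

/-- In rank one the relations are generated by those with supports of at most two vertices. -/
theorem ker_le_rankOne {σ : Fin k → Cech (Decomp W)} {X : Fin k → Set (F 1)}
    (hX : ∀ j, ∃ x, X j ⊆ {x}) {K : AddSubgroup (FreeMod 1 k)} (hK : ∀ (c : F 1) (x : FreeMod 1 k),
      (x ∈ coeffIn fun j => {g | ∀ v ∈ X j, treeDist c (g⁻¹ * v) ≤ 1}) → presMap σ x = 0 → x ∈ K)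
    (hKker : K ≤ (presMap σ).ker) : (presMap σ).ker ≤ K := by
  choose x₀ hx₀ using hX
  let A : F 1 → Fin k → Set (F 1) := fun c j => {g | ∀ v ∈ X j, treeDist c (g⁻¹ * v) ≤ 1}
  have hA : ∀ j (y c : F 1), treeDist c y ≤ 1 → x₀ j * y⁻¹ ∈ A c j := by
    intro j y c h v hv
    rw [hx₀ j hv]
    simpa using h
  -- When `X j` is nonempty, the translate of it belonging to `x₀ j * y⁻¹` is `{y}`. Since the group
  -- acts trivially on classes, moving `y` to a neighbour changes the basis element by a relation
  -- with support in a ball of radius one.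
  have hstep : ∀ j (y : F 1), basisElt j (x₀ j * y⁻¹) - basisElt j (x₀ j * 1⁻¹) ∈ K := by
    intro j y
    refine tree_induction (P := fun y : F 1 => basisElt j (x₀ j * y⁻¹) -
      basisElt j (x₀ j * 1⁻¹) ∈ K) 1 (by rw [sub_self]; exact K.zero_mem) ?_ y
    intro a b hab ha
    rw [← sub_add_sub_cancel _ (basisElt j (x₀ j * a⁻¹))]
    refine K.add_mem (hK a _ (sub_mem ?_ ?_) ?_) ha
    · exact basisElt_mem_coeffIn (A := A a) j _ (hA j b a (adj_iff_dist.1 hab).le)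
    · exact basisElt_mem_coeffIn (A := A a) j _ (hA j a a (by rw [treeDist_self]; omega))
    · rw [map_sub, presMap_basisElt, presMap_basisElt, smul_cech_rankOne, smul_cech_rankOne,
        sub_self]
  intro x hx
  -- Modulo `K`, every basis element has been moved to the identity; for `x` in the kernel, what is
  -- left is a relation supported near the identity.
  have hsum : x ∈ K ⊔ coeffIn (A 1) := by
    refine eq_top_of_basisElt_mem (fun j g => ?_) x
    have h1 := hstep j (g⁻¹ * x₀ j)
    have h2 : x₀ j * (g⁻¹ * x₀ j)⁻¹ = g := by group
    rw [h2] at h1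
    rw [← sub_add_cancel (basisElt j g) (basisElt j (x₀ j * 1⁻¹))]
    exact AddSubgroup.add_mem_sup h1 (basisElt_mem_coeffIn j _ (hA j 1 1 (by simp)))
  obtain ⟨a, ha, b, hb, rfl⟩ := AddSubgroup.mem_sup.1 hsum
  refine K.add_mem ha (hK 1 b hb ?_)
  have h1 := AddMonoidHom.mem_ker.1 hx
  rwa [map_add, AddMonoidHom.mem_ker.1 (hKker ha), zero_add] at h1

end RankOne

/-! ## The computable bounds -/

section Bounds

theorem primrec_pow : Primrec₂ (fun a b : ℕ => a ^ b) :=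
  (Primrec.nat_rec (f := fun _ : ℕ => 1) (g := fun a (p : ℕ × ℕ) => p.2 * a) (Primrec.const 1)
    (Primrec.nat_mul.comp (Primrec.snd.comp Primrec.snd) Primrec.fst).to₂).of_eq fun a b => by
      induction b with
      | zero => rfl
      | succ b ih => rw [pow_succ, ← ih]

/-- A radius at which the connectivity behind the edges of the tree is stable. -/
def stableRadius (p : ℕ × List (List (ℕ × Bool))) : ℕ :=
  2 * p.1 * ((2 * p.1 + 1) ^ p.2.flatten.length * (2 * p.1 + 1) ^ p.2.flatten.length)

/-- A bound for the size of the supports of the generating relations. -/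
def relationBound (p : (ℕ × List (List (ℕ × Bool))) × ℕ) : ℕ :=
  (2 * p.1.1 + 1) ^ (3 * p.2 + 2)

theorem computable_stableRadius : Computable stableRadius := by
  have h1 : Primrec fun p : ℕ × List (List (ℕ × Bool)) => 2 * p.1 :=
    Primrec.nat_mul.comp (Primrec.const 2) Primrec.fst
  have h2 : Primrec fun p : ℕ × List (List (ℕ × Bool)) => p.2.flatten.length :=
    Primrec.list_length.comp (Primrec.list_flatten.comp Primrec.snd)
  have h3 : Primrec fun p : ℕ × List (List (ℕ × Bool)) =>
      (2 * p.1 + 1) ^ p.2.flatten.length := primrec_pow.comp (Primrec.succ.comp h1) h2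
  exact (Primrec.nat_mul.comp h1 (Primrec.nat_mul.comp h3 h3)).to_comp

theorem computable_relationBound : Computable relationBound := by
  have h1 : Primrec fun p : (ℕ × List (List (ℕ × Bool))) × ℕ => 2 * p.1.1 :=
    Primrec.nat_mul.comp (Primrec.const 2) (Primrec.fst.comp Primrec.fst)
  have h2 : Primrec fun p : (ℕ × List (List (ℕ × Bool))) × ℕ => 3 * p.2 + 2 :=
    Primrec.nat_add.comp (Primrec.nat_mul.comp (Primrec.const 3) Primrec.snd) (Primrec.const 2)
  exact (primrec_pow.comp (Primrec.succ.comp h1) h2).to_comp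

theorem norm_le_of_mem_wordSet {n : ℕ} {ws : List (List (Fin n × Bool))} {w : F n}
    (hw : w ∈ wordSet ws) : w.norm ≤ (encode ws).flatten.length := by
  obtain ⟨l, hl, rfl⟩ := hw
  refine FreeGroup.norm_mk_le.trans ?_
  have h1 : (l.map fun s : Fin n × Bool => (s.1.val, s.2)) ∈ encode ws :=
    List.mem_map.2 ⟨l, hl, rfl⟩
  have h2 := (List.sublist_flatten_of_mem h1).length_le
  rwa [List.length_map] at h2

end Bounds

end LinePattern

end

theorem mainTheorem4 :
    ∃ (R₀ : ℕ × List (List (ℕ × Bool)) → ℕ) (N : (ℕ × List (List (ℕ × Bool))) × ℕ → ℕ),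
      Computable R₀ ∧ Computable N ∧
      ∀ (n : ℕ) (ws : List (List (Fin n × Bool))) (R k : ℕ)
        (σ : Fin k → CechZero.Cech (LinePattern.Decomp (LinePattern.wordSet ws))),
        (∀ j, LinePattern.SupportedOn (σ j) (LinePattern.ball n R)) →
        (∀ c, LinePattern.SupportedOn c (LinePattern.ball n (R₀ (n, LinePattern.encode ws))) →
          c ∈ AddSubgroup.closure
            {d | ∃ j, ∃ g ∈ LinePattern.ball n R, d = MulOpposite.op g • σ j}) →
        Function.Surjective (LinePattern.presMap σ) ∧
        ∀ X : Fin k → Set (LinePattern.F n), (∀ j, LinePattern.IsSupport (σ j) (X j)) →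
          (LinePattern.presMap σ).ker = AddSubgroup.closure
            {x | x ∈ (LinePattern.presMap σ).ker ∧
              (LinePattern.relSupport X x).encard ≤ (N ((n, LinePattern.encode ws), R) : ℕ∞)} := by
  refine ⟨LinePattern.stableRadius, LinePattern.relationBound, LinePattern.computable_stableRadius,
    LinePattern.computable_relationBound, fun n ws R k σ hσ hgen => ?_⟩
  have hW := fun w (hw : w ∈ LinePattern.wordSet ws) => LinePattern.norm_le_of_mem_wordSet hw
  have H : LinePattern.Presented (LinePattern.wordSet ws) σ R
      (LinePattern.stableRadius (n, LinePattern.encode ws)) :=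
    ⟨LinePattern.stable_of_bound hW le_rfl, hσ,
      fun v f hf hv => LinePattern.exists_lift hW hgen v hf hv⟩
  refine ⟨H.surjective, fun X hX => ?_⟩
  have hle : AddSubgroup.closure {x | x ∈ (LinePattern.presMap σ).ker ∧
      (LinePattern.relSupport X x).encard ≤
        (LinePattern.relationBound ((n, LinePattern.encode ws), R) : ℕ∞)} ≤
      (LinePattern.presMap σ).ker := (AddSubgroup.closure_le _).2 fun x hx => hx.1
  refine le_antisymm ?_ hle
  -- In rank one a support `X j` may lie arbitrarily far from `B_R`, so closeness of the
  -- coefficients does not bound the support of a relation.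
  by_cases hn : n = 1
  · subst hn
    refine LinePattern.ker_le_rankOne (X := X) (fun j => ?_) (fun c x hx h0 => ?_) hle
    · rcases (X j).eq_empty_or_nonempty with h | ⟨x, hx⟩
      · exact ⟨1, by rw [h]; exact Set.empty_subset _⟩
      · exact ⟨x, (hX j).subset_singleton hW hx⟩
    · refine AddSubgroup.subset_closure ⟨h0, LinePattern.relSupport_encard_le hx ?_⟩
      exact Nat.pow_le_pow_right (by omega) (show 1 ≤ 3 * R + 2 by omega)
  -- The radius is `(2 * R + 1) + (R + 1)`: the distance of `g⁻¹` from the centre, plus the radius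
  -- of the ball containing `X j`.
  · refine H.ker_le fun c x hx h0 => AddSubgroup.subset_closure
      ⟨h0, LinePattern.relSupport_encard_le (c := c) (t := 3 * R + 2) ?_ le_rfl⟩
    intro j g hg v hv
    have h1 : LinePattern.treeDist c g⁻¹ ≤ 2 * R + 1 := hx j g hg
    have h2 : v.norm ≤ R + 1 := (hX j).subset_ball hW hn (hσ j) hv
    have h3 := LinePattern.treeDist_triangle c g⁻¹ (g⁻¹ * v)
    have h4 := LinePattern.treeDist_smul g⁻¹ 1 v
    rw [mul_one, LinePattern.treeDist_one] at h4
    change LinePattern.treeDist c (g⁻¹ * v) ≤ _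
    omega
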